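/- Let $(M,g)$ be a compact $n$-dimensional smooth Riemannian manifold without boundary, with Levi-Civita connection $\nabla$ and Laplacian $\Delta=\operatorname{tr}_g\nabla^2$. Let $b\ge 0$ be a constant, let $a$ be a positive smooth function on $M$, and put $$\tilde{\mathcal H}=\{\varphi\in C^\infty(M) : \Delta\varphi-b|\nabla\varphi|^2+a>0\}.$$ Let $u_0,u_1\in\tilde{\mathcal H}$. For all real numbers $K_1,\dots,K_6$ there is a constant $C$, depending only on $K_1,\dots,K_6$, $u_0$, $u_1$, $a$, $b$ and $(M,g)$, such that the following holds. Let $f$ be a positive smooth function on $M\times[0,1]$ and let $u$ be a smooth function on $M\times[0,1]$ with $$u_{tt}\left(\Delta u-b|\nabla u|^2+a\right)-|\nabla u_t|^2=f\quad\text{on } M\times[0,1],$$ with $u(\cdot,0)=u_0$, $u(\cdot,1)=u_1$ and $u(\cdot,t)\in\tilde{\mathcal H}$ for every $t\in[0,1]$. Suppose that, with all suprema taken over $M\times[0,1]$, $$\sup|\nabla u|\le K_1,\quad \sup|u_{tt}|\le K_2,\quad \sup|\Delta u|\le K_3,\quad \sup f\le K_4,\quad \sup|\nabla(f^{1/2})|\le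 K_5,\quad \sup|\nabla^2(f^{1/2})|\le K_6 .$$ Then $$\sup_{M\times[0,1]}|\nabla^2u|\le C .$$ Here $\nabla$, $\nabla^2$ and $\Delta$ act in the $M$ variable only, and $|\nabla^2\varphi|^2=\sum_{i,j}(\nabla^2\varphi(e_i,e_j))^2$ for an orthonormal basis $(e_i)$. -/

import Mathlib

open Bundle
open scoped Manifold ContDiff

set_option linter.unusedSectionVars false

noncomputable section

namespace ChenHe

/-! ### The Levi-Civita connection of a Riemannian manifold -/

variable {E : Type*} [NormedAddCommGroup E] [NormedSpace ℝ E] [FiniteDimensional ℝ E]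
  [CompleteSpace E]
  {H : Type*} [TopologicalSpace H] (I : ModelWithCorners ℝ E H)
  {M : Type*} [TopologicalSpace M] [ChartedSpace H M] [IsManifold I ∞ M]
  [RiemannianBundle (fun x : M ↦ TangentSpace I x)]

/-- The right-hand side of the Koszul formula, including the factor `1 / 2`, so that
`⟨∇_X Y, Z⟩ = koszul I X Y Z`. -/
def koszul (X Y Z : Π x : M, TangentSpace I x) (x : M) : ℝ :=
  (1 / 2 : ℝ) *
    (mvfderiv I (fun y ↦ inner ℝ (Y y) (Z y)) x (X x)
      + mvfderiv I (fun y ↦ inner ℝ (X y) (Z y)) x (Y x)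
      - mvfderiv I (fun y ↦ inner ℝ (X y) (Y y)) x (Z x)
      + inner ℝ (VectorField.mlieBracket I X Y x) (Z x)
      - inner ℝ (VectorField.mlieBracket I X Z x) (Y x)
      - inner ℝ (VectorField.mlieBracket I Y Z x) (X x))

variable [IsContMDiffRiemannianBundle I ∞ E (fun x : M ↦ TangentSpace I x)]
variable {I}

theorem mdiff_inner {x : M} {Y Z : Π x : M, TangentSpace I x}
    (hY : MDiffAt (T% Y) x) (hZ : MDiffAt (T% Z) x) :
    MDifferentiableAt I (modelWithCornersSelf ℝ ℝ) (fun y ↦ (inner ℝ (Y y) (Z y) : ℝ)) x :=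
  MDifferentiableAt.inner_bundle (E := fun x : M ↦ TangentSpace I x) (IB := I) (F := E) hY hZ

theorem koszul_smul_left {x : M} {f : M → ℝ} {X Y Z : Π x : M, TangentSpace I x}
    (hf : MDiffAt f x)
    (hX : MDiffAt (T% X) x) (hY : MDiffAt (T% Y) x) (hZ : MDiffAt (T% Z) x) :
    koszul I (f • X) Y Z x = f x * koszul I X Y Z x := by
  have h1 := mvfderiv_fun_mul hf (mdiff_inner hX hZ)
  have h2 := mvfderiv_fun_mul hf (mdiff_inner hX hY)
  simp only [koszul, Pi.smul_apply', inner_smul_left, RCLike.conj_to_real, h1, h2,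
    VectorField.mlieBracket_smul_left hf hX, inner_add_left, inner_smul_right, map_smul,
    _root_.add_apply, _root_.smul_apply, smul_eq_mul, inner_neg_left, neg_smul]
  ring

theorem koszul_add_left {x : M} {X X' Y Z : Π x : M, TangentSpace I x}
    (hX : MDiffAt (T% X) x) (hX' : MDiffAt (T% X') x) (hY : MDiffAt (T% Y) x)
    (hZ : MDiffAt (T% Z) x) :
    koszul I (X + X') Y Z x = koszul I X Y Z x + koszul I X' Y Z x := by
  have h1 := mvfderiv_fun_add (mdiff_inner hX hZ) (mdiff_inner hX' hZ)
  have h2 := mvfderiv_fun_add (mdiff_inner hX hY) (mdiff_inner hX' hY)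
  simp only [koszul, Pi.add_apply, inner_add_left, inner_add_right, h1, h2, map_add,
    _root_.add_apply, VectorField.mlieBracket_add_left hX hX']
  ring

theorem koszul_smul_right {x : M} {f : M → ℝ} {X Y Z : Π x : M, TangentSpace I x}
    (hf : MDiffAt f x)
    (hX : MDiffAt (T% X) x) (hY : MDiffAt (T% Y) x) (hZ : MDiffAt (T% Z) x) :
    koszul I X Y (f • Z) x = f x * koszul I X Y Z x := by
  have h1 := mvfderiv_fun_mul hf (mdiff_inner hY hZ)
  have h2 := mvfderiv_fun_mul hf (mdiff_inner hX hZ)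
  simp only [koszul, Pi.smul_apply', inner_smul_left, RCLike.conj_to_real, h1, h2,
    VectorField.mlieBracket_smul_right hf hZ, inner_add_left, inner_smul_right, map_smul,
    _root_.add_apply, _root_.smul_apply, smul_eq_mul]
  rw [real_inner_comm (Y x) (Z x), real_inner_comm (X x) (Z x)]
  ring

theorem koszul_add_right {x : M} {X Y Z Z' : Π x : M, TangentSpace I x}
    (hX : MDiffAt (T% X) x) (hY : MDiffAt (T% Y) x)
    (hZ : MDiffAt (T% Z) x) (hZ' : MDiffAt (T% Z') x) :
    koszul I X Y (Z + Z') x = koszul I X Y Z x + koszul I X Y Z' x := by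
  have h1 := mvfderiv_fun_add (mdiff_inner hY hZ) (mdiff_inner hY hZ')
  have h2 := mvfderiv_fun_add (mdiff_inner hX hZ) (mdiff_inner hX hZ')
  simp only [koszul, Pi.add_apply, inner_add_left, inner_add_right, h1, h2, map_add,
    _root_.add_apply, VectorField.mlieBracket_add_right hZ hZ']
  ring

theorem koszul_smul_mid {x : M} {f : M → ℝ} {X Y Z : Π x : M, TangentSpace I x}
    (hf : MDiffAt f x)
    (hX : MDiffAt (T% X) x) (hY : MDiffAt (T% Y) x) (hZ : MDiffAt (T% Z) x) :
    koszul I X (f • Y) Z x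
      = f x * koszul I X Y Z x + mvfderiv I f x (X x) * inner ℝ (Y x) (Z x) := by
  have h1 := mvfderiv_fun_mul hf (mdiff_inner hY hZ)
  have h2 := mvfderiv_fun_mul hf (mdiff_inner hX hY)
  simp only [koszul, Pi.smul_apply', inner_smul_left, RCLike.conj_to_real, h1, h2,
    VectorField.mlieBracket_smul_left hf hY, VectorField.mlieBracket_smul_right hf hY,
    inner_add_left, inner_smul_right, map_smul, neg_smul, inner_neg_left,
    _root_.add_apply, _root_.smul_apply, smul_eq_mul]
  rw [real_inner_comm (X x) (Y x)]
  ring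

theorem koszul_add_mid {x : M} {X Y Y' Z : Π x : M, TangentSpace I x}
    (hX : MDiffAt (T% X) x) (hY : MDiffAt (T% Y) x) (hY' : MDiffAt (T% Y') x)
    (hZ : MDiffAt (T% Z) x) :
    koszul I X (Y + Y') Z x = koszul I X Y Z x + koszul I X Y' Z x := by
  have h1 := mvfderiv_fun_add (mdiff_inner hY hZ) (mdiff_inner hY' hZ)
  have h2 := mvfderiv_fun_add (mdiff_inner hX hY) (mdiff_inner hX hY')
  simp only [koszul, Pi.add_apply, inner_add_left, inner_add_right, h1, h2, map_add,
    _root_.add_apply, VectorField.mlieBracket_add_right hY hY',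
    VectorField.mlieBracket_add_left hY hY']
  ring

theorem koszul_tensorial_left {x : M} {Y Z : Π x : M, TangentSpace I x}
    (hY : MDiffAt (T% Y) x) (hZ : MDiffAt (T% Z) x) :
    TensorialAt I E (fun X ↦ koszul I X Y Z x) x where
  smul hf hX := koszul_smul_left hf hX hY hZ
  add hX hX' := koszul_add_left hX hX' hY hZ

theorem koszul_tensorial_right {x : M} {X Y : Π x : M, TangentSpace I x}
    (hX : MDiffAt (T% X) x) (hY : MDiffAt (T% Y) x) :
    TensorialAt I E (fun Z ↦ koszul I X Y Z x) x where
  smul hf hZ := koszul_smul_right hf hX hY hZ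
  add hZ hZ' := koszul_add_right hX hY hZ hZ'

/-- The bilinear form `(v, w) ↦ ⟨∇_v Y, w⟩` on `T_x M` given by the Koszul formula, for a vector
field `Y` differentiable at `x`. -/
def koszulForm (Y : Π x : M, TangentSpace I x) (x : M) (hY : MDiffAt (T% Y) x) :
    TangentSpace I x →L[ℝ] TangentSpace I x →L[ℝ] ℝ :=
  TensorialAt.mkHom₂ (I := I) (F := E) (F' := E) (fun X Z ↦ koszul I X Y Z x) x
    (fun _ hZ ↦ koszul_tensorial_left hY hZ) (fun _ hX ↦ koszul_tensorial_right hX hY)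


instance tangentSpace_finiteDimensional (x : M) : FiniteDimensional ℝ (TangentSpace I x) :=
  inferInstanceAs (FiniteDimensional ℝ E)

instance tangentSpace_completeSpace (x : M) : CompleteSpace (TangentSpace I x) :=
  FiniteDimensional.complete ℝ _

variable (I) in
/-- The musical isomorphism: the tangent vector `α♯` with `⟨α♯, w⟩ = α w` for all `w`. -/
def tangentSharp (x : M) : (TangentSpace I x →L[ℝ] ℝ) →ₗ[ℝ] TangentSpace I x where
  toFun α := (InnerProductSpace.toDual ℝ (TangentSpace I x)).symm α
  map_add' α β := map_add _ α β
  map_smul' c α := by simp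

theorem inner_tangentSharp (x : M) (α : TangentSpace I x →L[ℝ] ℝ) (w : TangentSpace I x) :
    inner ℝ (tangentSharp I x α) w = α w :=
  InnerProductSpace.toDual_symm_apply (𝕜 := ℝ) (E := TangentSpace I x)

open Classical in
/-- The map `Y ↦ (v ↦ ∇_v Y)` with `⟨∇_X Y, Z⟩` given by the Koszul formula (and `0` at points
where `Y` is not differentiable). -/
def leviCivitaFun (Y : Π x : M, TangentSpace I x) (x : M) :
    TangentSpace I x →L[ℝ] TangentSpace I x :=
  if hY : MDiffAt (T% Y) x then
    LinearMap.toContinuousLinearMap (tangentSharp I x ∘ₗ (koszulForm Y x hY).toLinearMap)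
  else 0

theorem inner_leviCivitaFun {x : M} {X Y Z : Π x : M, TangentSpace I x}
    (hX : MDiffAt (T% X) x) (hY : MDiffAt (T% Y) x) (hZ : MDiffAt (T% Z) x) :
    inner ℝ (leviCivitaFun Y x (X x)) (Z x) = koszul I X Y Z x := by
  rw [leviCivitaFun, dif_pos hY]
  exact (inner_tangentSharp x _ _).trans (TensorialAt.mkHom₂_apply _ _ hX hZ)

theorem leviCivitaFun_ext {x : M} {A B : TangentSpace I x →L[ℝ] TangentSpace I x}
    (h : ∀ X Z : Π x : M, TangentSpace I x, MDiffAt (T% X) x → MDiffAt (T% Z) x →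
      (inner ℝ (A (X x)) (Z x) : ℝ) = inner ℝ (B (X x)) (Z x)) : A = B := by
  ext v
  refine ext_inner_right ℝ fun w ↦ ?_
  have := h (FiberBundle.extend E v) (FiberBundle.extend E w)
    (FiberBundle.mdifferentiableAt_extend ..) (FiberBundle.mdifferentiableAt_extend ..)
  simpa using this

variable (I M) in
/-- The Levi-Civita connection; `leviCivita I M Y x v` is `∇_v Y` at `x`. It is torsion-free
(`leviCivita_torsion`) and compatible with the metric (`leviCivita_metric`). -/
def leviCivita : CovariantDerivative I E (fun x : M ↦ TangentSpace I x) where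
  toFun := leviCivitaFun
  isCovariantDerivativeOnUniv :=
    { add := by
        intro Y Y' x hY hY' _
        refine leviCivitaFun_ext fun X Z hX hZ ↦ ?_
        rw [_root_.add_apply, inner_add_left,
          inner_leviCivitaFun hX (mdifferentiableAt_add_section hY hY') hZ,
          inner_leviCivitaFun hX hY hZ, inner_leviCivitaFun hX hY' hZ,
          koszul_add_mid hX hY hY' hZ]
      leibniz := by
        intro Y f x hY hf _
        refine leviCivitaFun_ext fun X Z hX hZ ↦ ?_
        rw [_root_.add_apply, inner_add_left, _root_.smul_apply,
          inner_smul_left, inner_leviCivitaFun hX (hf.smul_section hY) hZ,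
          inner_leviCivitaFun hX hY hZ, koszul_smul_mid hf hX hY hZ,
          ContinuousLinearMap.smulRight_apply, inner_smul_left]
        simp }

theorem inner_leviCivita {x : M} {X Y Z : Π x : M, TangentSpace I x}
    (hX : MDiffAt (T% X) x) (hY : MDiffAt (T% Y) x) (hZ : MDiffAt (T% Z) x) :
    inner ℝ (leviCivita I M Y x (X x)) (Z x) = koszul I X Y Z x :=
  inner_leviCivitaFun hX hY hZ

theorem leviCivita_torsion : (leviCivita I M).torsion = 0 := by
  rw [CovariantDerivative.torsion_eq_zero_iff]
  intro X Y x hX hY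
  refine ext_inner_right ℝ fun w ↦ ?_
  have hW : MDiffAt (T% (FiberBundle.extend E w : Π x : M, TangentSpace I x)) x :=
    FiberBundle.mdifferentiableAt_extend ..
  have hw : (FiberBundle.extend E w : Π x : M, TangentSpace I x) x = w := by simp
  rw [← hw, inner_sub_left, inner_leviCivita hX hY hW, inner_leviCivita hY hX hW]
  rw [koszul, koszul, VectorField.mlieBracket_swap_apply (V := Y) (W := X), inner_neg_left]
  simp only [real_inner_comm]
  ring

theorem leviCivita_metric {x : M} {X Y Z : Π x : M, TangentSpace I x}
    (hX : MDiffAt (T% X) x) (hY : MDiffAt (T% Y) x) (hZ : MDiffAt (T% Z) x) :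
    mvfderiv I (fun y ↦ inner ℝ (Y y) (Z y)) x (X x)
      = inner ℝ (leviCivita I M Y x (X x)) (Z x) + inner ℝ (Y x) (leviCivita I M Z x (X x)) := by
  rw [real_inner_comm (leviCivita I M Z x (X x)), inner_leviCivita hX hY hZ,
    inner_leviCivita hX hZ hY, koszul, koszul,
    VectorField.mlieBracket_swap_apply (V := Z) (W := Y), inner_neg_left]
  simp only [real_inner_comm]
  ring

/-! ### Gradient, Hessian and Laplacian -/

variable (I)

/-- The gradient `∇φ`, the vector field with `⟨∇φ, w⟩ = dφ(w)`. -/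
def grad (φ : M → ℝ) (x : M) : TangentSpace I x :=
  tangentSharp I x (mvfderiv I φ x)

/-- The Hessian `∇²φ(v, w) = ⟨∇_v ∇φ, w⟩`. -/
def hess (φ : M → ℝ) (x : M) (v w : TangentSpace I x) : ℝ :=
  inner ℝ (leviCivita I M (grad I φ) x v) w

/-- The pointwise norm `|∇²φ|`: `|∇²φ|² = ∑ᵢⱼ ∇²φ(eᵢ, eⱼ)²` in an orthonormal basis `eᵢ`. -/
def hessNorm (φ : M → ℝ) (x : M) : ℝ :=
  √(∑ i, ∑ j, hess I φ x (stdOrthonormalBasis ℝ (TangentSpace I x) i)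
    (stdOrthonormalBasis ℝ (TangentSpace I x) j) ^ 2)

/-- The Laplace-Beltrami operator `Δφ`, the trace of `∇²φ`. -/
def laplacian (φ : M → ℝ) (x : M) : ℝ :=
  ∑ i, hess I φ x (stdOrthonormalBasis ℝ (TangentSpace I x) i)
    (stdOrthonormalBasis ℝ (TangentSpace I x) i)

/-! ### The Chen-He equation -/

/-- The space of smooth `φ` on `M` with `Δφ - b |∇φ|² + a > 0`. -/
def spaceH (a : M → ℝ) (b : ℝ) : Set (M → ℝ) :=
  {φ | ContMDiff I 𝓘(ℝ, ℝ) ∞ φ ∧ ∀ x, 0 < laplacian I φ x - b * ‖grad I φ x‖ ^ 2 + a x}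

/-- Smoothness on `M × [0, 1]` (up to the boundary) of a function of `x : M` and the time `t`. -/
def SmoothOnSlab (u : M → ℝ → ℝ) : Prop :=
  ContMDiffOn (I.prod 𝓘(ℝ, ℝ)) 𝓘(ℝ, ℝ) ∞ (fun p : M × ℝ ↦ u p.1 p.2)
    (Set.univ ×ˢ Set.Icc (0 : ℝ) 1)

/-- The time derivative `u_t` on `[0, 1]`, one-sided at the endpoints. -/
def timeDeriv (u : M → ℝ → ℝ) (x : M) (t : ℝ) : ℝ :=
  derivWithin (u x) (Set.Icc (0 : ℝ) 1) t

/-- The equation `u_tt (Δu - b |∇u|² + a) - |∇u_t|² = f` on `M × [0, 1]`. -/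
def SolvesChenHe (a : M → ℝ) (b : ℝ) (f u : M → ℝ → ℝ) : Prop :=
  ∀ x : M, ∀ t ∈ Set.Icc (0 : ℝ) 1,
    timeDeriv (timeDeriv u) x t *
        (laplacian I (fun y ↦ u y t) x - b * ‖grad I (fun y ↦ u y t) x‖ ^ 2 + a x)
      - ‖grad I (fun y ↦ timeDeriv u y t) x‖ ^ 2 = f x t

end ChenHe

end

open Filter Topology

noncomputable section

namespace ChenHe

/-! ### Christoffel symbols of a family of bilinear forms on a vector space. -/

section Christoffel

variable {F : Type*} [NormedAddCommGroup F] [NormedSpace ℝ F] [FiniteDimensional ℝ F]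

/-! The estimate is a maximum principle for `testFun`, that is ∇²u(ξ,ξ) + |∇u|²/2 + D t² over unit
tangent vectors ξ and times t. Write x = u_tt, y = Δu - b|∇u|² + a, z = ∇u_t and h = √f, so that the
equation reads xy - |z|² = h². Since y and f are positive, so is x, and the linearised operator Lφ =
y φ_tt - 2⟨z, ∇φ_t⟩ + x Δφ is nonpositive at an interior maximum of φ
(`contraction_nonpos_of_isLocalMax`).

At an interior maximum, choose coordinates whose Christoffel symbols vanish at the point and extend
ξ with constant components. Differentiating the equation twice along ξ gives L(u_ξξ) together with
2(x_ξ y_ξ - |z_ξ|²), and the latter is at most 2 h_ξ² because √(xy - |z|²) is concave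
(`lorentz_concavity`). Hence h_ξ² cancels and no lower bound on f is needed. The term L(|∇u|²/2)
contributes x|∇²u|²; its third derivatives are removed by the equation differentiated once. The
quadratic part of -b|∇u|² has a good sign since b ≥ 0, and L(D t²) = 2Dy. This is
`contraction_of_derivatives`.

With R = |∇²u| and κ = K₆ + K₁K₅, which bounds h_ξξ + ⟨∇u, ∇h⟩, the outcome is x R² + 2Dy - 2hκ ≤
x(1 + R)C. All errors carry the factor x because |z|² ≤ xy ≤ xY; this is essential, as x has no
uniform positive lower bound. Since h² ≤ xy and κ² < 2D, the arithmetic-geometric mean inequality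
gives x + 2Dy > 2hκ, which absorbs the term in h and bounds R (`quadratic_growth`,
`hessian_bound_of_contraction`).

At times 0 and 1 the Hessian is that of the boundary data. The resulting upper bound on ∇²u(ξ,ξ) and
the bound on Δu control every entry of the Hessian (`hessNorm_le_of_hess_le`).

For uniformity the coordinates are an explicit quadratic map (`normalMap`) depending smoothly on its
centre and frame. Orthonormal frames over a compact part of a chart form a compact set, so the
derivatives of the metric coefficients at the centre have common bounds (`exists_flatCoefficients`),
and finitely many charts suffice. The constant extension of ξ has length one only at the centre,
which is why the maximum is used in the homogeneous form `testFun_homogeneous`. -/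

theorem isInvertible_of_posDef {B : F →L[ℝ] F →L[ℝ] ℝ} (hB : ∀ v, v ≠ 0 → 0 < B v v) :
    B.IsInvertible := by
  have hinj : Function.Injective B := by
    refine (injective_iff_map_eq_zero B).2 fun v hv ↦ ?_
    by_contra h
    exact (hB v h).ne' (by rw [hv]; rfl)
  have hdim : Module.finrank ℝ F = Module.finrank ℝ (F →L[ℝ] ℝ) := by
    rw [← LinearMap.toContinuousLinearMap.finrank_eq]
    exact (Subspace.dual_finrank_eq (K := ℝ) (V := F)).symm
  exact ⟨(LinearEquiv.ofInjectiveOfFinrankEq B.toLinearMap hinj hdim).toContinuousLinearEquiv,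
    by ext; rfl⟩

theorem fderiv_clm_apply_apply {F : Type*} [NormedAddCommGroup F] [NormedSpace ℝ F]
    {g : F → F →L[ℝ] F →L[ℝ] ℝ} {y : F} (hd : DifferentiableAt ℝ g y) (u v w : F) :
    fderiv ℝ (fun z ↦ g z v w) y u = fderiv ℝ g y u v w := by
  have h1 : HasFDerivAt (fun z ↦ g z v) ((fderiv ℝ g y).flip v) y := by
    simpa using hd.hasFDerivAt.clm_apply (hasFDerivAt_const v y)
  have h2 := (h1.clm_apply (hasFDerivAt_const w y)).fderiv
  rw [h2]
  simp

section trilinear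

variable (T : F →L[ℝ] F →L[ℝ] F →L[ℝ] ℝ)

theorem trilinear_add_left (a b v w : F) : T (a + b) v w = T a v w + T b v w :=
  congrArg (fun B : F →L[ℝ] F →L[ℝ] ℝ ↦ B v w) (ContinuousLinearMap.map_add T a b)

theorem trilinear_smul_left (c : ℝ) (a v w : F) : T (c • a) v w = c * T a v w :=
  congrArg (fun B : F →L[ℝ] F →L[ℝ] ℝ ↦ B v w) (ContinuousLinearMap.map_smul T c a)

theorem trilinear_add_mid (a b v w : F) : T v (a + b) w = T v a w + T v b w :=
  congrArg (fun B : F →L[ℝ] ℝ ↦ B w) (ContinuousLinearMap.map_add (T v) a b)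

theorem trilinear_smul_mid (c : ℝ) (a v w : F) : T v (c • a) w = c * T v a w :=
  congrArg (fun B : F →L[ℝ] ℝ ↦ B w) (ContinuousLinearMap.map_smul (T v) c a)

theorem trilinear_add_right (a b v w : F) : T v w (a + b) = T v w a + T v w b :=
  ContinuousLinearMap.map_add (T v w) a b

theorem trilinear_smul_right (c : ℝ) (a v w : F) : T v w (c • a) = c * T v w a :=
  ContinuousLinearMap.map_smul (T v w) c a

end trilinear

/-- The Christoffel symbols of the first kind of a family `g` of bilinear forms. -/
def christoffelLower (g : F → F →L[ℝ] F →L[ℝ] ℝ) (y v w : F) : F →L[ℝ] ℝ :=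
  LinearMap.toContinuousLinearMap
    { toFun := fun u ↦ 1 / 2 * (fderiv ℝ g y v w u + fderiv ℝ g y w v u - fderiv ℝ g y u v w)
      map_add' := fun a b ↦ by
        rw [trilinear_add_left, trilinear_add_right, trilinear_add_right]; ring
      map_smul' := fun c a ↦ by
        rw [trilinear_smul_left, trilinear_smul_right, trilinear_smul_right]
        simp only [smul_eq_mul, RingHom.id_apply]; ring }

theorem christoffelLower_apply (g : F → F →L[ℝ] F →L[ℝ] ℝ) (y v w u : F) :
    christoffelLower g y v w u
      = 1 / 2 * (fderiv ℝ g y v w u + fderiv ℝ g y w v u - fderiv ℝ g y u v w) := rfl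

/-- The Christoffel symbols of the second kind of a family `g` of bilinear forms. -/
def christoffel (g : F → F →L[ℝ] F →L[ℝ] ℝ) (y : F) : F →L[ℝ] F →L[ℝ] F :=
  LinearMap.toContinuousBilinearMap <| LinearMap.mk₂ ℝ
    (fun v w ↦ (g y).inverse (christoffelLower g y v w))
    (fun _ _ _ ↦ by
      rw [← map_add]; congr 1; ext u
      rw [add_apply]; simp only [christoffelLower_apply]
      rw [trilinear_add_left, trilinear_add_mid, trilinear_add_mid]; ring)
    (fun _ _ _ ↦ by
      rw [← map_smul]; congr 1; ext u
      rw [smul_apply]; simp only [christoffelLower_apply, smul_eq_mul]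
      rw [trilinear_smul_left, trilinear_smul_mid, trilinear_smul_mid]; ring)
    (fun _ _ _ ↦ by
      rw [← map_add]; congr 1; ext u
      rw [add_apply]; simp only [christoffelLower_apply]
      rw [trilinear_add_left, trilinear_add_mid, trilinear_add_right]; ring)
    (fun _ _ _ ↦ by
      rw [← map_smul]; congr 1; ext u
      rw [smul_apply]; simp only [christoffelLower_apply, smul_eq_mul]
      rw [trilinear_smul_left, trilinear_smul_mid, trilinear_smul_right]; ring)

theorem christoffel_apply (g : F → F →L[ℝ] F →L[ℝ] ℝ) (y v w : F) :
    christoffel g y v w = (g y).inverse (christoffelLower g y v w) := rfl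

theorem metric_christoffel {g : F → F →L[ℝ] F →L[ℝ] ℝ} {y : F} (hg : (g y).IsInvertible)
    (v w u : F) : g y (christoffel g y v w) u
      = 1 / 2 * (fderiv ℝ g y v w u + fderiv ℝ g y w v u - fderiv ℝ g y u v w) := by
  rw [← christoffelLower_apply]
  exact congrArg (fun L : F →L[ℝ] ℝ ↦ L u) (hg.self_apply_inverse (christoffelLower g y v w))

theorem fderiv_metric_symm {g : F → F →L[ℝ] F →L[ℝ] ℝ} {y : F} (hd : DifferentiableAt ℝ g y)
    (hs : ∀ᶠ z in 𝓝 y, ∀ v w, g z v w = g z w v) (u v w : F) :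
    fderiv ℝ g y u v w = fderiv ℝ g y u w v := by
  rw [← fderiv_clm_apply_apply hd, ← fderiv_clm_apply_apply hd]
  congr 1
  exact Filter.EventuallyEq.fderiv_eq (hs.mono fun z hz ↦ hz v w)

theorem christoffel_symm {g : F → F →L[ℝ] F →L[ℝ] ℝ} {y : F} (hd : DifferentiableAt ℝ g y)
    (hs : ∀ᶠ z in 𝓝 y, ∀ v w, g z v w = g z w v) (v w : F) :
    christoffel g y v w = christoffel g y w v := by
  rw [christoffel_apply, christoffel_apply]
  congr 1
  ext u
  rw [christoffelLower_apply, christoffelLower_apply, fderiv_metric_symm hd hs u v w]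
  ring

/-- Metric compatibility in coordinates: the two lowered symbols add up and all but one derivative
cancel by symmetry. It is the reason the metric is constant to first order in the coordinates of
`normalMap`. -/
theorem fderiv_metric {g : F → F →L[ℝ] F →L[ℝ] ℝ} {y : F} (hg : (g y).IsInvertible)
    (hd : DifferentiableAt ℝ g y) (hs : ∀ᶠ z in 𝓝 y, ∀ v w, g z v w = g z w v) (u v w : F) :
    fderiv ℝ g y u v w = g y (christoffel g y u v) w + g y v (christoffel g y u w) := by
  rw [hs.self_of_nhds v, metric_christoffel hg, metric_christoffel hg,
    fderiv_metric_symm hd hs u v w, fderiv_metric_symm hd hs v u w,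
    fderiv_metric_symm hd hs w u v]
  ring

theorem contDiffOn_christoffel {g : F → F →L[ℝ] F →L[ℝ] ℝ} {U : Set F} (hU : IsOpen U)
    (hd : ContDiffOn ℝ ∞ g U) (hg : ∀ y ∈ U, (g y).IsInvertible) :
    ContDiffOn ℝ ∞ (christoffel g) U := by
  have hder (u v w : F) : ContDiffOn ℝ ∞ (fun y ↦ fderiv ℝ g y u v w) U := by
    have h1 : ContDiffOn ℝ ∞ (fun z ↦ g z v w) U :=
      (hd.clm_apply contDiffOn_const).clm_apply contDiffOn_const
    have h2 : ContDiffOn ℝ ∞ (fun y ↦ fderiv ℝ (fun z ↦ g z v w) y u) U :=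
      (h1.fderiv_of_isOpen hU (by simp)).clm_apply contDiffOn_const
    refine h2.congr fun y hy ↦ (fderiv_clm_apply_apply ?_ u v w).symm
    exact (hd.contDiffAt (hU.mem_nhds hy)).differentiableAt (by simp)
  refine contDiffOn_clm_apply.2 fun v ↦ contDiffOn_clm_apply.2 fun w ↦ ?_
  have h3 : ContDiffOn ℝ ∞ (fun y ↦ christoffelLower g y v w) U := by
    refine contDiffOn_clm_apply.2 fun u ↦ ?_
    simp only [christoffelLower_apply]
    exact contDiffOn_const.mul (((hder v w u).add (hder w v u)).sub (hder u v w))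
  have h4 : ContDiffOn ℝ ∞ (fun z ↦ (g z).inverse) U := fun y hy ↦
    ((hg y hy).contDiffAt_map_inverse).comp_contDiffWithinAt y (hd y hy)
  exact h4.clm_apply h3

end Christoffel

/-! ### Coordinate fields of a chart; the metric, gradient and Hessian in coordinates. -/

section ChartFrame

open VectorField

variable {n : ℕ} {M : Type*} [TopologicalSpace M] [ChartedSpace (EuclideanSpace ℝ (Fin n)) M]
  [IsManifold (𝓡 n) ∞ M]

/-- The constant vector field on Euclidean space. -/
def constField (v : EuclideanSpace ℝ (Fin n)) (y : EuclideanSpace ℝ (Fin n)) :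
    TangentSpace (𝓡 n) y := v

/-- The coordinate vector field with constant components `v` in the chart at `p`. -/
def chartField (p : M) (v : EuclideanSpace ℝ (Fin n)) : Π x : M, TangentSpace (𝓡 n) x :=
  mpullback (𝓡 n) (𝓡 n) (extChartAt (𝓡 n) p) (constField v)

theorem contMDiffAt_constField (v y : EuclideanSpace ℝ (Fin n)) :
    ContMDiffAt (𝓡 n) (𝓡 n).tangent ∞ (T% (constField v)) y := by
  rw [contMDiffAt_vectorSpace_iff_contDiffAt]
  exact contDiffAt_const

theorem contMDiffAt_chartField (p : M) (v : EuclideanSpace ℝ (Fin n)) {x : M}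
    (hx : x ∈ (extChartAt (𝓡 n) p).source) :
    ContMDiffAt (𝓡 n) (𝓡 n).tangent ∞ (T% (chartField p v)) x := by
  have : IsManifold (𝓡 n) 1 M := IsManifold.of_le (n := ∞) (by simp)
  refine ContMDiffAt.mpullback_vectorField_preimage (n := ∞) (contMDiffAt_constField v _)
    (contMDiffAt_extChartAt' (by simpa using hx)) (isInvertible_mfderiv_extChartAt hx) ?_
  simp

theorem chartField_add (p : M) (v w : EuclideanSpace ℝ (Fin n)) (x : M) :
    chartField p (v + w) x = chartField p v x + chartField p w x :=
  map_add (mfderiv (𝓡 n) (𝓡 n) (extChartAt (𝓡 n) p) x).inverse (constField v _) (constField w _)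

theorem chartField_smul (p : M) (c : ℝ) (v : EuclideanSpace ℝ (Fin n)) (x : M) :
    chartField p (c • v) x = c • chartField p v x :=
  map_smul (mfderiv (𝓡 n) (𝓡 n) (extChartAt (𝓡 n) p) x).inverse c (constField v _)

theorem chartField_bijective (p : M) {x : M} (hx : x ∈ (extChartAt (𝓡 n) p).source) :
    Function.Bijective (fun v : EuclideanSpace ℝ (Fin n) ↦ chartField p v x) :=
  have : IsManifold (𝓡 n) 1 M := IsManifold.of_le (n := ∞) (by simp)
  (isInvertible_mfderiv_extChartAt (I := 𝓡 n) (x := p) hx).inverse.bijective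

/-- Pullback commutes with the Lie bracket and constant fields commute. This removes the bracket
terms from the Koszul formula for coordinate fields. -/
theorem mlieBracket_chartField (p : M) (v w : EuclideanSpace ℝ (Fin n)) {x : M}
    (hx : x ∈ (extChartAt (𝓡 n) p).source) :
    mlieBracket (𝓡 n) (chartField p v) (chartField p w) x = 0 := by
  have : IsManifold (𝓡 n) (minSmoothness ℝ 2) M :=
    IsManifold.of_le (n := ∞) (by simp; exact WithTop.coe_le_coe.2 le_top)
  have h := mpullback_mlieBracket (I := 𝓡 n) (I' := 𝓡 n) (n := ∞)
    (f := extChartAt (𝓡 n) p) (x₀ := x) (V := constField v) (W := constField w)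
    ((contMDiffAt_constField v _).mdifferentiableAt (by simp))
    ((contMDiffAt_constField w _).mdifferentiableAt (by simp))
    (contMDiffAt_extChartAt' (by simpa using hx))
    (by simp; exact WithTop.coe_le_coe.2 le_top)
  refine h.symm.trans ?_
  have : mlieBracket (𝓡 n) (constField v) (constField w) = 0 := by
    rw [← mlieBracketWithin_univ, mlieBracketWithin_eq_lieBracketWithin]
    ext1 y
    have h1 (u : EuclideanSpace ℝ (Fin n)) : (constField u : EuclideanSpace ℝ (Fin n) → _)
      = fun _ ↦ u := rfl
    simp only [lieBracketWithin]
    erw [h1, h1]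
    simp
    rfl
  rw [this]
  simp

theorem mvfderiv_chartField (p : M) (v : EuclideanSpace ℝ (Fin n)) {x : M}
    (hx : x ∈ (extChartAt (𝓡 n) p).source) {φ : M → ℝ} (hφ : MDifferentiableAt (𝓡 n) 𝓘(ℝ, ℝ) φ x) :
    mvfderiv (𝓡 n) φ x (chartField p v x)
      = fderiv ℝ (fun y ↦ φ ((extChartAt (𝓡 n) p).symm y)) (extChartAt (𝓡 n) p x) v := by
  have : IsManifold (𝓡 n) 1 M := IsManifold.of_le (n := ∞) (by simp)
  set y := extChartAt (𝓡 n) p x with hy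
  have hyt : y ∈ (extChartAt (𝓡 n) p).target := (extChartAt (𝓡 n) p).map_source hx
  have hxy : (extChartAt (𝓡 n) p).symm y = x := (extChartAt (𝓡 n) p).left_inv hx
  have hs : MDifferentiableAt (𝓡 n) (𝓡 n) (extChartAt (𝓡 n) p).symm y := by
    have := mdifferentiableWithinAt_extChartAt_symm hyt
    rwa [ModelWithCorners.range_eq_univ, mdifferentiableWithinAt_univ] at this
  have hc : MDifferentiableAt (𝓡 n) 𝓘(ℝ, ℝ) (fun y ↦ φ ((extChartAt (𝓡 n) p).symm y)) y :=
    MDifferentiableAt.comp y (by rwa [hxy]) hs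
  have hev : φ =ᶠ[𝓝 x] (fun y ↦ φ ((extChartAt (𝓡 n) p).symm y)) ∘ extChartAt (𝓡 n) p := by
    filter_upwards [extChartAt_source_mem_nhds' (I := 𝓡 n) hx] with z hz
    exact congrArg φ ((extChartAt (𝓡 n) p).left_inv hz).symm
  have h1 : mfderiv (𝓡 n) 𝓘(ℝ, ℝ) φ x = (mfderiv (𝓡 n) 𝓘(ℝ, ℝ)
      (fun y ↦ φ ((extChartAt (𝓡 n) p).symm y)) y).comp
      (mfderiv (𝓡 n) (𝓡 n) (extChartAt (𝓡 n) p) x) := by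
    rw [hev.mfderiv_eq]
    exact mfderiv_comp x hc (mdifferentiableAt_extChartAt (by simpa using hx))
  have h2 : mfderiv (𝓡 n) (𝓡 n) (extChartAt (𝓡 n) p) x (chartField p v x) = v :=
    (isInvertible_mfderiv_extChartAt (I := 𝓡 n) (M := M) hx).self_apply_inverse _
  rw [← mfderiv_eq_fderiv]
  change mfderiv (𝓡 n) 𝓘(ℝ, ℝ) φ x (chartField p v x) = _
  rw [h1]
  exact congrArg (mfderiv (𝓡 n) 𝓘(ℝ, ℝ) (fun y ↦ φ ((extChartAt (𝓡 n) p).symm y)) y) h2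


variable [RiemannianBundle (fun x : M ↦ TangentSpace (𝓡 n) x)]

/-- The coefficients of the metric in the chart at `p`. -/
def chartMetric (p : M) (y : EuclideanSpace ℝ (Fin n)) :
    EuclideanSpace ℝ (Fin n) →L[ℝ] EuclideanSpace ℝ (Fin n) →L[ℝ] ℝ :=
  LinearMap.toContinuousBilinearMap <| LinearMap.mk₂ ℝ
    (fun v w ↦ inner ℝ (chartField p v ((extChartAt (𝓡 n) p).symm y))
      (chartField p w ((extChartAt (𝓡 n) p).symm y)))
    (fun _ _ _ ↦ by rw [chartField_add, inner_add_left])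
    (fun _ _ _ ↦ by rw [chartField_smul, inner_smul_left]; rfl)
    (fun _ _ _ ↦ by rw [chartField_add, inner_add_right])
    (fun _ _ _ ↦ by rw [chartField_smul, inner_smul_right]; rfl)

theorem chartMetric_apply (p : M) (y v w : EuclideanSpace ℝ (Fin n)) :
    chartMetric p y v w = inner ℝ (chartField p v ((extChartAt (𝓡 n) p).symm y))
      (chartField p w ((extChartAt (𝓡 n) p).symm y)) := rfl

variable [IsContMDiffRiemannianBundle (𝓡 n) ∞ (EuclideanSpace ℝ (Fin n))
  (fun x : M ↦ TangentSpace (𝓡 n) x)]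

theorem contDiffOn_chartMetric (p : M) :
    ContDiffOn ℝ ∞ (chartMetric p) (extChartAt (𝓡 n) p).target := by
  refine contDiffOn_clm_apply.2 fun v ↦ contDiffOn_clm_apply.2 fun w ↦ ?_
  simp only [chartMetric_apply]
  rw [← contMDiffOn_iff_contDiffOn]
  have h1 : ContMDiffOn (𝓡 n) 𝓘(ℝ, ℝ) ∞ (fun x ↦ inner ℝ (chartField p v x) (chartField p w x))
      (extChartAt (𝓡 n) p).source := fun x hx ↦
    ((contMDiffAt_chartField p v hx).inner_bundle
      (contMDiffAt_chartField p w hx)).contMDiffWithinAt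
  exact h1.comp (contMDiffOn_extChartAt_symm p) (extChartAt (𝓡 n) p).mapsTo_symm

theorem chartMetric_symm (p : M) (y v w : EuclideanSpace ℝ (Fin n)) :
    chartMetric p y v w = chartMetric p y w v := by
  simp only [chartMetric_apply]
  exact real_inner_comm _ _

theorem chartMetric_pos (p : M) {y : EuclideanSpace ℝ (Fin n)}
    (hy : y ∈ (extChartAt (𝓡 n) p).target) {v : EuclideanSpace ℝ (Fin n)} (hv : v ≠ 0) :
    0 < chartMetric p y v v := by
  rw [chartMetric_apply]
  refine real_inner_self_pos.2 fun h ↦ hv ?_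
  refine (chartField_bijective p ((extChartAt (𝓡 n) p).map_target hy)).1 ?_
  have h0 : chartField p (0 : EuclideanSpace ℝ (Fin n)) ((extChartAt (𝓡 n) p).symm y) = 0 := by
    have := chartField_smul p (0 : ℝ) v ((extChartAt (𝓡 n) p).symm y)
    rwa [zero_smul, zero_smul] at this
  exact h.trans h0.symm

theorem isInvertible_chartMetric (p : M) {y : EuclideanSpace ℝ (Fin n)}
    (hy : y ∈ (extChartAt (𝓡 n) p).target) : (chartMetric p y).IsInvertible :=
  isInvertible_of_posDef fun _ hv ↦ chartMetric_pos p hy hv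

theorem isOpen_extChartAt_target_model (p : M) : IsOpen (extChartAt (𝓡 n) p).target :=
  isOpen_extChartAt_target p

theorem contDiffAt_chartMetric (p : M) {y : EuclideanSpace ℝ (Fin n)}
    (hy : y ∈ (extChartAt (𝓡 n) p).target) : ContDiffAt ℝ ∞ (chartMetric p) y :=
  (contDiffOn_chartMetric p).contDiffAt ((isOpen_extChartAt_target_model p).mem_nhds hy)

theorem inner_grad (φ : M → ℝ) (x : M) (w : TangentSpace (𝓡 n) x) :
    inner ℝ (grad (𝓡 n) φ x) w = mvfderiv (𝓡 n) φ x w :=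
  inner_tangentSharp x _ w

/-- The representative of a function in the chart at `p`. -/
abbrev chartRep (p : M) (φ : M → ℝ) (y : EuclideanSpace ℝ (Fin n)) : ℝ :=
  φ ((extChartAt (𝓡 n) p).symm y)

theorem contDiffOn_chartRep (p : M) {φ : M → ℝ} (hφ : ContMDiff (𝓡 n) 𝓘(ℝ, ℝ) ∞ φ) :
    ContDiffOn ℝ ∞ (chartRep p φ) (extChartAt (𝓡 n) p).target := by
  rw [← contMDiffOn_iff_contDiffOn]
  exact hφ.comp_contMDiffOn (contMDiffOn_extChartAt_symm p)

theorem grad_chart (p : M) {φ : M → ℝ} (hφ : ContMDiff (𝓡 n) 𝓘(ℝ, ℝ) ∞ φ) {x : M}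
    (hx : x ∈ (extChartAt (𝓡 n) p).source) :
    grad (𝓡 n) φ x = chartField p ((chartMetric p (extChartAt (𝓡 n) p x)).inverse
      (fderiv ℝ (chartRep p φ) (extChartAt (𝓡 n) p x))) x := by
  refine ext_inner_right ℝ fun w ↦ ?_
  obtain ⟨v, rfl⟩ := (chartField_bijective p hx).2 w
  have hy := (extChartAt (𝓡 n) p).map_source hx
  have h1 := chartMetric_apply p (extChartAt (𝓡 n) p x)
    ((chartMetric p (extChartAt (𝓡 n) p x)).inverse
      (fderiv ℝ (chartRep p φ) (extChartAt (𝓡 n) p x))) v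
  rw [(isInvertible_chartMetric p hy).self_apply_inverse, (extChartAt (𝓡 n) p).left_inv hx] at h1
  rw [← h1, inner_grad, mvfderiv_chartField p v hx (hφ.mdifferentiable (by simp) x)]

theorem chartField_sum (p : M) (v : EuclideanSpace ℝ (Fin n)) (x : M) :
    chartField p v x = ∑ i, v i • chartField p (EuclideanSpace.single i 1) x := by
  let L : EuclideanSpace ℝ (Fin n) →ₗ[ℝ] TangentSpace (𝓡 n) x :=
    { toFun := fun w ↦ chartField p w x
      map_add' := fun v w ↦ chartField_add p v w x
      map_smul' := fun c v ↦ chartField_smul p c v x }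
  have hv : v = ∑ i, v i • EuclideanSpace.single i (1 : ℝ) := by
    ext j; simp [Finset.sum_apply, Pi.single_apply]
  change L v = ∑ i, v i • L (EuclideanSpace.single i 1)
  conv_lhs => rw [hv, map_sum]
  exact Finset.sum_congr rfl fun i _ ↦ map_smul _ _ _

/-- The connection takes the junk value zero on fields that are not differentiable, so the Hessian
has its meaning only once the gradient is known to be smooth. The proof expands the gradient in the
coordinate frame with smooth coefficients. -/
theorem contMDiffAt_grad {φ : M → ℝ} (hφ : ContMDiff (𝓡 n) 𝓘(ℝ, ℝ) ∞ φ) (x : M) :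
    ContMDiffAt (𝓡 n) (𝓡 n).tangent ∞ (T% (grad (𝓡 n) φ)) x := by
  have hU := isOpen_extChartAt_target_model (n := n) x
  set U := (extChartAt (𝓡 n) x).target with hUdef
  have hc : ContDiffOn ℝ ∞ (fun y ↦ (chartMetric x y).inverse (fderiv ℝ (chartRep x φ) y)) U := by
    have h4 : ContDiffOn ℝ ∞ (fun z ↦ (chartMetric x z).inverse) U := fun y hy ↦
      ((isInvertible_chartMetric x hy).contDiffAt_map_inverse).comp_contDiffWithinAt y
        (contDiffOn_chartMetric x y hy)
    exact h4.clm_apply ((contDiffOn_chartRep x hφ).fderiv_of_isOpen hU (by simp))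
  have hsum : ContMDiffAt (𝓡 n) (𝓡 n).tangent ∞ (T% (fun z : M ↦ ∑ i : Fin n,
      ((fun z' : M ↦ ((chartMetric x (extChartAt (𝓡 n) x z')).inverse
        (fderiv ℝ (chartRep x φ) (extChartAt (𝓡 n) x z'))) i) •
        chartField x (EuclideanSpace.single i (1 : ℝ))) z)) x := by
    refine ContMDiffAt.sum_section fun i _ ↦ ContMDiffAt.smul_section ?_
      (contMDiffAt_chartField x _ (mem_extChartAt_source x))
    have hci : ContDiffAt ℝ ∞ (fun y ↦ ((chartMetric x y).inverse
        (fderiv ℝ (chartRep x φ) y)) i) (extChartAt (𝓡 n) x x) := by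
      have := (hc _ (mem_extChartAt_target x)).contDiffAt (hU.mem_nhds (mem_extChartAt_target x))
      exact (EuclideanSpace.proj (𝕜 := ℝ) i :
        EuclideanSpace ℝ (Fin n) →L[ℝ] ℝ).contDiff.contDiffAt.comp _ this
    exact hci.contMDiffAt.comp x (contMDiffAt_extChartAt (x := x))
  refine hsum.congr_of_eventuallyEq ?_
  filter_upwards [extChartAt_source_mem_nhds (I := 𝓡 n) x] with z hz
  have : grad (𝓡 n) φ z = ∑ i : Fin n,
      ((fun z' : M ↦ ((chartMetric x (extChartAt (𝓡 n) x z')).inverse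
        (fderiv ℝ (chartRep x φ) (extChartAt (𝓡 n) x z'))) i) •
        chartField x (EuclideanSpace.single i (1 : ℝ))) z := by
    rw [grad_chart x hφ hz]
    exact chartField_sum x _ z
  rw [this]

theorem mdiffAt_chartField (p : M) (v : EuclideanSpace ℝ (Fin n)) {x : M}
    (hx : x ∈ (extChartAt (𝓡 n) p).source) :
    MDifferentiableAt (𝓡 n) (𝓡 n).tangent (T% (chartField p v)) x :=
  (contMDiffAt_chartField p v hx).mdifferentiableAt (by simp)

theorem mvfderiv_inner_chartField (p : M) (u v w : EuclideanSpace ℝ (Fin n))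
    {y : EuclideanSpace ℝ (Fin n)} (hy : y ∈ (extChartAt (𝓡 n) p).target) :
    mvfderiv (𝓡 n) (fun z ↦ inner ℝ (chartField p v z) (chartField p w z))
      ((extChartAt (𝓡 n) p).symm y) (chartField p u ((extChartAt (𝓡 n) p).symm y))
      = fderiv ℝ (chartMetric p) y u v w := by
  have hx := (extChartAt (𝓡 n) p).map_target hy
  rw [mvfderiv_chartField p u hx
    (mdiff_inner (mdiffAt_chartField p v hx) (mdiffAt_chartField p w hx)),
    (extChartAt (𝓡 n) p).right_inv hy]
  exact fderiv_clm_apply_apply ((contDiffAt_chartMetric p hy).differentiableAt (by simp)) u v w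

theorem leviCivita_chartField (p : M) (v w : EuclideanSpace ℝ (Fin n))
    {y : EuclideanSpace ℝ (Fin n)} (hy : y ∈ (extChartAt (𝓡 n) p).target) :
    leviCivita (𝓡 n) M (chartField p w) ((extChartAt (𝓡 n) p).symm y)
      (chartField p v ((extChartAt (𝓡 n) p).symm y))
      = chartField p (christoffel (chartMetric p) y v w) ((extChartAt (𝓡 n) p).symm y) := by
  have hx := (extChartAt (𝓡 n) p).map_target hy
  refine ext_inner_right ℝ fun b ↦ ?_
  obtain ⟨u, rfl⟩ := (chartField_bijective p hx).2 b
  have h1 := metric_christoffel (isInvertible_chartMetric p hy) v w u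
  rw [chartMetric_apply] at h1
  rw [h1, inner_leviCivita (mdiffAt_chartField p v hx) (mdiffAt_chartField p w hx)
    (mdiffAt_chartField p u hx), koszul, mlieBracket_chartField p v w hx,
    mlieBracket_chartField p v u hx, mlieBracket_chartField p w u hx,
    mvfderiv_inner_chartField p v w u hy, mvfderiv_inner_chartField p w v u hy,
    mvfderiv_inner_chartField p u v w hy, inner_zero_left, inner_zero_left, inner_zero_left]
  ring

/-- Differentiate ⟨∇φ, W⟩ = dφ(W) along V for coordinate fields V and W: metric compatibility splits
off ⟨∇φ, ∇_V W⟩, which is the Christoffel term. -/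
theorem hess_chart (p : M) {φ : M → ℝ} (hφ : ContMDiff (𝓡 n) 𝓘(ℝ, ℝ) ∞ φ)
    {y : EuclideanSpace ℝ (Fin n)} (hy : y ∈ (extChartAt (𝓡 n) p).target)
    (v w : EuclideanSpace ℝ (Fin n)) :
    hess (𝓡 n) φ ((extChartAt (𝓡 n) p).symm y)
      (chartField p v ((extChartAt (𝓡 n) p).symm y))
      (chartField p w ((extChartAt (𝓡 n) p).symm y))
      = fderiv ℝ (fun z ↦ fderiv ℝ (chartRep p φ) z w) y v
        - fderiv ℝ (chartRep p φ) y (christoffel (chartMetric p) y v w) := by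
  have hx := (extChartAt (𝓡 n) p).map_target hy
  have hgrad : MDifferentiableAt (𝓡 n) (𝓡 n).tangent (T% (grad (𝓡 n) φ)) ((extChartAt (𝓡 n) p).symm y) :=
    (contMDiffAt_grad hφ _).mdifferentiableAt (by simp)
  have hw := mdiffAt_chartField p w hx
  have h1 := leviCivita_metric (mdiffAt_chartField p v hx) hgrad hw
  have h2 : inner ℝ (grad (𝓡 n) φ ((extChartAt (𝓡 n) p).symm y))
      (leviCivita (𝓡 n) M (chartField p w) ((extChartAt (𝓡 n) p).symm y)
      (chartField p v ((extChartAt (𝓡 n) p).symm y)))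
      = fderiv ℝ (chartRep p φ) y (christoffel (chartMetric p) y v w) := by
    rw [leviCivita_chartField p v w hy, inner_grad,
      mvfderiv_chartField p _ hx (hφ.mdifferentiable (by simp) _),
      (extChartAt (𝓡 n) p).right_inv hy]
  have h3 : mvfderiv (𝓡 n) (fun z ↦ inner ℝ (grad (𝓡 n) φ z) (chartField p w z))
      ((extChartAt (𝓡 n) p).symm y) (chartField p v ((extChartAt (𝓡 n) p).symm y))
      = fderiv ℝ (fun z ↦ fderiv ℝ (chartRep p φ) z w) y v := by
    rw [mvfderiv_chartField p v hx (mdiff_inner hgrad hw), (extChartAt (𝓡 n) p).right_inv hy]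
    congr 1
    refine Filter.EventuallyEq.fderiv_eq ?_
    filter_upwards [(isOpen_extChartAt_target_model p).mem_nhds hy] with z hz
    have hz' := (extChartAt (𝓡 n) p).map_target hz
    rw [inner_grad, mvfderiv_chartField p _ hz' (hφ.mdifferentiable (by simp) _),
      (extChartAt (𝓡 n) p).right_inv hz]
  rw [h2, h3] at h1
  rw [hess]
  linarith

end ChartFrame

/-! ### Calculus of iterated directional derivatives, and conditions at a local maximum. -/

section Directional

variable {V : Type*} [NormedAddCommGroup V] [NormedSpace ℝ V]

/-- The derivative of `f` in the direction `w`. -/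
def dir (w : V) (f : V → ℝ) (p : V) : ℝ := fderiv ℝ f p w

variable {f g : V → ℝ} {p : V}

theorem two_le_infty : (2 : WithTop ℕ∞) ≤ ∞ := by
  exact WithTop.coe_le_coe.2 (le_top : (2 : ℕ∞) ≤ ⊤)

theorem eventually_differentiableAt_of_contDiffAt (hf : ContDiffAt ℝ ∞ f p) :
    ∀ᶠ q in 𝓝 p, DifferentiableAt ℝ f q :=
  ((hf.of_le (m := 1) (by exact_mod_cast le_top)).eventually (by simp)).mono
    fun _ h ↦ h.differentiableAt (by simp)

theorem contDiffAt_dir (w : V) (hf : ContDiffAt ℝ ∞ f p) : ContDiffAt ℝ ∞ (dir w f) p :=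
  (hf.fderiv_right (by simp)).clm_apply contDiffAt_const

theorem dir_congr (w : V) (h : f =ᶠ[𝓝 p] g) : dir w f =ᶠ[𝓝 p] dir w g := by
  filter_upwards [h.eventuallyEq_nhds] with q hq
  rw [dir, dir, hq.fderiv_eq]

theorem dir_add_dir (w w' : V) (f : V → ℝ) (p : V) : dir (w + w') f p = dir w f p + dir w' f p :=
  map_add _ _ _

theorem dir_smul_dir (c : ℝ) (w : V) (f : V → ℝ) (p : V) : dir (c • w) f p = c * dir w f p :=
  map_smul _ _ _

theorem dir_sum_dir {ι : Type*} (s : Finset ι) (c : ι → ℝ) (e : ι → V) (f : V → ℝ) (p : V) :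
    dir (∑ i ∈ s, c i • e i) f p = ∑ i ∈ s, c i * dir (e i) f p := by
  simp [dir, map_sum]

/-- The first order rules are equalities near `p`, not only at `p`, so that `dir_congr` allows them
to be differentiated again. -/
theorem dir_add (w : V) (hf : ContDiffAt ℝ ∞ f p) (hg : ContDiffAt ℝ ∞ g p) :
    dir w (fun q ↦ f q + g q) =ᶠ[𝓝 p] fun q ↦ dir w f q + dir w g q := by
  filter_upwards [eventually_differentiableAt_of_contDiffAt hf, eventually_differentiableAt_of_contDiffAt hg] with q h1 h2
  simp only [dir]
  rw [fderiv_fun_add h1 h2]; rfl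

theorem dir_sub (w : V) (hf : ContDiffAt ℝ ∞ f p) (hg : ContDiffAt ℝ ∞ g p) :
    dir w (fun q ↦ f q - g q) =ᶠ[𝓝 p] fun q ↦ dir w f q - dir w g q := by
  filter_upwards [eventually_differentiableAt_of_contDiffAt hf, eventually_differentiableAt_of_contDiffAt hg] with q h1 h2
  simp only [dir]
  rw [fderiv_fun_sub h1 h2]; rfl

theorem dir_mul (w : V) (hf : ContDiffAt ℝ ∞ f p) (hg : ContDiffAt ℝ ∞ g p) :
    dir w (fun q ↦ f q * g q) =ᶠ[𝓝 p] fun q ↦ dir w f q * g q + f q * dir w g q := by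
  filter_upwards [eventually_differentiableAt_of_contDiffAt hf, eventually_differentiableAt_of_contDiffAt hg] with q h1 h2
  simp only [dir]
  rw [fderiv_fun_mul h1 h2]
  simp only [add_apply, smul_apply, smul_eq_mul]
  ring

theorem dir_const_mul (w : V) (c : ℝ) (hf : ContDiffAt ℝ ∞ f p) :
    dir w (fun q ↦ c * f q) =ᶠ[𝓝 p] fun q ↦ c * dir w f q := by
  filter_upwards [eventually_differentiableAt_of_contDiffAt hf] with q h1
  simp only [dir]
  rw [fderiv_const_mul h1]; rfl

theorem dir_sum {ι : Type*} {s : Finset ι} (w : V) {F : ι → V → ℝ}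
    (hF : ∀ i ∈ s, ContDiffAt ℝ ∞ (F i) p) :
    dir w (fun q ↦ ∑ i ∈ s, F i q) =ᶠ[𝓝 p] fun q ↦ ∑ i ∈ s, dir w (F i) q := by
  have h : ∀ᶠ q in 𝓝 p, ∀ i ∈ s, DifferentiableAt ℝ (F i) q :=
    (Finset.eventually_all s).2 fun i hi ↦ eventually_differentiableAt_of_contDiffAt (hF i hi)
  filter_upwards [h] with q hq
  simp only [dir]
  rw [fderiv_fun_sum hq]
  simp

theorem dir_comm (w w' : V) (hf : ContDiffAt ℝ ∞ f p) :
    dir w (dir w' f) =ᶠ[𝓝 p] dir w' (dir w f) := by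
  filter_upwards [(hf.of_le two_le_infty).eventually (by simp)] with q hq
  have hd : DifferentiableAt ℝ (fderiv ℝ f) q :=
    (hq.fderiv_right (m := 1) (by norm_num)).differentiableAt (by simp)
  have key (a b : V) : dir a (dir b f) q = fderiv ℝ (fderiv ℝ f) q a b := by
    have h := (hd.hasFDerivAt.clm_apply (hasFDerivAt_const b q)).fderiv
    change fderiv ℝ (fun z ↦ fderiv ℝ f z b) q a = _
    rw [h]; simp
  rw [key, key]
  exact (hq.isSymmSndFDerivAt (by simp)) w w'

/-! ### Second derivatives at a point -/

theorem dir₂_add (w w' : V) (hf : ContDiffAt ℝ ∞ f p) (hg : ContDiffAt ℝ ∞ g p) :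
    dir w (dir w' fun q ↦ f q + g q) p = dir w (dir w' f) p + dir w (dir w' g) p := by
  rw [(dir_congr w (dir_add w' hf hg)).self_of_nhds]
  exact (dir_add w (contDiffAt_dir w' hf) (contDiffAt_dir w' hg)).self_of_nhds

theorem dir₂_sub (w w' : V) (hf : ContDiffAt ℝ ∞ f p) (hg : ContDiffAt ℝ ∞ g p) :
    dir w (dir w' fun q ↦ f q - g q) p = dir w (dir w' f) p - dir w (dir w' g) p := by
  rw [(dir_congr w (dir_sub w' hf hg)).self_of_nhds]
  exact (dir_sub w (contDiffAt_dir w' hf) (contDiffAt_dir w' hg)).self_of_nhds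

theorem dir₂_const_mul (w w' : V) (c : ℝ) (hf : ContDiffAt ℝ ∞ f p) :
    dir w (dir w' fun q ↦ c * f q) p = c * dir w (dir w' f) p := by
  rw [(dir_congr w (dir_const_mul w' c hf)).self_of_nhds]
  exact (dir_const_mul w c (contDiffAt_dir w' hf)).self_of_nhds

theorem dir₂_sum {ι : Type*} {s : Finset ι} (w w' : V) {F : ι → V → ℝ}
    (hF : ∀ i ∈ s, ContDiffAt ℝ ∞ (F i) p) :
    dir w (dir w' fun q ↦ ∑ i ∈ s, F i q) p = ∑ i ∈ s, dir w (dir w' (F i)) p := by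
  rw [(dir_congr w (dir_sum w' hF)).self_of_nhds]
  exact (dir_sum w fun i hi ↦ contDiffAt_dir w' (hF i hi)).self_of_nhds

theorem dir₂_mul (w w' : V) (hf : ContDiffAt ℝ ∞ f p) (hg : ContDiffAt ℝ ∞ g p) :
    dir w (dir w' fun q ↦ f q * g q) p = dir w (dir w' f) p * g p + dir w' f p * dir w g p
      + dir w f p * dir w' g p + f p * dir w (dir w' g) p := by
  rw [(dir_congr w (dir_mul w' hf hg)).self_of_nhds]
  rw [(dir_add w ((contDiffAt_dir w' hf).mul hg) (hf.mul (contDiffAt_dir w' hg))).self_of_nhds]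
  beta_reduce
  rw [(dir_mul w (contDiffAt_dir w' hf) hg).self_of_nhds,
    (dir_mul w hf (contDiffAt_dir w' hg)).self_of_nhds]
  ring

/-! ### Local maxima -/

/-- A positive second derivative at a critical point would also make it a local minimum. The
function would then be locally constant, with second derivative zero. -/
theorem deriv_deriv_nonpos_of_isLocalMax {φ : ℝ → ℝ} (hφ : ContDiffAt ℝ 2 φ 0)
    (hm : IsLocalMax φ 0) : deriv (deriv φ) 0 ≤ 0 := by
  by_contra h
  push Not at h
  have hmin : IsLocalMin φ 0 :=
    isLocalMin_of_deriv_deriv_pos h hm.deriv_eq_zero hφ.continuousAt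
  have hc : φ =ᶠ[𝓝 0] fun _ ↦ φ 0 := by
    filter_upwards [hm, hmin] with x h1 h2 using le_antisymm h1 h2
  have hd : deriv φ =ᶠ[𝓝 0] fun _ ↦ 0 := by
    filter_upwards [hc.eventuallyEq_nhds] with x hx
    rw [hx.deriv_eq]; simp
  rw [hd.deriv_eq] at h
  simp at h

theorem dir_eq_zero_of_isLocalMax (w : V) (hm : IsLocalMax f p) : dir w f p = 0 := by
  rw [dir, hm.fderiv_eq_zero]; rfl

theorem dir_dir_nonpos_of_isLocalMax (w : V) (hf : ContDiffAt ℝ ∞ f p) (hm : IsLocalMax f p) :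
    dir w (dir w f) p ≤ 0 := by
  have hl (s : ℝ) : HasDerivAt (fun s : ℝ ↦ p + s • w) w s := by
    simpa using ((hasDerivAt_id s).smul_const w).const_add p
  have hcont : ContinuousAt (fun s : ℝ ↦ p + s • w) 0 := (hl 0).continuousAt
  have htend : Tendsto (fun s : ℝ ↦ p + s • w) (𝓝 0) (𝓝 p) := by
    simpa [ContinuousAt] using hcont
  have key {g : V → ℝ} (hg : ContDiffAt ℝ ∞ g p) :
      deriv (fun s : ℝ ↦ g (p + s • w)) =ᶠ[𝓝 0] fun s ↦ dir w g (p + s • w) := by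
    filter_upwards [htend.eventually (eventually_differentiableAt_of_contDiffAt hg)] with s hs
    exact (hs.hasFDerivAt.comp_hasDerivAt s (hl s)).deriv
  have h2 : deriv (deriv (fun s : ℝ ↦ f (p + s • w))) 0 = dir w (dir w f) p := by
    rw [(key hf).deriv_eq, (key (contDiffAt_dir w hf)).self_of_nhds]
    simp
  rw [← h2]
  refine deriv_deriv_nonpos_of_isLocalMax ?_ ?_
  · have h3 : ContDiffAt ℝ 2 f (p + (0 : ℝ) • w) := by
      simpa using hf.of_le two_le_infty
    exact h3.comp (0 : ℝ) (contDiffAt_const.add (contDiffAt_id.smul contDiffAt_const))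
  · have : IsLocalMax f (p + (0 : ℝ) • w) := by simpa using hm
    exact this.comp_tendsto (g := fun s : ℝ ↦ p + s • w) (by simpa using htend)

/-- At a local maximum the contraction of the Hessian with the nonnegative form
`y τ² - 2 z · eτ + x |e|²`, `|z|² ≤ x y`, is nonpositive. -/
theorem contraction_nonpos_of_isLocalMax {n : ℕ} (e : Fin n → V) (τ : V) {x y : ℝ}
    {z : Fin n → ℝ} (hx : 0 < x) (hxy : ∑ k, z k ^ 2 ≤ x * y) (hf : ContDiffAt ℝ ∞ f p)
    (hm : IsLocalMax f p) :
    y * dir τ (dir τ f) p - 2 * ∑ k, z k * dir (e k) (dir τ f) p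
      + x * ∑ k, dir (e k) (dir (e k) f) p ≤ 0 := by
  have h0 := dir_dir_nonpos_of_isLocalMax τ hf hm
  have hk (k : Fin n) : x ^ 2 * dir (e k) (dir (e k) f) p
      - 2 * x * (z k * dir (e k) (dir τ f) p) + z k ^ 2 * dir τ (dir τ f) p ≤ 0 := by
    -- Completing the square: the form is 1/x times the sum of the squares of the directions x eₖ -
    -- zₖ τ, plus (xy - |z|²)/x times the square of τ.
    have h := dir_dir_nonpos_of_isLocalMax (x • e k + (-z k) • τ) hf hm
    have hin : dir (x • e k + (-z k) • τ) f
        = fun q ↦ x * dir (e k) f q + (-z k) * dir τ f q := by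
      ext q; rw [dir_add_dir, dir_smul_dir, dir_smul_dir]
    have h1 := contDiffAt_dir (e k) hf
    have h2 := contDiffAt_dir τ hf
    have hout (w : V) : dir w (dir (x • e k + (-z k) • τ) f) p
        = x * dir w (dir (e k) f) p + (-z k) * dir w (dir τ f) p := by
      rw [hin, (dir_add w (contDiffAt_const.mul h1) (contDiffAt_const.mul h2)).self_of_nhds]
      beta_reduce
      rw [(dir_const_mul w x h1).self_of_nhds, (dir_const_mul w (-z k) h2).self_of_nhds]
    rw [hout, dir_add_dir, dir_smul_dir, dir_smul_dir, dir_add_dir, dir_smul_dir, dir_smul_dir,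
      (dir_comm τ (e k) hf).self_of_nhds] at h
    linarith
  have hsum := Finset.sum_nonpos fun k (_ : k ∈ Finset.univ) ↦ hk k
  simp only [Finset.sum_add_distrib, Finset.sum_sub_distrib, ← Finset.mul_sum,
    ← Finset.sum_mul] at hsum
  have : x * (y * dir τ (dir τ f) p - 2 * ∑ k, z k * dir (e k) (dir τ f) p
      + x * ∑ k, dir (e k) (dir (e k) f) p) ≤ 0 := by nlinarith
  exact nonpos_of_mul_nonpos_right this hx

end Directional

/-! ### Pointwise algebra of the equation and of its derivatives at a maximum. -/

section Algebra

variable {n : ℕ}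

/-- Reversed Cauchy-Schwarz inequality: concavity of `√(x y - |z|²)` to second order. -/
theorem lorentz_concavity {x y x' y' h h' : ℝ} {z z' : Fin n → ℝ} (hx : 0 < x)
    (h0 : x * y - ∑ i, z i ^ 2 = h ^ 2)
    (h1 : x' * y + x * y' - 2 * ∑ i, z i * z' i = 2 * h * h') :
    x' * y' - ∑ i, z' i ^ 2 ≤ h' ^ 2 := by
  have hcs : 0 ≤ ∑ i, (x * z' i - x' * z i) ^ 2 := Finset.sum_nonneg fun i _ ↦ sq_nonneg _
  have hexp : ∑ i, (x * z' i - x' * z i) ^ 2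
      = x ^ 2 * ∑ i, z' i ^ 2 - 2 * x * x' * ∑ i, z i * z' i + x' ^ 2 * ∑ i, z i ^ 2 := by
    simp only [Finset.mul_sum, ← Finset.sum_sub_distrib, ← Finset.sum_add_distrib]
    exact Finset.sum_congr rfl fun i _ ↦ by ring
  rw [hexp] at hcs
  set Z := ∑ i, z i ^ 2
  set W := ∑ i, z i * z' i
  set Z' := ∑ i, z' i ^ 2
  have hW : 2 * W = x' * y + x * y' - 2 * h * h' := by linarith
  have hZ : Z = x * y - h ^ 2 := by linarith
  have : x ^ 2 * (x' * y' - Z') ≤ x ^ 2 * h' ^ 2 := by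
    -- The defect is a sum of squares, |x z' - x' z|² + (x h' - x' h)².
    have e : x ^ 2 * h' ^ 2 - x ^ 2 * (x' * y' - Z')
        = (x ^ 2 * Z' - 2 * x * x' * W + x' ^ 2 * Z) + (x * h' - x' * h) ^ 2 := by
      rw [hZ]
      linear_combination (x * x') * hW
    nlinarith [sq_nonneg (x * h' - x' * h)]
  exact le_of_mul_le_mul_left this (by positivity)

theorem abs_sum_le_card_mul {f : Fin n → ℝ} {c : ℝ} (h : ∀ i, |f i| ≤ c) :
    |∑ i, f i| ≤ n * c := by
  refine (Finset.abs_sum_le_sum_abs _ _).trans ?_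
  simpa using Finset.sum_le_card_nsmul Finset.univ (fun i ↦ |f i|) c fun i _ ↦ h i

theorem abs_sum_sum_le_card_mul {f : Fin n → Fin n → ℝ} {c : ℝ} (h : ∀ i j, |f i j| ≤ c) :
    |∑ i, ∑ j, f i j| ≤ n * (n * c) :=
  abs_sum_le_card_mul fun i ↦ abs_sum_le_card_mul (h i)

theorem abs_mul_le_mul' {s t a b : ℝ} (hs : |s| ≤ a) (ht : |t| ≤ b) : |s * t| ≤ a * b := by
  rw [abs_mul]
  exact mul_le_mul hs ht (abs_nonneg _) ((abs_nonneg _).trans hs)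

/-- Part of the term x R² beats x(1 + R)C once R > 2C + 2 and still leaves x over. Then x + 2Dy must
absorb 2hκ, which it does by the arithmetic-geometric mean inequality, because h² ≤ xy and κ² < 2D.
-/
theorem quadratic_growth {x y h D κ R C q : ℝ} (hx : 0 < x) (hy : 0 < y) (hh : 0 < h)
    (hD : κ ^ 2 < 2 * D) (hR : 0 ≤ R) (hC : 0 ≤ C) (hlt : 2 * C + 2 < R) (hq : -κ ≤ q)
    (hhxy : h ^ 2 ≤ x * y) : 0 < 2 * h * q + x * R ^ 2 + 2 * D * y - x * ((1 + R) * C) := by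
  have hquad : 1 + (1 + R) * C ≤ R ^ 2 := by
    nlinarith [mul_le_mul_of_nonneg_right hlt.le hR, mul_nonneg hR hC]
  by_contra hle
  push Not at hle
  have hlow : x + 2 * D * y ≤ 2 * h * κ := by
    have h1 := mul_le_mul_of_nonneg_left hquad hx.le
    have h2 := mul_le_mul_of_nonneg_left hq hh.le
    linarith
  have hD0 : 0 < D := by nlinarith [sq_nonneg κ]
  have hsq : (x + 2 * D * y) ^ 2 ≤ (2 * h * κ) ^ 2 :=
    pow_le_pow_left₀ (by positivity) hlow 2
  have hh2 : 0 < h ^ 2 := by positivity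
  have h3 := mul_le_mul_of_nonneg_left hhxy hD0.le
  have h4 := mul_lt_mul_of_pos_left hD hh2
  have h5 := sq_nonneg (x - 2 * D * y)
  linarith

set_option maxHeartbeats 1000000 in
/-- The algebraic core of the maximum principle argument. -/
theorem hessian_bound_of_contraction {Λ K b Y κ R : ℝ} (hΛ : 0 ≤ Λ) (hK : 0 ≤ K) (hb : 0 ≤ b)
    (hY : 0 ≤ Y)
    {x y h D : ℝ} (hx : 0 < x) (hyY : y ≤ Y) (hh : 0 < h) (hD : κ ^ 2 < 2 * D)
    {z q Hξ : Fin n → ℝ} {H : Fin n → Fin n → ℝ} (hR : 0 ≤ R) (hH : ∀ i j, |H i j| ≤ R)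
    (hHξ : ∀ i, |Hξ i| ≤ n * R) (hq : ∀ i, |q i| ≤ K)
    (h0 : x * y - ∑ i, z i ^ 2 = h ^ 2)
    {α : Fin n → Fin n → ℝ} (hα : ∀ i j, |α i j| ≤ Λ)
    {γ1 γ2 B1 : Fin n → Fin n → ℝ} {βξ β1ξ : Fin n → ℝ}
    (hβ : ∀ i, |βξ i| ≤ Λ) (hβ1 : ∀ i, |β1ξ i| ≤ Λ)
    (hγ1 : ∀ l k, |γ1 l k| ≤ Λ) (hγ2 : ∀ l k, |γ2 l k| ≤ Λ) (hB1 : ∀ k i, |B1 k i| ≤ Λ)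
    {aξ : ℝ} {a1 G2 : Fin n → ℝ} (haξ : |aξ| ≤ Λ) (ha1 : ∀ i, |a1 i| ≤ Λ)
    (hG2 : ∀ k, |G2 k| ≤ Λ) {α2 : Fin n → Fin n → Fin n → ℝ} (hα2 : ∀ i j k, |α2 i j k| ≤ Λ)
    {lam hq1 : ℝ} (hlam : |lam| ≤ n * (n * R)) (hκ : |hq1| ≤ κ)
    (hmain : 2 * h * hq1 + (∑ i, ∑ j, α i j * (z i * z j) + 2 * ∑ k, ∑ l, z k * (γ1 l k * z l)
        - 2 * ∑ k, ∑ i, z k * (z i * H i k)) + x * R ^ 2 + 2 * D * y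
      - x * (∑ i, ∑ j, α i j * H i j + ∑ k, (βξ k * q k + 2 * (β1ξ k * Hξ k))
        - b * ∑ i, ∑ j, α i j * (q i * q j) + aξ + ∑ k, ∑ l, (γ2 l k * q l + 2 * (γ1 l k * H k l))
        - 2 * b * ∑ k, ∑ l, q k * (γ1 l k * q l) + ∑ i, q i * (∑ k, B1 k i * q k + a1 i)
        - 1 / 2 * ∑ k, ∑ i, ∑ j, α2 i j k * (q i * q j) + lam * ∑ k, G2 k) ≤ 0) :
    R ≤ 2 * ((n * (n * (Λ * Y)) + 2 * (n * (n * (Λ * Y))) + 2 * (n * (n * Y))) +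
      (n * (n * Λ) + n * (Λ * K + 2 * (Λ * n)) + b * (n * (n * (Λ * (K * K)))) + Λ
        + n * (n * (Λ * K + 2 * Λ)) + 2 * b * (n * (n * (K * (Λ * K))))
        + n * (K * (n * (Λ * K) + Λ)) + 1 / 2 * (n * (n * (n * (Λ * (K * K)))))
        + n * n * (n * Λ))) + 2 := by
  -- `Ca` collects the terms quadratic in z, which are bounded by x times a constant through |z|² ≤
  -- xY; `Cb` collects the terms that carry the factor x explicitly.
  obtain ⟨Ca, hCa⟩ : ∃ Ca : ℝ, Ca = n * (n * (Λ * Y)) + 2 * (n * (n * (Λ * Y))) + 2 * (n * (n * Y)) := ⟨_, rfl⟩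
  obtain ⟨Cb, hCb⟩ : ∃ Cb : ℝ, Cb = n * (n * Λ) + n * (Λ * K + 2 * (Λ * n)) + b * (n * (n * (Λ * (K * K)))) + Λ
        + n * (n * (Λ * K + 2 * Λ)) + 2 * b * (n * (n * (K * (Λ * K))))
        + n * (K * (n * (Λ * K) + Λ)) + 1 / 2 * (n * (n * (n * (Λ * (K * K)))))
        + n * n * (n * Λ) := ⟨_, rfl⟩
  rw [← hCa, ← hCb]
  have hCa0 : 0 ≤ Ca := by rw [hCa]; positivity
  have hCb0 : 0 ≤ Cb := by rw [hCb]; positivity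
  by_contra hlt
  push Not at hlt
  have hZ0 : 0 ≤ ∑ i, z i ^ 2 := Finset.sum_nonneg fun i _ ↦ sq_nonneg _
  have hxy : 0 < x * y := by linarith [pow_pos hh 2]
  have hy : 0 < y := (mul_pos_iff_of_pos_left hx).1 hxy
  have hZ : ∑ i, z i ^ 2 ≤ x * Y := by linarith [sq_nonneg h, mul_le_mul_of_nonneg_left hyY hx.le]
  have hzz (i j : Fin n) : |z i * z j| ≤ x * Y := by
    have h1 (i : Fin n) : z i ^ 2 ≤ ∑ i, z i ^ 2 :=
      Finset.single_le_sum (f := fun i ↦ z i ^ 2) (fun i _ ↦ sq_nonneg _) (Finset.mem_univ i)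
    refine abs_le.2 ⟨?_, ?_⟩ <;>
      linarith [h1 i, h1 j, sq_nonneg (z i + z j), sq_nonneg (z i - z j)]
  have hqq (i j : Fin n) : |q i * q j| ≤ K * K := abs_mul_le_mul' (hq i) (hq j)
  have A1 := abs_le.1 (abs_sum_sum_le_card_mul fun i j ↦ abs_mul_le_mul' (hα i j) (hzz i j))
  have A2 : |∑ k, ∑ l, z k * (γ1 l k * z l)| ≤ n * (n * (Λ * (x * Y))) :=
    abs_sum_sum_le_card_mul fun k l ↦ by
      have := abs_mul_le_mul' (hγ1 l k) (hzz k l)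
      rwa [show γ1 l k * (z k * z l) = z k * (γ1 l k * z l) by ring] at this
  have A3 : |∑ k, ∑ i, z k * (z i * H i k)| ≤ n * (n * (x * Y * R)) :=
    abs_sum_sum_le_card_mul fun k i ↦ by
      have := abs_mul_le_mul' (hzz k i) (hH i k)
      rwa [mul_assoc (z k)] at this
  have B1' := abs_le.1 (abs_sum_sum_le_card_mul fun i j ↦ abs_mul_le_mul' (hα i j) (hH i j))
  have B2 : |∑ k, (βξ k * q k + 2 * (β1ξ k * Hξ k))| ≤ n * (Λ * K + 2 * (Λ * (n * R))) :=
    abs_sum_le_card_mul fun k ↦ (abs_add_le _ _).trans <|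
      add_le_add (abs_mul_le_mul' (hβ k) (hq k)) <| by
        rw [abs_mul, abs_two]
        exact mul_le_mul_of_nonneg_left (abs_mul_le_mul' (hβ1 k) (hHξ k)) zero_le_two
  have B3 := abs_le.1 (abs_sum_sum_le_card_mul fun i j ↦ abs_mul_le_mul' (hα i j) (hqq i j))
  have B4 : |∑ k, ∑ l, (γ2 l k * q l + 2 * (γ1 l k * H k l))| ≤ n * (n * (Λ * K + 2 * (Λ * R))) :=
    abs_sum_sum_le_card_mul fun k l ↦ (abs_add_le _ _).trans <|
      add_le_add (abs_mul_le_mul' (hγ2 l k) (hq l)) <| by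
        rw [abs_mul, abs_two]
        exact mul_le_mul_of_nonneg_left (abs_mul_le_mul' (hγ1 l k) (hH k l)) zero_le_two
  have B5 := abs_le.1 (abs_sum_sum_le_card_mul fun k l ↦
    abs_mul_le_mul' (hq k) (abs_mul_le_mul' (hγ1 l k) (hq l)))
  have B6 : |∑ i, q i * (∑ k, B1 k i * q k + a1 i)| ≤ n * (K * (n * (Λ * K) + Λ)) :=
    abs_sum_le_card_mul fun i ↦ abs_mul_le_mul' (hq i) <| (abs_add_le _ _).trans <|
      add_le_add (abs_sum_le_card_mul fun k ↦ abs_mul_le_mul' (hB1 k i) (hq k)) (ha1 i)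
  have B7 := abs_le.1 (abs_sum_le_card_mul fun k ↦ abs_sum_sum_le_card_mul fun i j ↦
    abs_mul_le_mul' (hα2 i j k) (hqq i j))
  have B8 := abs_le.1 (abs_mul_le_mul' hlam (abs_sum_le_card_mul hG2))
  rw [abs_le] at A2 A3 B2 B4 B6 haξ hκ
  set s1 := ∑ i, ∑ j, α i j * (z i * z j)
  set s2 := ∑ k, ∑ l, z k * (γ1 l k * z l)
  set s3 := ∑ k, ∑ i, z k * (z i * H i k)
  set t1 := ∑ i, ∑ j, α i j * H i j
  set t2 := ∑ k, (βξ k * q k + 2 * (β1ξ k * Hξ k))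
  set t3 := ∑ i, ∑ j, α i j * (q i * q j)
  set t4 := ∑ k, ∑ l, (γ2 l k * q l + 2 * (γ1 l k * H k l))
  set t5 := ∑ k, ∑ l, q k * (γ1 l k * q l)
  set t6 := ∑ i, q i * (∑ k, B1 k i * q k + a1 i)
  set t7 := ∑ k, ∑ i, ∑ j, α2 i j k * (q i * q j)
  set t8 := lam * ∑ k, G2 k
  have hN : (0 : ℝ) ≤ n := Nat.cast_nonneg n
  have e1 : t1 + t2 - b * t3 + aξ + t4 - 2 * b * t5 + t6 - 1 / 2 * t7 + t8 ≤ (1 + R) * Cb := by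
    have b3 : -(b * t3) ≤ b * (n * (n * (Λ * (K * K)))) := by
      linarith [mul_le_mul_of_nonneg_left B3.1 hb]
    have b5 : -(2 * b * t5) ≤ 2 * b * (n * (n * (K * (Λ * K)))) := by
      linarith [mul_le_mul_of_nonneg_left B5.1 hb]
    have step : t1 + t2 - b * t3 + aξ + t4 - 2 * b * t5 + t6 - 1 / 2 * t7 + t8 ≤
        n * (n * (Λ * R)) + n * (Λ * K + 2 * (Λ * (n * R))) + b * (n * (n * (Λ * (K * K)))) + Λ
        + n * (n * (Λ * K + 2 * (Λ * R))) + 2 * b * (n * (n * (K * (Λ * K))))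
        + n * (K * (n * (Λ * K) + Λ)) + 1 / 2 * (n * (n * (n * (Λ * (K * K)))))
        + n * (n * R) * (n * Λ) := by
      linarith [B1'.2, B2.2, B4.2, B6.2, B7.1, B8.2, haξ.2]
    refine step.trans ?_
    -- What is added when each bound linear in R, and each bound free of R, is enlarged to a
    -- multiple of 1 + R.
    have rest : 0 ≤ n * (n * Λ) + n * (2 * (Λ * n)) + n * (n * (2 * Λ)) + n * n * (n * Λ)
        + R * (n * (Λ * K) + b * (n * (n * (Λ * (K * K)))) + Λ
        + n * (n * (Λ * K)) + 2 * b * (n * (n * (K * (Λ * K))))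
        + n * (K * (n * (Λ * K) + Λ)) + 1 / 2 * (n * (n * (n * (Λ * (K * K)))))) := by
      positivity
    rw [hCb]
    linarith
  have e2 : -(x * ((1 + R) * Ca)) ≤ s1 + 2 * s2 - 2 * s3 := by
    have step : -(n * (n * (Λ * (x * Y))) + 2 * (n * (n * (Λ * (x * Y))))
        + 2 * (n * (n * (x * Y * R)))) ≤ s1 + 2 * s2 - 2 * s3 := by
      linarith [A1.1, A2.1, A3.2]
    refine le_trans ?_ step
    have rest : 0 ≤ x * (R * (n * (n * (Λ * Y)) + 2 * (n * (n * (Λ * Y)))) + 2 * (n * (n * Y))) := by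
      positivity
    rw [hCa]
    linarith
  have e3 := mul_le_mul_of_nonneg_left e1 hx.le
  have hmain' : 2 * h * hq1 + x * R ^ 2 + 2 * D * y - x * ((1 + R) * (Ca + Cb)) ≤ 0 := by
    linarith
  exact absurd hmain' (not_le.2 (quadratic_growth hx hy hh hD hR (add_nonneg hCa0 hCb0) hlt hκ.1
    (by linarith)))

/-- Combines the differentiated equation with the second order condition at a maximum. -/
theorem contraction_of_derivatives {b x y h D : ℝ} (hx : 0 < x) (hy : 0 ≤ y) (hb : 0 ≤ b)
    {z q Hξ zξ : Fin n → ℝ} {H : Fin n → Fin n → ℝ} (hsymm : ∀ i j, H i j = H j i)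
    {R : ℝ} (hRH : R ^ 2 = ∑ k, ∑ i, H i k ^ 2)
    {α : Fin n → Fin n → ℝ} {γ1 γ2 B1 : Fin n → Fin n → ℝ} {βξ β1ξ : Fin n → ℝ}
    {aξ : ℝ} {a1 G2 h1 : Fin n → ℝ} {α2 : Fin n → Fin n → Fin n → ℝ} {lam hξ hξξ xξ yξ yξξ : ℝ}
    {S1 : ℝ} {S2 S3 T U : Fin n → ℝ} {W X : Fin n → Fin n → ℝ}
    (hC : y * (S1 + ∑ i, (q i * U i + z i ^ 2) + 2 * D)
      - 2 * ∑ k, z k * (S2 k - ∑ l, γ1 l k * z l + ∑ i, (q i * W i k + H k i * z i))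
      + x * ∑ k, (S3 k - ∑ l, (γ2 l k * q l + 2 * (γ1 l k * H k l))
        + (1 / 2 * ∑ i, ∑ j, α2 i j k * (q i * q j) + ∑ i, (q i * X i k + H k i ^ 2))
        - lam * G2 k) ≤ 0)
    (hF : ∀ k, T k - ∑ l, γ1 l k * q l + ∑ i, q i * H k i = 0)
    (hE1 : ∀ i, U i * y + x * (∑ k, X i k + ∑ k, B1 k i * q k - b * ∑ k, 2 * (q k * H i k) + a1 i)
      - ∑ k, 2 * (z k * W i k) = 2 * h * h1 i)
    (hE2 : S1 * y + 2 * (xξ * yξ) + x * yξξ - (∑ i, ∑ j, α i j * (z i * z j)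
      + ∑ i, (2 * zξ i ^ 2 + 2 * (z i * S2 i))) = 2 * hξ ^ 2 + 2 * h * hξξ)
    (hYξξ : yξξ = ∑ i, ∑ j, α i j * H i j + ∑ i, S3 i + ∑ k, (βξ k * q k + 2 * (β1ξ k * Hξ k))
      - b * (∑ i, ∑ j, α i j * (q i * q j) + ∑ i, (2 * Hξ i ^ 2 + 2 * (q i * T i))) + aξ)
    (hconc : xξ * yξ - ∑ i, zξ i ^ 2 ≤ hξ ^ 2) :
    2 * h * (hξξ + ∑ i, q i * h1 i) + (∑ i, ∑ j, α i j * (z i * z j)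
        + 2 * ∑ k, ∑ l, z k * (γ1 l k * z l)
        - 2 * ∑ k, ∑ i, z k * (z i * H i k)) + x * R ^ 2 + 2 * D * y
      - x * (∑ i, ∑ j, α i j * H i j + ∑ k, (βξ k * q k + 2 * (β1ξ k * Hξ k))
        - b * ∑ i, ∑ j, α i j * (q i * q j) + aξ + ∑ k, ∑ l, (γ2 l k * q l + 2 * (γ1 l k * H k l))
        - 2 * b * ∑ k, ∑ l, q k * (γ1 l k * q l) + ∑ i, q i * (∑ k, B1 k i * q k + a1 i)
        - 1 / 2 * ∑ k, ∑ i, ∑ j, α2 i j k * (q i * q j) + lam * ∑ k, G2 k) ≤ 0 := by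
  have r1 : ∑ k, z k * (S2 k - ∑ l, γ1 l k * z l + ∑ i, (q i * W i k + H k i * z i))
      = ∑ k, z k * S2 k - ∑ k, ∑ l, z k * (γ1 l k * z l) + ∑ i, ∑ k, q i * (z k * W i k)
        + ∑ k, ∑ i, z k * (z i * H i k) := by
    rw [Finset.sum_comm (f := fun i k ↦ q i * (z k * W i k))]
    simp only [← Finset.sum_add_distrib, ← Finset.sum_sub_distrib]
    refine Finset.sum_congr rfl fun k _ ↦ ?_
    rw [mul_add, mul_sub, Finset.mul_sum, Finset.mul_sum, add_assoc, ← Finset.sum_add_distrib]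
    congr 1
    refine Finset.sum_congr rfl fun i _ ↦ ?_
    rw [hsymm k i]; ring
  have r2 : ∑ k, (S3 k - ∑ l, (γ2 l k * q l + 2 * (γ1 l k * H k l))
        + (1 / 2 * ∑ i, ∑ j, α2 i j k * (q i * q j) + ∑ i, (q i * X i k + H k i ^ 2))
        - lam * G2 k)
      = ∑ k, S3 k - ∑ k, ∑ l, (γ2 l k * q l + 2 * (γ1 l k * H k l))
        + 1 / 2 * ∑ k, ∑ i, ∑ j, α2 i j k * (q i * q j) + ∑ i, ∑ k, q i * X i k + R ^ 2
        - lam * ∑ k, G2 k := by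
    rw [hRH, Finset.sum_comm (f := fun i k ↦ q i * X i k)]
    simp only [Finset.sum_add_distrib, Finset.sum_sub_distrib, Finset.mul_sum]
    have : ∑ k, ∑ i, H k i ^ 2 = ∑ k, ∑ i, H i k ^ 2 :=
      Finset.sum_congr rfl fun k _ ↦ Finset.sum_congr rfl fun i _ ↦ by rw [hsymm]
    rw [this]
    ring
  -- The first order condition at the maximum trades the gradient of u_ξξ, a third derivative, for
  -- the Hessian.
  have r3 : ∑ k, q k * T k = ∑ k, ∑ l, q k * (γ1 l k * q l) - ∑ i, ∑ k, q i * (q k * H i k) := by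
    rw [← Finset.sum_sub_distrib]
    refine Finset.sum_congr rfl fun k _ ↦ ?_
    rw [← Finset.mul_sum, ← Finset.mul_sum, ← mul_sub]
    congr 1
    linarith [hF k]
  -- The once differentiated equation, paired with ∇u, replaces all third derivatives produced by
  -- L(|∇u|²/2).
  have r4 : y * ∑ i, q i * U i + x * (∑ i, ∑ k, q i * X i k
      + ∑ i, q i * (∑ k, B1 k i * q k + a1 i) - 2 * b * ∑ i, ∑ k, q i * (q k * H i k))
      - 2 * ∑ i, ∑ k, q i * (z k * W i k) = 2 * h * ∑ i, q i * h1 i := by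
    have t (F : Fin n → Fin n → ℝ) : ∑ i, ∑ k, q i * F i k = ∑ i, q i * ∑ k, F i k :=
      Finset.sum_congr rfl fun i _ ↦ (Finset.mul_sum ..).symm
    rw [t, t, t, Finset.mul_sum, Finset.mul_sum, Finset.mul_sum, ← Finset.sum_add_distrib,
      ← Finset.sum_sub_distrib, Finset.mul_sum, ← Finset.sum_add_distrib, Finset.mul_sum,
      ← Finset.sum_sub_distrib]
    refine Finset.sum_congr rfl fun i _ ↦ ?_
    have := hE1 i
    rw [← Finset.mul_sum, ← Finset.mul_sum] at this
    linear_combination q i * this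
  have r5 : ∑ i, (q i * U i + z i ^ 2) = ∑ i, q i * U i + ∑ i, z i ^ 2 :=
    Finset.sum_add_distrib
  have r6 : ∑ i, (2 * zξ i ^ 2 + 2 * (z i * S2 i)) = 2 * ∑ i, zξ i ^ 2 + 2 * ∑ k, z k * S2 k := by
    simp only [Finset.sum_add_distrib, Finset.mul_sum]
  have r7 : ∑ i, (2 * Hξ i ^ 2 + 2 * (q i * T i)) = 2 * ∑ i, Hξ i ^ 2 + 2 * ∑ k, q k * T k := by
    simp only [Finset.sum_add_distrib, Finset.mul_sum]
  -- The two good terms that are discarded: y|z|² comes from the second time derivative of |∇u|²/2,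
  -- and x b|∇u_ξ|² from the second ξ-derivative of -b|∇u|². The latter has this sign because b ≥ 0.
  have p1 : 0 ≤ y * ∑ i, z i ^ 2 := mul_nonneg hy (Finset.sum_nonneg fun i _ ↦ sq_nonneg _)
  have p2 : 0 ≤ x * (b * ∑ i, Hξ i ^ 2) :=
    mul_nonneg hx.le (mul_nonneg hb (Finset.sum_nonneg fun i _ ↦ sq_nonneg _))
  rw [r1, r2, r5] at hC
  rw [r6, hYξξ, r7, r3] at hE2
  linarith

end Algebra

/-! ### Derivatives of sums whose coefficients are trivial to first order at a point. -/

section FlatCoefficients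

variable {V : Type*} [NormedAddCommGroup V] [NormedSpace ℝ V] {f g : V → ℝ} {p : V} {n : ℕ}

theorem dir₁_add (w : V) (hf : ContDiffAt ℝ ∞ f p) (hg : ContDiffAt ℝ ∞ g p) :
    dir w (fun q ↦ f q + g q) p = dir w f p + dir w g p :=
  (dir_add w hf hg).self_of_nhds

theorem dir₁_sub (w : V) (hf : ContDiffAt ℝ ∞ f p) (hg : ContDiffAt ℝ ∞ g p) :
    dir w (fun q ↦ f q - g q) p = dir w f p - dir w g p :=
  (dir_sub w hf hg).self_of_nhds

theorem dir₁_mul (w : V) (hf : ContDiffAt ℝ ∞ f p) (hg : ContDiffAt ℝ ∞ g p) :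
    dir w (fun q ↦ f q * g q) p = dir w f p * g p + f p * dir w g p :=
  (dir_mul w hf hg).self_of_nhds

theorem dir₁_const_mul (w : V) (c : ℝ) (hf : ContDiffAt ℝ ∞ f p) :
    dir w (fun q ↦ c * f q) p = c * dir w f p :=
  (dir_const_mul w c hf).self_of_nhds

theorem dir₁_sum {ι : Type*} {s : Finset ι} (w : V) {F : ι → V → ℝ}
    (hF : ∀ i ∈ s, ContDiffAt ℝ ∞ (F i) p) :
    dir w (fun q ↦ ∑ i ∈ s, F i q) p = ∑ i ∈ s, dir w (F i) p :=
  (dir_sum w hF).self_of_nhds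

theorem dir_const (w : V) (c : ℝ) (p : V) : dir w (fun _ ↦ c) p = 0 := by
  simp [dir]

theorem dir₂_const (w w' : V) (c : ℝ) (p : V) : dir w (dir w' fun _ ↦ c) p = 0 := by
  have : dir w' (fun _ : V ↦ c) = fun _ ↦ 0 := funext fun q ↦ dir_const w' c q
  rw [this, dir_const]

variable {A F : Fin n → Fin n → V → ℝ}

theorem contDiffAt_sum_sum_mul (hA : ∀ i j, ContDiffAt ℝ ∞ (A i j) p)
    (hF : ∀ i j, ContDiffAt ℝ ∞ (F i j) p) :
    ContDiffAt ℝ ∞ (fun q ↦ ∑ i, ∑ j, A i j q * F i j q) p :=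
  ContDiffAt.sum fun i _ ↦ ContDiffAt.sum fun j _ ↦ (hA i j).mul (hF i j)

theorem flat_sum (hA0 : ∀ i j, A i j p = if i = j then 1 else 0) :
    ∑ i, ∑ j, A i j p * F i j p = ∑ i, F i i p := by
  simp [hA0]

theorem dir_flat_sum (hA : ∀ i j, ContDiffAt ℝ ∞ (A i j) p)
    (hF : ∀ i j, ContDiffAt ℝ ∞ (F i j) p) (hA0 : ∀ i j, A i j p = if i = j then 1 else 0)
    (hA1 : ∀ w i j, dir w (A i j) p = 0) (w : V) :
    dir w (fun q ↦ ∑ i, ∑ j, A i j q * F i j q) p = ∑ i, dir w (F i i) p := by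
  rw [dir₁_sum w fun i _ ↦ ContDiffAt.sum fun j _ ↦ (hA i j).mul (hF i j)]
  refine Finset.sum_congr rfl fun i _ ↦ ?_
  rw [dir₁_sum w fun j _ ↦ (hA i j).mul (hF i j)]
  simp only [dir₁_mul w (hA i _) (hF i _), hA1, hA0]
  simp

/-- The coefficients are the identity with zero first derivative at `p`, so the cross terms drop out
and only the second derivatives of `A`, the curvature-type terms, survive. -/
theorem dir₂_flat_sum (hA : ∀ i j, ContDiffAt ℝ ∞ (A i j) p)
    (hF : ∀ i j, ContDiffAt ℝ ∞ (F i j) p) (hA0 : ∀ i j, A i j p = if i = j then 1 else 0)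
    (hA1 : ∀ w i j, dir w (A i j) p = 0) (w w' : V) :
    dir w (dir w' fun q ↦ ∑ i, ∑ j, A i j q * F i j q) p
      = ∑ i, ∑ j, dir w (dir w' (A i j)) p * F i j p + ∑ i, dir w (dir w' (F i i)) p := by
  rw [dir₂_sum w w' fun i _ ↦ ContDiffAt.sum fun j _ ↦ (hA i j).mul (hF i j),
    ← Finset.sum_add_distrib]
  refine Finset.sum_congr rfl fun i _ ↦ ?_
  rw [dir₂_sum w w' fun j _ ↦ (hA i j).mul (hF i j)]
  simp only [dir₂_mul w w' (hA i _) (hF i _), hA1, hA0, Finset.sum_add_distrib]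
  simp

variable {B X : Fin n → V → ℝ}

theorem dir_null_sum (hB : ∀ k, ContDiffAt ℝ ∞ (B k) p) (hX : ∀ k, ContDiffAt ℝ ∞ (X k) p)
    (hB0 : ∀ k, B k p = 0) (w : V) :
    dir w (fun q ↦ ∑ k, B k q * X k q) p = ∑ k, dir w (B k) p * X k p := by
  rw [dir₁_sum w fun k _ ↦ (hB k).mul (hX k)]
  refine Finset.sum_congr rfl fun k _ ↦ ?_
  rw [dir₁_mul w (hB k) (hX k), hB0]
  ring

/-- The coefficients vanish at `p`, so the second derivatives of `X`, which would be third
derivatives of the solution for `X` a gradient, do not occur. -/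
theorem dir₂_null_sum (hB : ∀ k, ContDiffAt ℝ ∞ (B k) p) (hX : ∀ k, ContDiffAt ℝ ∞ (X k) p)
    (hB0 : ∀ k, B k p = 0) (w w' : V) :
    dir w (dir w' fun q ↦ ∑ k, B k q * X k q) p = ∑ k, (dir w (dir w' (B k)) p * X k p
      + dir w' (B k) p * dir w (X k) p + dir w (B k) p * dir w' (X k) p) := by
  rw [dir₂_sum w w' fun k _ ↦ (hB k).mul (hX k)]
  refine Finset.sum_congr rfl fun k _ ↦ ?_
  rw [dir₂_mul w w' (hB k) (hX k), hB0]
  ring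

theorem dir_comm_apply (w w' : V) (hf : ContDiffAt ℝ ∞ f p) :
    dir w (dir w' f) p = dir w' (dir w f) p :=
  (dir_comm w w' hf).self_of_nhds

/-- Moving two derivatives past two others. -/
theorem dir₄_comm (u u' w w' : V) (hf : ContDiffAt ℝ ∞ f p) :
    dir u (dir u' (dir w (dir w' f))) p = dir w (dir w' (dir u (dir u' f))) p := by
  have s {v : V} {f : V → ℝ} (hf : ContDiffAt ℝ ∞ f p) := contDiffAt_dir v hf
  calc dir u (dir u' (dir w (dir w' f))) p
      = dir u (dir w (dir u' (dir w' f))) p :=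
        (dir_congr u (dir_comm u' w (s hf))).self_of_nhds
    _ = dir w (dir u (dir u' (dir w' f))) p := dir_comm_apply u w (s (s hf))
    _ = dir w (dir u (dir w' (dir u' f))) p :=
        (dir_congr w (dir_congr u (dir_comm u' w' hf))).self_of_nhds
    _ = dir w (dir w' (dir u (dir u' f))) p :=
        (dir_congr w (dir_comm u w' (s hf))).self_of_nhds

theorem dir₃_comm (u w w' : V) (hf : ContDiffAt ℝ ∞ f p) :
    dir w (dir w' (dir u f)) p = dir u (dir w (dir w' f)) p :=
  ((dir_congr w (dir_comm w' u hf)).trans (dir_comm w u (contDiffAt_dir w' hf))).self_of_nhds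

end FlatCoefficients

/-! ### The Hessian bound at a local maximum, in coordinates geodesic at the point. -/

section Pointwise

variable {V : Type*} [NormedAddCommGroup V] [NormedSpace ℝ V] {n : ℕ}

/-- Second derivatives are bounded by the norm of the Hessian. -/
theorem abs_dir_dir_le {e : Fin n → V} {ξ p : V} {v : V → ℝ} {c : Fin n → ℝ}
    (hξ : ξ = ∑ i, c i • e i) (hc1 : ∀ i, |c i| ≤ 1) (hv : ContDiffAt ℝ ∞ v p) :
    (∀ i j, |dir (e i) (dir (e j) v) p| ≤ √(∑ k, ∑ i, dir (e i) (dir (e k) v) p ^ 2)) ∧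
    (∀ i, |dir ξ (dir (e i) v) p| ≤ n * √(∑ k, ∑ i, dir (e i) (dir (e k) v) p ^ 2)) ∧
    |dir ξ (dir ξ v) p| ≤ n * (n * √(∑ k, ∑ i, dir (e i) (dir (e k) v) p ^ 2)) := by
  have hH (i j : Fin n) :
      |dir (e i) (dir (e j) v) p| ≤ √(∑ k, ∑ i, dir (e i) (dir (e k) v) p ^ 2) := by
    refine Real.le_sqrt_of_sq_le ?_
    rw [sq_abs]
    refine le_trans ?_ (Finset.single_le_sum (f := fun k ↦ ∑ i, dir (e i) (dir (e k) v) p ^ 2)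
      (fun k _ ↦ Finset.sum_nonneg fun i _ ↦ sq_nonneg _) (Finset.mem_univ j))
    exact Finset.single_le_sum (f := fun i ↦ dir (e i) (dir (e j) v) p ^ 2)
      (fun i _ ↦ sq_nonneg _) (Finset.mem_univ i)
  have hHξ (i : Fin n) :
      |dir ξ (dir (e i) v) p| ≤ n * √(∑ k, ∑ i, dir (e i) (dir (e k) v) p ^ 2) := by
    rw [hξ, dir_sum_dir]
    refine abs_sum_le_card_mul fun k ↦ ?_
    simpa using abs_mul_le_mul' (hc1 k) (hH k i)
  refine ⟨hH, hHξ, ?_⟩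
  nth_rewrite 1 [hξ]
  rw [dir_sum_dir]
  refine abs_sum_le_card_mul fun k ↦ ?_
  rw [dir_comm_apply _ _ hv]
  simpa using abs_mul_le_mul' (hc1 k) (hHξ k)

/-- Coefficients of a Riemannian metric in coordinates which are geodesic at the point `p`:
`A` is the inverse metric, `B` the first order part of the Laplacian, `Γ` that of the second
covariant derivative in a fixed direction `ξ`, and `G` the squared length of `ξ`; all of them are
independent of the time direction `τ`. -/
structure FlatCoefficients (e : Fin n → V) (τ ξ p : V) (Λ : ℝ) (A : Fin n → Fin n → V → ℝ)
    (B Γ : Fin n → V → ℝ) (G : V → ℝ) : Prop where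
  smooth_A : ∀ i j, ContDiffAt ℝ ∞ (A i j) p
  smooth_B : ∀ i, ContDiffAt ℝ ∞ (B i) p
  smooth_Γ : ∀ i, ContDiffAt ℝ ∞ (Γ i) p
  smooth_G : ContDiffAt ℝ ∞ G p
  A_self : ∀ i j, A i j p = if i = j then 1 else 0
  dir_A : ∀ w i j, dir w (A i j) p = 0
  B_self : ∀ i, B i p = 0
  Γ_self : ∀ i, Γ i p = 0
  G_self : G p = 1
  dir_G : ∀ w, dir w G p = 0
  time_A : ∀ w i j, dir w (dir τ (A i j)) p = 0
  time_Γ : ∀ i, dir τ (Γ i) p = 0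
  time_Γ₂ : ∀ w i, dir w (dir τ (Γ i)) p = 0
  time_G : ∀ w, dir w (dir τ G) p = 0
  bound_A : ∀ i j k, |dir (e k) (dir (e k) (A i j)) p| ≤ Λ
  bound_Aξ : ∀ i j, |dir ξ (dir ξ (A i j)) p| ≤ Λ
  bound_B : ∀ i k, |dir (e k) (B i) p| ≤ Λ
  bound_Bξ : ∀ i, |dir ξ (B i) p| ≤ Λ
  bound_Bξ₂ : ∀ i, |dir ξ (dir ξ (B i)) p| ≤ Λ
  bound_Γ : ∀ i k, |dir (e k) (Γ i) p| ≤ Λ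
  bound_Γ₂ : ∀ i k, |dir (e k) (dir (e k) (Γ i)) p| ≤ Λ
  bound_G : ∀ k, |dir (e k) (dir (e k) G) p| ≤ Λ

/-- The constant in the pointwise Hessian bound. -/
def hessConst (n : ℕ) (Λ K b Y : ℝ) : ℝ :=
  2 * ((n * (n * (Λ * Y)) + 2 * (n * (n * (Λ * Y))) + 2 * (n * (n * Y))) +
      (n * (n * Λ) + n * (Λ * K + 2 * (Λ * n)) + b * (n * (n * (Λ * (K * K)))) + Λ
        + n * (n * (Λ * K + 2 * Λ)) + 2 * b * (n * (n * (K * (Λ * K))))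
        + n * (K * (n * (Λ * K) + Λ)) + 1 / 2 * (n * (n * (n * (Λ * (K * K)))))
        + n * n * (n * Λ))) + 2

variable {e : Fin n → V} {τ ξ p : V} {Λ : ℝ} {A : Fin n → Fin n → V → ℝ}
  {B Γ : Fin n → V → ℝ} {G a P v h : V → ℝ}

/-- The coordinate form of the maximum principle: `v` represents u, `h` represents √f and `P` stands
for D t². Since `M` is the value of the test function at `p`, the function assumed to have a local
maximum vanishes at `p`; the factor `G` accounts for the varying length of the direction `ξ`. -/
theorem hessian_bound_of_isLocalMax (hc : FlatCoefficients e τ ξ p Λ A B Γ G)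
    {c : Fin n → ℝ} (hξ : ξ = ∑ i, c i • e i) (hc1 : ∀ i, |c i| ≤ 1)
    {K b Y κ D M : ℝ} (hΛ : 0 ≤ Λ) (hK : 0 ≤ K) (hb : 0 ≤ b) (hY : 0 ≤ Y) (hD : κ ^ 2 < 2 * D)
    (ha : ContDiffAt ℝ ∞ a p) (ha1 : ∀ k, |dir (e k) a p| ≤ Λ) (haξ : |dir ξ (dir ξ a) p| ≤ Λ)
    (hP : ContDiffAt ℝ ∞ P p) (hP1 : ∀ k, dir (e k) P p = 0)
    (hPτ : dir τ (dir τ P) p = 2 * D) (hP2 : ∀ k w, dir (e k) (dir w P) p = 0)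
    (hv : ContDiffAt ℝ ∞ v p) (hh : ContDiffAt ℝ ∞ h p) (hpos : 0 < h p)
    (hx : 0 < dir τ (dir τ v) p)
    (heq : (fun q ↦ dir τ (dir τ v) q * (∑ i, ∑ j, A i j q * dir (e i) (dir (e j) v) q
        + ∑ k, B k q * dir (e k) v q - b * ∑ i, ∑ j, A i j q * (dir (e i) v q * dir (e j) v q)
        + a q) - ∑ i, ∑ j, A i j q * (dir (e i) (dir τ v) q * dir (e j) (dir τ v) q))
      =ᶠ[𝓝 p] fun q ↦ h q * h q)
    (hyY : ∑ i, dir (e i) (dir (e i) v) p - b * ∑ i, dir (e i) v p ^ 2 + a p ≤ Y)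
    (hq : ∀ i, |dir (e i) v p| ≤ K)
    (hκ : |dir ξ (dir ξ h) p + ∑ i, dir (e i) v p * dir (e i) h p| ≤ κ)
    (hM : dir ξ (dir ξ v) p + (1 / 2 * ∑ i, dir (e i) v p ^ 2 + P p) = M)
    (hmax : IsLocalMax (fun q ↦ (dir ξ (dir ξ v) q - ∑ k, Γ k q * dir (e k) v q)
      + (1 / 2 * ∑ i, ∑ j, A i j q * (dir (e i) v q * dir (e j) v q) + P q - M) * G q) p) :
    √(∑ k, ∑ i, dir (e i) (dir (e k) v) p ^ 2) ≤ hessConst n Λ K b Y := by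
  have s {w : V} {f : V → ℝ} (hf : ContDiffAt ℝ ∞ f p) : ContDiffAt ℝ ∞ (dir w f) p :=
    contDiffAt_dir w hf
  obtain ⟨hA, hB, hΓ, hG, hA0, hA1, hB0, hΓ0, hG0, hG1, hAτ, hΓτ, hΓτ2, hGτ, bA, bAξ, bB, bBξ,
    bBξ2, bΓ, bΓ2, bG⟩ := hc
  have hv1 (i : Fin n) : ContDiffAt ℝ ∞ (dir (e i) v) p := s hv
  have hv2 (i j : Fin n) : ContDiffAt ℝ ∞ (dir (e i) (dir (e j) v)) p := s (s hv)
  have hvt (i : Fin n) : ContDiffAt ℝ ∞ (dir (e i) (dir τ v)) p := s (s hv)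
  have hvtt : ContDiffAt ℝ ∞ (dir τ (dir τ v)) p := s (s hv)
  have hvξ : ContDiffAt ℝ ∞ (dir ξ (dir ξ v)) p := s (s hv)
  have hqq (i j : Fin n) : ContDiffAt ℝ ∞ (fun q ↦ dir (e i) v q * dir (e j) v q) p :=
    (hv1 i).mul (hv1 j)
  have hzz (i j : Fin n) :
      ContDiffAt ℝ ∞ (fun q ↦ dir (e i) (dir τ v) q * dir (e j) (dir τ v) q) p :=
    (hvt i).mul (hvt j)
  have hSA := contDiffAt_sum_sum_mul hA hv2
  have hSB : ContDiffAt ℝ ∞ (fun q ↦ ∑ k, B k q * dir (e k) v q) p :=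
    ContDiffAt.sum fun k _ ↦ (hB k).mul (hv1 k)
  have hSq := contDiffAt_sum_sum_mul hA hqq
  have hZ := contDiffAt_sum_sum_mul hA hzz
  have hSΓ : ContDiffAt ℝ ∞ (fun q ↦ ∑ k, Γ k q * dir (e k) v q) p :=
    ContDiffAt.sum fun k _ ↦ (hΓ k).mul (hv1 k)
  have hbSq : ContDiffAt ℝ ∞ (fun q ↦ b * ∑ i, ∑ j, A i j q * (dir (e i) v q * dir (e j) v q)) p :=
    contDiffAt_const.mul hSq
  have hYs := ((hSA.add hSB).sub hbSq).add ha
  set Yf : V → ℝ := fun q ↦ ∑ i, ∑ j, A i j q * dir (e i) (dir (e j) v) q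
        + ∑ k, B k q * dir (e k) v q - b * ∑ i, ∑ j, A i j q * (dir (e i) v q * dir (e j) v q)
        + a q with hYf
  -- values and derivatives of the coefficient `Yf`
  have hY0 : Yf p = ∑ i, dir (e i) (dir (e i) v) p - b * ∑ i, dir (e i) v p ^ 2 + a p := by
    simp only [hYf]
    rw [flat_sum (F := fun i j ↦ dir (e i) (dir (e j) v)) hA0,
      flat_sum (F := fun i j q ↦ dir (e i) v q * dir (e j) v q) hA0]
    simp [hB0, pow_two]
  have hY1 (w : V) : dir w Yf p = ∑ i, dir w (dir (e i) (dir (e i) v)) p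
      + ∑ k, dir w (B k) p * dir (e k) v p
      - b * ∑ i, (2 * (dir (e i) v p * dir w (dir (e i) v) p)) + dir w a p := by
    simp only [hYf]
    rw [dir₁_add w ((hSA.add hSB).sub hbSq) ha, dir₁_sub w (hSA.add hSB) hbSq,
      dir₁_add w hSA hSB, dir₁_const_mul w b hSq, dir_flat_sum hA hv2 hA0 hA1,
      dir_flat_sum hA hqq hA0 hA1, dir_null_sum hB hv1 hB0]
    congr 3
    refine Finset.sum_congr rfl fun i _ ↦ ?_
    rw [dir₁_mul w (hv1 i) (hv1 i)]
    ring
  have hY2 : dir ξ (dir ξ Yf) p = ∑ i, ∑ j, dir ξ (dir ξ (A i j)) p * dir (e i) (dir (e j) v) p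
      + ∑ i, dir (e i) (dir (e i) (dir ξ (dir ξ v))) p
      + ∑ k, (dir ξ (dir ξ (B k)) p * dir (e k) v p
        + 2 * (dir ξ (B k) p * dir ξ (dir (e k) v) p))
      - b * (∑ i, ∑ j, dir ξ (dir ξ (A i j)) p * (dir (e i) v p * dir (e j) v p)
        + ∑ i, (2 * dir ξ (dir (e i) v) p ^ 2
          + 2 * (dir (e i) v p * dir (e i) (dir ξ (dir ξ v)) p))) + dir ξ (dir ξ a) p := by
    simp only [hYf]
    rw [dir₂_add ξ ξ ((hSA.add hSB).sub hbSq) ha, dir₂_sub ξ ξ (hSA.add hSB) hbSq,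
      dir₂_add ξ ξ hSA hSB, dir₂_const_mul ξ ξ b hSq, dir₂_flat_sum hA hv2 hA0 hA1,
      dir₂_flat_sum hA hqq hA0 hA1, dir₂_null_sum hB hv1 hB0]
    have r1 : ∑ i, dir ξ (dir ξ (dir (e i) (dir (e i) v))) p
        = ∑ i, dir (e i) (dir (e i) (dir ξ (dir ξ v))) p :=
      Finset.sum_congr rfl fun i _ ↦ dir₄_comm _ _ _ _ hv
    have r2 : ∑ k, (dir ξ (dir ξ (B k)) p * dir (e k) v p
        + dir ξ (B k) p * dir ξ (dir (e k) v) p + dir ξ (B k) p * dir ξ (dir (e k) v) p)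
        = ∑ k, (dir ξ (dir ξ (B k)) p * dir (e k) v p
        + 2 * (dir ξ (B k) p * dir ξ (dir (e k) v) p)) :=
      Finset.sum_congr rfl fun k _ ↦ by ring
    have r3 : ∑ i, dir ξ (dir ξ fun q ↦ dir (e i) v q * dir (e i) v q) p
        = ∑ i, (2 * dir ξ (dir (e i) v) p ^ 2
          + 2 * (dir (e i) v p * dir (e i) (dir ξ (dir ξ v)) p)) := by
      refine Finset.sum_congr rfl fun i _ ↦ ?_
      rw [dir₂_mul ξ ξ (hv1 i) (hv1 i), dir₃_comm (e i) ξ ξ hv]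
      ring
    rw [r1, r2, r3]
  have hZ1 (w : V) : dir w (fun q ↦ ∑ i, ∑ j, A i j q *
      (dir (e i) (dir τ v) q * dir (e j) (dir τ v) q)) p
      = ∑ i, 2 * (dir (e i) (dir τ v) p * dir w (dir (e i) (dir τ v)) p) := by
    rw [dir_flat_sum hA hzz hA0 hA1]
    refine Finset.sum_congr rfl fun i _ ↦ ?_
    rw [dir₁_mul w (hvt i) (hvt i)]
    ring
  have hZ2 : dir ξ (dir ξ (fun q ↦ ∑ i, ∑ j, A i j q *
      (dir (e i) (dir τ v) q * dir (e j) (dir τ v) q))) p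
      = ∑ i, ∑ j, dir ξ (dir ξ (A i j)) p * (dir (e i) (dir τ v) p * dir (e j) (dir τ v) p)
        + ∑ i, (2 * dir ξ (dir (e i) (dir τ v)) p ^ 2
          + 2 * (dir (e i) (dir τ v) p * dir (e i) (dir τ (dir ξ (dir ξ v))) p)) := by
    rw [dir₂_flat_sum hA hzz hA0 hA1]
    congr 1
    refine Finset.sum_congr rfl fun i _ ↦ ?_
    rw [dir₂_mul ξ ξ (hvt i) (hvt i), dir₄_comm ξ ξ (e i) τ hv]
    ring
  -- the equation and its derivatives
  have E0 : dir τ (dir τ v) p * Yf p - ∑ i, dir (e i) (dir τ v) p ^ 2 = h p ^ 2 := by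
    have := heq.self_of_nhds
    beta_reduce at this
    rw [flat_sum (F := fun i j q ↦ dir (e i) (dir τ v) q * dir (e j) (dir τ v) q) hA0] at this
    simp only [pow_two]
    exact this
  have E1 (w : V) : dir w (dir τ (dir τ v)) p * Yf p + dir τ (dir τ v) p * dir w Yf p
      - ∑ i, 2 * (dir (e i) (dir τ v) p * dir w (dir (e i) (dir τ v)) p)
      = 2 * h p * dir w h p := by
    have := (dir_congr w heq).self_of_nhds
    rw [dir₁_sub w (hvtt.mul hYs) hZ, dir₁_mul w hvtt hYs, hZ1, dir₁_mul w hh hh] at this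
    linarith
  have E2 : dir τ (dir τ (dir ξ (dir ξ v))) p * Yf p
      + 2 * (dir ξ (dir τ (dir τ v)) p * dir ξ Yf p) + dir τ (dir τ v) p * dir ξ (dir ξ Yf) p
      - (∑ i, ∑ j, dir ξ (dir ξ (A i j)) p * (dir (e i) (dir τ v) p * dir (e j) (dir τ v) p)
        + ∑ i, (2 * dir ξ (dir (e i) (dir τ v)) p ^ 2
          + 2 * (dir (e i) (dir τ v) p * dir (e i) (dir τ (dir ξ (dir ξ v))) p)))
      = 2 * dir ξ h p ^ 2 + 2 * h p * dir ξ (dir ξ h) p := by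
    have := (dir_congr ξ (dir_congr ξ heq)).self_of_nhds
    rw [dir₂_sub ξ ξ (hvtt.mul hYs) hZ, dir₂_mul ξ ξ hvtt hYs, hZ2, dir₂_mul ξ ξ hh hh,
      dir₄_comm ξ ξ τ τ hv] at this
    linarith
  -- the second order conditions at the maximum
  have hHs (i j : Fin n) : dir (e i) (dir (e j) v) p = dir (e j) (dir (e i) v) p :=
    dir_comm_apply _ _ hv
  have hr := ((contDiffAt_const (c := (1 / 2 : ℝ))).mul hSq).add hP
  have hrM := hr.sub (contDiffAt_const (c := M))
  have hN := hvξ.sub hSΓ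
  -- By the choice of `M` the factor in front of `G` equals -v_ξξ at `p`. The second derivatives of
  -- `G` therefore enter with a coefficient that is only linear in the Hessian.
  have hrM0 : 1 / 2 * ∑ i, ∑ j, A i j p * (dir (e i) v p * dir (e j) v p) + P p - M
      = -dir ξ (dir ξ v) p := by
    rw [flat_sum (F := fun i j q ↦ dir (e i) v q * dir (e j) v q) hA0, ← hM]
    simp only [pow_two]
    ring
  have hφ1 (k : Fin n) : dir (e k) (dir ξ (dir ξ v)) p - ∑ l, dir (e k) (Γ l) p * dir (e l) v p
      + ∑ i, dir (e i) v p * dir (e k) (dir (e i) v) p = 0 := by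
    have h0 := dir_eq_zero_of_isLocalMax (e k) hmax
    rw [dir₁_add _ hN (hrM.mul hG), dir₁_mul _ hrM hG, hG1, hG0, dir₁_sub _ hvξ hSΓ,
      dir₁_sub _ hr contDiffAt_const, dir₁_add _ (contDiffAt_const.mul hSq) hP,
      dir₁_const_mul _ _ hSq, dir_flat_sum hA hqq hA0 hA1, dir_null_sum hΓ hv1 hΓ0, hP1,
      dir_const] at h0
    have r : ∑ i, dir (e k) (fun q ↦ dir (e i) v q * dir (e i) v q) p
        = 2 * ∑ i, dir (e i) v p * dir (e k) (dir (e i) v) p := by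
      rw [Finset.mul_sum]
      refine Finset.sum_congr rfl fun i _ ↦ ?_
      rw [dir₁_mul _ (hv1 i) (hv1 i)]
      ring
    rw [r] at h0
    linarith
  have hφ2 (w w' : V) : dir w (dir w' fun q ↦ (dir ξ (dir ξ v) q - ∑ k, Γ k q * dir (e k) v q)
      + (1 / 2 * ∑ i, ∑ j, A i j q * (dir (e i) v q * dir (e j) v q) + P q - M) * G q) p
      = dir w (dir w' (dir ξ (dir ξ v))) p
        - ∑ l, (dir w (dir w' (Γ l)) p * dir (e l) v p
          + dir w' (Γ l) p * dir w (dir (e l) v) p + dir w (Γ l) p * dir w' (dir (e l) v) p)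
        + (1 / 2 * ∑ i, ∑ j, dir w (dir w' (A i j)) p * (dir (e i) v p * dir (e j) v p)
          + ∑ i, (dir (e i) v p * dir (e i) (dir w (dir w' v)) p
            + dir w (dir (e i) v) p * dir w' (dir (e i) v) p) + dir w (dir w' P) p)
        - dir ξ (dir ξ v) p * dir w (dir w' G) p := by
    rw [dir₂_add _ _ hN (hrM.mul hG), dir₂_mul _ _ hrM hG, hG1, hG1, hG0, hrM0,
      dir₂_sub _ _ hvξ hSΓ, dir₂_sub _ _ hr contDiffAt_const,
      dir₂_add _ _ (contDiffAt_const.mul hSq) hP, dir₂_const_mul _ _ _ hSq,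
      dir₂_flat_sum hA hqq hA0 hA1, dir₂_null_sum hΓ hv1 hΓ0, dir₂_const]
    have r : ∑ i, dir w (dir w' fun q ↦ dir (e i) v q * dir (e i) v q) p
        = 2 * ∑ i, (dir (e i) v p * dir (e i) (dir w (dir w' v)) p
            + dir w (dir (e i) v) p * dir w' (dir (e i) v) p) := by
      rw [Finset.mul_sum]
      refine Finset.sum_congr rfl fun i _ ↦ ?_
      rw [dir₂_mul _ _ (hv1 i) (hv1 i), dir₃_comm (e i) w w' hv]
      ring
    rw [r]
    ring
  set x := dir τ (dir τ v) p with hxdef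
  have hxy : ∑ k, dir (e k) (dir τ v) p ^ 2 ≤ x * Yf p := by linarith [sq_nonneg (h p)]
  have hy : 0 ≤ Yf p := by
    have h1 : 0 ≤ x * Yf p := le_trans (Finset.sum_nonneg fun i _ ↦ sq_nonneg _) hxy
    exact nonneg_of_mul_nonneg_right h1 hx
  have hC := contraction_nonpos_of_isLocalMax e τ hx hxy (hN.add (hrM.mul hG)) hmax
  simp only [hφ2] at hC
  set R := √(∑ k, ∑ i, dir (e i) (dir (e k) v) p ^ 2) with hRdef
  have hRsq : R ^ 2 = ∑ k, ∑ i, dir (e i) (dir (e k) v) p ^ 2 :=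
    Real.sq_sqrt (Finset.sum_nonneg fun k _ ↦ Finset.sum_nonneg fun i _ ↦ sq_nonneg _)
  have hR : 0 ≤ R := Real.sqrt_nonneg _
  obtain ⟨hH, hHξ, hHξξ⟩ := abs_dir_dir_le hξ hc1 hv
  -- Dictionary: `S1`, `S2`, `S3` are second derivatives of v_ξξ and `T` is its gradient; `U`, `W`,
  -- `X` are the remaining third derivatives; `α`, `α2`, `γ1`, `γ2`, `βξ`, `β1ξ`, `B1`, `G2` are
  -- derivatives of the metric coefficients, bounded by `Λ`. The remaining goals are the contracted
  -- second order condition and the once differentiated equation along the `e i` and along `ξ`.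
  have hmain := contraction_of_derivatives (R := R) (D := D) (b := b) (h := h p)
    (z := fun i ↦ dir (e i) (dir τ v) p) (q := fun i ↦ dir (e i) v p)
    (Hξ := fun i ↦ dir ξ (dir (e i) v) p) (zξ := fun i ↦ dir ξ (dir (e i) (dir τ v)) p)
    (H := fun i j ↦ dir (e i) (dir (e j) v) p)
    (α := fun i j ↦ dir ξ (dir ξ (A i j)) p) (γ1 := fun l k ↦ dir (e k) (Γ l) p)
    (γ2 := fun l k ↦ dir (e k) (dir (e k) (Γ l)) p) (B1 := fun k i ↦ dir (e i) (B k) p)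
    (βξ := fun k ↦ dir ξ (dir ξ (B k)) p) (β1ξ := fun k ↦ dir ξ (B k) p)
    (a1 := fun i ↦ dir (e i) a p) (G2 := fun k ↦ dir (e k) (dir (e k) G) p)
    (h1 := fun i ↦ dir (e i) h p) (α2 := fun i j k ↦ dir (e k) (dir (e k) (A i j)) p)
    (lam := dir ξ (dir ξ v) p) (S1 := dir τ (dir τ (dir ξ (dir ξ v))) p)
    (S2 := fun k ↦ dir (e k) (dir τ (dir ξ (dir ξ v))) p)
    (S3 := fun k ↦ dir (e k) (dir (e k) (dir ξ (dir ξ v))) p)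
    (T := fun k ↦ dir (e k) (dir ξ (dir ξ v)) p)
    (U := fun i ↦ dir (e i) (dir τ (dir τ v)) p)
    (W := fun i k ↦ dir (e i) (dir (e k) (dir τ v)) p)
    (X := fun i k ↦ dir (e i) (dir (e k) (dir (e k) v)) p)
    hx hy hb hHs hRsq ?_ hφ1 (fun i ↦ ?_) E2 hY2
    (lorentz_concavity (z := fun i ↦ dir (e i) (dir τ v) p) hx E0 ?_)
  · exact hessian_bound_of_contraction hΛ hK hb hY hx (hY0.trans_le hyY) hpos hD hR hH hHξ hq E0
      bAξ bBξ2 bBξ bΓ bΓ2 bB haξ ha1 bG bA hHξξ hκ hmain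
  · refine le_trans (le_of_eq ?_) hC
    have t1 (i : Fin n) : dir τ (dir (e i) v) p = dir (e i) (dir τ v) p := dir_comm_apply _ _ hv
    have t3 (k : Fin n) : ∑ l, (dir (e k) (dir (e k) (Γ l)) p * dir (e l) v p
        + dir (e k) (Γ l) p * dir (e k) (dir (e l) v) p
        + dir (e k) (Γ l) p * dir (e k) (dir (e l) v) p)
        = ∑ l, (dir (e k) (dir (e k) (Γ l)) p * dir (e l) v p
        + 2 * (dir (e k) (Γ l) p * dir (e k) (dir (e l) v) p)) :=
      Finset.sum_congr rfl fun l _ ↦ by ring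
    simp only [t1, hΓτ, hΓτ2, hAτ, hGτ, hPτ, hP2, zero_mul, mul_zero, Finset.sum_const_zero,
      add_zero, zero_add, sub_zero, t3, ← pow_two]
    ring
  · have := E1 (e i)
    rw [hY1] at this
    exact this
  · have := E1 ξ
    rw [← Finset.mul_sum] at this
    exact this

end Pointwise

theorem contDiffAt_clm_of_apply {D E F : Type*} [NormedAddCommGroup D] [NormedSpace ℝ D]
    [NormedAddCommGroup E] [NormedSpace ℝ E] [FiniteDimensional ℝ E] [NormedAddCommGroup F]
    [NormedSpace ℝ F] {m : WithTop ℕ∞} {f : D → E →L[ℝ] F} {x : D}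
    (h : ∀ v, ContDiffAt ℝ m (fun y ↦ f y v) x) : ContDiffAt ℝ m f x := by
  let d := Module.finrank ℝ E
  have hd : d = Module.finrank ℝ (Fin d → ℝ) := (Module.finrank_fin_fun ℝ).symm
  let e₁ := ContinuousLinearEquiv.ofFinrankEq hd
  let e₂ := (e₁.arrowCongr (1 : F ≃L[ℝ] F)).trans (ContinuousLinearEquiv.piRing (Fin d))
  rw [← Function.id_comp f, ← e₂.symm_comp_self]
  exact e₂.symm.contDiff.contDiffAt.comp x (contDiffAt_pi.2 fun i ↦ h _)

/-! ### Quadratic coordinates in which the Christoffel symbols vanish at the centre. -/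

section NormalCoordinates

variable {F : Type*} [NormedAddCommGroup F] [NormedSpace ℝ F] [FiniteDimensional ℝ F]

/-- The quadratic coordinate change centred at `θ.1`, with linear part `θ.2`, which makes the
Christoffel symbols of `g` vanish at the centre. -/
def normalMap (g : F → F →L[ℝ] F →L[ℝ] ℝ) (θ : F × (F →L[ℝ] F)) (y : F) : F :=
  θ.1 + θ.2 y - (1 / 2 : ℝ) • christoffel g θ.1 (θ.2 y) (θ.2 y)

/-- The derivative of `normalMap`. -/
def normalDeriv (g : F → F →L[ℝ] F →L[ℝ] ℝ) (θ : F × (F →L[ℝ] F)) (y : F) : F →L[ℝ] F :=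
  θ.2 - (christoffel g θ.1 (θ.2 y)).comp θ.2

/-- The pullback of the metric `g` under `normalMap`. -/
def normalMetric (g : F → F →L[ℝ] F →L[ℝ] ℝ) (θ : F × (F →L[ℝ] F)) (y : F) :
    F →L[ℝ] F →L[ℝ] ℝ :=
  (g (normalMap g θ y)).bilinearComp (normalDeriv g θ y) (normalDeriv g θ y)

/-- The Christoffel symbols of `g` in the coordinates given by `normalMap`. -/
def normalChristoffel (g : F → F →L[ℝ] F →L[ℝ] ℝ) (θ : F × (F →L[ℝ] F)) (y v w : F) : F :=
  (normalDeriv g θ y).inverse (christoffel g (normalMap g θ y) (normalDeriv g θ y v)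
    (normalDeriv g θ y w) - christoffel g θ.1 (θ.2 v) (θ.2 w))

variable {g : F → F →L[ℝ] F →L[ℝ] ℝ} {θ : F × (F →L[ℝ] F)} {y : F}

theorem normalDeriv_apply (v : F) :
    normalDeriv g θ y v = θ.2 v - christoffel g θ.1 (θ.2 y) (θ.2 v) := rfl

theorem normalMetric_apply (v w : F) : normalMetric g θ y v w
    = g (normalMap g θ y) (normalDeriv g θ y v) (normalDeriv g θ y w) := rfl

@[simp] theorem normalMap_zero : normalMap g θ 0 = θ.1 := by simp [normalMap]

@[simp] theorem normalDeriv_zero : normalDeriv g θ 0 = θ.2 := by simp [normalDeriv]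

theorem normalMetric_zero (v w : F) : normalMetric g θ 0 v w = g θ.1 (θ.2 v) (θ.2 w) := by
  simp [normalMetric_apply]

@[simp] theorem normalChristoffel_zero (v w : F) : normalChristoffel g θ 0 v w = 0 := by
  simp [normalChristoffel]

/-- Symmetry of the Christoffel symbols makes the two halves of the derivative of the quadratic term
agree, so the factor 1/2 disappears. -/
theorem hasFDerivAt_normalMap
    (hs : ∀ v w, christoffel g θ.1 v w = christoffel g θ.1 w v) :
    HasFDerivAt (normalMap g θ) (normalDeriv g θ y) y := by
  have h1 : HasFDerivAt (fun y ↦ θ.2 y) θ.2 y := θ.2.hasFDerivAt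
  have h2 : HasFDerivAt (fun y ↦ christoffel g θ.1 (θ.2 y)) ((christoffel g θ.1).comp θ.2) y :=
    (christoffel g θ.1).hasFDerivAt.comp y h1
  have h3 := ((h1.const_add θ.1).sub ((h2.clm_apply h1).const_smul (1 / 2 : ℝ)))
  refine h3.congr_fderiv ?_
  ext v
  simp only [_root_.sub_apply, _root_.smul_apply, _root_.add_apply,
    ContinuousLinearMap.comp_apply, ContinuousLinearMap.flip_apply, normalDeriv_apply]
  rw [hs (θ.2 v), ← two_smul ℝ (christoffel g θ.1 (θ.2 y) (θ.2 v)), smul_smul]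
  norm_num

theorem hasFDerivAt_normalDeriv (v : F) :
    HasFDerivAt (fun y ↦ normalDeriv g θ y v)
      (-((christoffel g θ.1).flip (θ.2 v)).comp θ.2) y := by
  have h1 : HasFDerivAt (fun y ↦ θ.2 y) θ.2 y := θ.2.hasFDerivAt
  have h2 : HasFDerivAt (fun y ↦ christoffel g θ.1 (θ.2 y) (θ.2 v))
      (((christoffel g θ.1).flip (θ.2 v)).comp θ.2) y :=
    ((christoffel g θ.1).flip (θ.2 v)).hasFDerivAt.comp y h1
  exact h2.const_sub (θ.2 v)

section Smooth

set_option synthInstance.maxHeartbeats 200000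

variable {U : Set F} (hU : IsOpen U) (hg : ContDiffOn ℝ ∞ g U)
  (hinv : ∀ y ∈ U, (g y).IsInvertible)
include hU hg hinv

variable {D : Type*} [NormedAddCommGroup D] [NormedSpace ℝ D] {s : D → F × (F →L[ℝ] F)}
  {z : D → F} {x : D}

theorem contDiffAt_normalMap (hs : ContDiffAt ℝ ∞ s x) (hz : ContDiffAt ℝ ∞ z x)
    (hx : (s x).1 ∈ U) : ContDiffAt ℝ ∞ (fun q ↦ normalMap g (s q) (z q)) x := by
  have hΓ : ContDiffAt ℝ ∞ (christoffel g) (s x).1 :=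
    (contDiffOn_christoffel hU hg hinv).contDiffAt (hU.mem_nhds hx)
  have h1 := hΓ.comp x hs.fst
  have h2 := hs.snd.clm_apply hz
  exact (hs.fst.add h2).sub (((h1.clm_apply h2).clm_apply h2).const_smul (1 / 2 : ℝ))

theorem contDiffAt_normalDeriv (hs : ContDiffAt ℝ ∞ s x) (hz : ContDiffAt ℝ ∞ z x)
    (hx : (s x).1 ∈ U) : ContDiffAt ℝ ∞ (fun q ↦ normalDeriv g (s q) (z q)) x := by
  have hΓ : ContDiffAt ℝ ∞ (christoffel g) (s x).1 :=
    (contDiffOn_christoffel hU hg hinv).contDiffAt (hU.mem_nhds hx)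
  have h1 := hΓ.comp x hs.fst
  exact hs.snd.sub ((h1.clm_apply (hs.snd.clm_apply hz)).clm_comp hs.snd)

theorem contDiffAt_normalMetric (hs : ContDiffAt ℝ ∞ s x) (hz : ContDiffAt ℝ ∞ z x)
    (hx : (s x).1 ∈ U) (hx' : normalMap g (s x) (z x) ∈ U) :
    ContDiffAt ℝ ∞ (fun q ↦ normalMetric g (s q) (z q)) x := by
  have hg' : ContDiffAt ℝ ∞ g (normalMap g (s x) (z x)) := hg.contDiffAt (hU.mem_nhds hx')
  have h1 := hg'.comp x (contDiffAt_normalMap hU hg hinv hs hz hx)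
  have h2 := contDiffAt_normalDeriv hU hg hinv hs hz hx
  refine contDiffAt_clm_of_apply fun v ↦ contDiffAt_clm_of_apply fun w ↦ ?_
  exact (h1.clm_apply (h2.clm_apply contDiffAt_const)).clm_apply (h2.clm_apply contDiffAt_const)

theorem contDiffAt_normalMetric_inverse (hs : ContDiffAt ℝ ∞ s x) (hz : ContDiffAt ℝ ∞ z x)
    (hx : (s x).1 ∈ U) (hx' : normalMap g (s x) (z x) ∈ U)
    (hN : (normalMetric g (s x) (z x)).IsInvertible) :
    ContDiffAt ℝ ∞ (fun q ↦ (normalMetric g (s q) (z q)).inverse) x :=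
  ContDiffAt.comp x (g := fun L : F →L[ℝ] F →L[ℝ] ℝ ↦ L.inverse)
    (f := fun q ↦ normalMetric g (s q) (z q)) hN.contDiffAt_map_inverse
    (contDiffAt_normalMetric hU hg hinv hs hz hx hx')

theorem contDiffAt_normalChristoffel {v w : D → F} (hs : ContDiffAt ℝ ∞ s x)
    (hz : ContDiffAt ℝ ∞ z x) (hv : ContDiffAt ℝ ∞ v x) (hw : ContDiffAt ℝ ∞ w x)
    (hx : (s x).1 ∈ U) (hx' : normalMap g (s x) (z x) ∈ U)
    (hN : (normalDeriv g (s x) (z x)).IsInvertible) :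
    ContDiffAt ℝ ∞ (fun q ↦ normalChristoffel g (s q) (z q) (v q) (w q)) x := by
  have hΓ := contDiffOn_christoffel hU hg hinv
  have h1 := (hΓ.contDiffAt (hU.mem_nhds hx')).comp x (contDiffAt_normalMap hU hg hinv hs hz hx)
  have h2 := contDiffAt_normalDeriv hU hg hinv hs hz hx
  have h3 := (hΓ.contDiffAt (hU.mem_nhds hx)).comp x hs.fst
  exact (hN.contDiffAt_map_inverse.comp x h2).clm_apply
    (((h1.clm_apply (h2.clm_apply hv)).clm_apply (h2.clm_apply hw)).sub
    ((h3.clm_apply (hs.snd.clm_apply hv)).clm_apply (hs.snd.clm_apply hw)))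

/-- The derivative of `g` at the centre is cancelled by the derivatives of the two factors
`normalDeriv`; this is exactly metric compatibility, `fderiv_metric`. -/
theorem fderiv_normalMetric (hsymm : ∀ y v w, g y v w = g y w v) (hx : θ.1 ∈ U) :
    fderiv ℝ (normalMetric g θ) 0 = 0 := by
  have hgd : DifferentiableAt ℝ g θ.1 :=
    (hg.contDiffAt (hU.mem_nhds hx)).differentiableAt (by simp)
  have hc (v w : F) : christoffel g θ.1 v w = christoffel g θ.1 w v :=
    christoffel_symm hgd (Eventually.of_forall fun z ↦ hsymm z) v w
  have hd : DifferentiableAt ℝ (normalMetric g θ) 0 :=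
    (contDiffAt_normalMetric hU hg hinv (s := fun _ ↦ θ) (z := id) contDiffAt_const
      contDiffAt_id hx (by simpa using hx)).differentiableAt (by simp)
  ext u v w
  rw [← fderiv_clm_apply_apply hd]
  have h1 : HasFDerivAt (fun y ↦ g (normalMap g θ y)) ((fderiv ℝ g θ.1).comp θ.2) 0 := by
    have hgd' : HasFDerivAt g (fderiv ℝ g θ.1) (normalMap g θ 0) := by
      rw [normalMap_zero]; exact hgd.hasFDerivAt
    have := HasFDerivAt.comp (g := g) (f := normalMap g θ) 0 hgd'
      (hasFDerivAt_normalMap (y := 0) hc)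
    rwa [normalDeriv_zero] at this
  have h2 := (h1.clm_apply (hasFDerivAt_normalDeriv (g := g) (θ := θ) v)).clm_apply
    (hasFDerivAt_normalDeriv (g := g) (θ := θ) w)
  have h3 : fderiv ℝ (fun y ↦ normalMetric g θ y v w) 0 u = fderiv ℝ g θ.1 (θ.2 u) (θ.2 v) (θ.2 w)
      - g θ.1 (christoffel g θ.1 (θ.2 u) (θ.2 v)) (θ.2 w)
      - g θ.1 (θ.2 v) (christoffel g θ.1 (θ.2 u) (θ.2 w)) := by
    simp only [normalMetric_apply]
    rw [h2.fderiv]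
    simp
    ring
  rw [h3, fderiv_metric (hinv _ hx) hgd (Eventually.of_forall fun z ↦ hsymm z)]
  simp

theorem fderiv_normalMetric_inverse (hsymm : ∀ y v w, g y v w = g y w v) (hx : θ.1 ∈ U)
    (hN : (normalMetric g θ 0).IsInvertible) (ℓ ℓ' : F →L[ℝ] ℝ) :
    fderiv ℝ (fun y ↦ ℓ ((normalMetric g θ y).inverse ℓ')) 0 = 0 := by
  have hd : DifferentiableAt ℝ (normalMetric g θ) 0 :=
    (contDiffAt_normalMetric hU hg hinv (s := fun _ ↦ θ) (z := id) contDiffAt_const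
      contDiffAt_id hx (by simpa using hx)).differentiableAt (by simp)
  let φ : (F →L[ℝ] F →L[ℝ] ℝ) → ℝ := fun B ↦ ℓ (B.inverse ℓ')
  have h1 : ContDiffAt ℝ ∞ φ (normalMetric g θ 0) :=
    ℓ.contDiff.contDiffAt.comp _ (hN.contDiffAt_map_inverse.clm_apply
      (contDiffAt_const (c := ℓ')))
  have h := HasFDerivAt.comp (g := φ) (f := normalMetric g θ) 0
    (h1.differentiableAt (by simp)).hasFDerivAt hd.hasFDerivAt
  refine h.fderiv.trans ?_
  ext w
  rw [ContinuousLinearMap.comp_apply, fderiv_normalMetric hU hg hinv hsymm hx]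
  simp

end Smooth

end NormalCoordinates

/-! ### Uniform derivative bounds for smooth families over a compact parameter set. -/

section ParametricBound

variable {Θ F : Type*} [NormedAddCommGroup Θ] [NormedSpace ℝ Θ] [NormedAddCommGroup F]
  [NormedSpace ℝ F]

theorem dir_prodMk {f : Θ × F → ℝ} {θ : Θ} {y : F} (hf : ContDiffAt ℝ ∞ f (θ, y)) (w : F) :
    dir w (fun y ↦ f (θ, y)) =ᶠ[𝓝 y] fun y ↦ dir (0, w) f (θ, y) := by
  have hc : Tendsto (fun y : F ↦ (θ, y)) (𝓝 y) (𝓝 (θ, y)) :=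
    (Continuous.prodMk_right θ).continuousAt
  filter_upwards [hc.eventually (eventually_differentiableAt_of_contDiffAt hf)] with z hz
  have := hz.hasFDerivAt.comp z (hasFDerivAt_prodMk_right θ z)
  exact congrArg (fun L : F →L[ℝ] ℝ ↦ L w) this.fderiv

theorem dir_comp_fst {f : F → ℝ} {y : F} (hf : ContDiffAt ℝ ∞ f y) (w : F × Θ) (t : Θ) :
    dir w (fun q : F × Θ ↦ f q.1) =ᶠ[𝓝 (y, t)] fun q ↦ dir w.1 f q.1 := by
  have hc : Tendsto (Prod.fst : F × Θ → F) (𝓝 (y, t)) (𝓝 y) := continuous_fst.continuousAt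
  filter_upwards [hc.eventually (eventually_differentiableAt_of_contDiffAt hf)] with z hz
  have := hz.hasFDerivAt.comp z hasFDerivAt_fst
  exact congrArg (fun L : F × Θ →L[ℝ] ℝ ↦ L w) this.fderiv

theorem dir₁_comp_fst {f : F → ℝ} {y : F} (hf : ContDiffAt ℝ ∞ f y) (w : F × Θ) (t : Θ) :
    dir w (fun q : F × Θ ↦ f q.1) (y, t) = dir w.1 f y :=
  (dir_comp_fst hf w t).self_of_nhds

theorem dir₂_comp_fst {f : F → ℝ} {y : F} (hf : ContDiffAt ℝ ∞ f y) (w w' : F × Θ) (t : Θ) :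
    dir w (dir w' fun q : F × Θ ↦ f q.1) (y, t) = dir w.1 (dir w'.1 f) y :=
  (dir_congr w (dir_comp_fst hf w' t)).self_of_nhds.trans
    (dir₁_comp_fst (contDiffAt_dir w'.1 hf) w t)

theorem exists_norm_le_of_continuousAt_prodMk {Z : Type*} [NormedAddCommGroup Z] {K : Set Θ}
    (hK : IsCompact K) {φ : Θ × F → Z} (hφ : ∀ θ ∈ K, ContinuousAt φ (θ, 0)) :
    ∃ Λ, ∀ θ ∈ K, ‖φ (θ, 0)‖ ≤ Λ :=
  hK.exists_bound_of_continuousOn fun θ hθ ↦ ((hφ θ hθ).comp (f := fun θ : Θ ↦ (θ, (0 : F)))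
    (Continuous.prodMk_left 0).continuousAt).continuousWithinAt

set_option synthInstance.maxHeartbeats 200000 in
/-- Uniform bounds for the derivatives of a smooth family with compact parameter set. -/
theorem exists_forall_abs_dir_le {K : Set Θ} (hK : IsCompact K) {f : Θ × F → ℝ}
    (hf : ∀ θ ∈ K, ContDiffAt ℝ ∞ f (θ, 0)) :
    ∃ Λ : ℝ, 0 ≤ Λ ∧ ∀ θ ∈ K, ∀ w w' : F, ‖w‖ ≤ 1 → ‖w'‖ ≤ 1 →
      |dir w (fun y ↦ f (θ, y)) 0| ≤ Λ ∧ |dir w (dir w' fun y ↦ f (θ, y)) 0| ≤ Λ := by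
  have h1 (θ : Θ) (hθ : θ ∈ K) : ContDiffAt ℝ ∞ (fderiv ℝ f) (θ, 0) :=
    (hf θ hθ).fderiv_right (by simp)
  have h2 (θ : Θ) (hθ : θ ∈ K) : ContDiffAt ℝ ∞ (fderiv ℝ (fderiv ℝ f)) (θ, 0) :=
    (h1 θ hθ).fderiv_right (by simp)
  obtain ⟨Λ, hΛ⟩ := exists_norm_le_of_continuousAt_prodMk hK fun θ hθ ↦ (h1 θ hθ).continuousAt
  obtain ⟨Λ', hΛ'⟩ := exists_norm_le_of_continuousAt_prodMk hK fun θ hθ ↦ (h2 θ hθ).continuousAt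
  refine ⟨max 0 (max Λ Λ'), le_max_left _ _, fun θ hθ w w' hw hw' ↦ ⟨?_, ?_⟩⟩
  · have hn : ‖((0 : Θ), w)‖ ≤ 1 := by simpa [Prod.norm_def] using hw
    rw [(dir_prodMk (hf θ hθ) w).self_of_nhds]
    refine ((fderiv ℝ f (θ, 0)).le_of_opNorm_le_of_le (hΛ θ hθ) hn).trans ?_
    simp
  · have hn : ‖((0 : Θ), w)‖ ≤ 1 := by simpa [Prod.norm_def] using hw
    have hn' : ‖((0 : Θ), w')‖ ≤ 1 := by simpa [Prod.norm_def] using hw'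
    rw [(dir_congr w (dir_prodMk (hf θ hθ) w')).self_of_nhds,
      (dir_prodMk (contDiffAt_dir (0, w') (hf θ hθ)) w).self_of_nhds]
    -- The iterated directional derivative is an entry of the full second derivative, whose norm at
    -- (θ, 0) is continuous in θ and hence bounded on `K`.
    have he : dir (0, w) (dir (0, w') f) (θ, 0) = fderiv ℝ (fderiv ℝ f) (θ, 0) (0, w) (0, w') := by
      have := (((h1 θ hθ).differentiableAt (by simp)).hasFDerivAt.clm_apply
        (hasFDerivAt_const ((0 : Θ), w') (θ, (0 : F)))).fderiv
      rw [dir]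
      change fderiv ℝ (fun q ↦ fderiv ℝ f q (0, w')) (θ, 0) (0, w) = _
      rw [this]
      simp
    beta_reduce
    rw [he]
    refine (ContinuousLinearMap.le_of_opNorm_le_of_le _
      (ContinuousLinearMap.le_of_opNorm_le_of_le _ (hΛ' θ hθ) hn) hn').trans ?_
    simp

theorem exists_forall_abs_dir_le_of_finite {ι : Type*} [Fintype ι] {K : Set Θ} (hK : IsCompact K)
    {f : ι → Θ × F → ℝ} (hf : ∀ i, ∀ θ ∈ K, ContDiffAt ℝ ∞ (f i) (θ, 0)) :
    ∃ Λ : ℝ, 0 ≤ Λ ∧ ∀ i, ∀ θ ∈ K, ∀ w w' : F, ‖w‖ ≤ 1 → ‖w'‖ ≤ 1 →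
      |dir w (fun y ↦ f i (θ, y)) 0| ≤ Λ ∧ |dir w (dir w' fun y ↦ f i (θ, y)) 0| ≤ Λ := by
  choose Λ hΛ0 hΛ using fun i ↦ exists_forall_abs_dir_le hK (hf i)
  refine ⟨∑ i, Λ i, Finset.sum_nonneg fun i _ ↦ hΛ0 i, fun i θ hθ w w' hw hw' ↦ ?_⟩
  have hle : Λ i ≤ ∑ i, Λ i := Finset.single_le_sum (fun i _ ↦ hΛ0 i) (Finset.mem_univ i)
  exact ⟨(hΛ i θ hθ w w' hw hw').1.trans hle, (hΛ i θ hθ w w' hw hw').2.trans hle⟩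

end ParametricBound

/-! ### The coefficients of the Laplacian and the Hessian as functions of centre, frame, direction
and point. -/

section NormalCoefficients

set_option synthInstance.maxHeartbeats 200000

variable {n : ℕ}

/-- The dual basis vector. -/
abbrev coord (i : Fin n) : EuclideanSpace ℝ (Fin n) →L[ℝ] ℝ := EuclideanSpace.proj i

/-- The parameters of normal coordinates (centre and frame), together with a direction. -/
abbrev NormalParam (n : ℕ) : Type :=
  (EuclideanSpace ℝ (Fin n) × (EuclideanSpace ℝ (Fin n) →L[ℝ] EuclideanSpace ℝ (Fin n)))
    × EuclideanSpace ℝ (Fin n)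

/-- The parameters with orthonormal frame and unit direction, and centre in `K`. -/
def normalFrames (g : EuclideanSpace ℝ (Fin n) → EuclideanSpace ℝ (Fin n) →L[ℝ]
    EuclideanSpace ℝ (Fin n) →L[ℝ] ℝ) (K : Set (EuclideanSpace ℝ (Fin n))) :
    Set (NormalParam n) :=
  {θ | θ.1.1 ∈ K ∧ (∀ v w, g θ.1.1 (θ.1.2 v) (θ.1.2 w) = inner ℝ v w) ∧ ‖θ.2‖ = 1}

variable (g : EuclideanSpace ℝ (Fin n) → EuclideanSpace ℝ (Fin n) →L[ℝ]
    EuclideanSpace ℝ (Fin n) →L[ℝ] ℝ)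

/-- The inverse metric in normal coordinates. -/
def normalA (i j : Fin n) (d : NormalParam n × EuclideanSpace ℝ (Fin n)) : ℝ :=
  (normalMetric g d.1.1 d.2).inverse (coord j) i

/-- The first order part of the Laplacian in normal coordinates. -/
def normalB (k : Fin n) (d : NormalParam n × EuclideanSpace ℝ (Fin n)) : ℝ :=
  -∑ j, normalChristoffel g d.1.1 d.2 ((normalMetric g d.1.1 d.2).inverse (coord j))
    (EuclideanSpace.single j 1) k

/-- The first order part of the second covariant derivative in the direction of the parameter. -/
def normalΓ (k : Fin n) (d : NormalParam n × EuclideanSpace ℝ (Fin n)) : ℝ :=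
  normalChristoffel g d.1.1 d.2 d.1.2 d.1.2 k

/-- The squared length of the direction of the parameter. -/
def normalG (d : NormalParam n × EuclideanSpace ℝ (Fin n)) : ℝ :=
  normalMetric g d.1.1 d.2 d.1.2 d.1.2

variable {g} {U K : Set (EuclideanSpace ℝ (Fin n))} {θ : NormalParam n}

theorem isInvertible_frame (hθ : ∀ v w, g θ.1.1 (θ.1.2 v) (θ.1.2 w) = inner ℝ v w) :
    θ.1.2.IsInvertible := by
  have hinj : Function.Injective θ.1.2 := by
    refine (injective_iff_map_eq_zero θ.1.2).2 fun v hv ↦ ?_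
    have := hθ v v
    rw [hv, map_zero] at this
    exact inner_self_eq_zero.1 this.symm
  exact ⟨(LinearEquiv.ofInjectiveEndo θ.1.2.toLinearMap hinj).toContinuousLinearEquiv,
    by ext; rfl⟩

theorem normalMetric_zero_eq (hθ : ∀ v w, g θ.1.1 (θ.1.2 v) (θ.1.2 w) = inner ℝ v w) :
    (normalMetric g θ.1 0).IsInvertible := by
  refine isInvertible_of_posDef fun v hv ↦ ?_
  rw [normalMetric_zero, hθ]
  exact real_inner_self_pos.2 hv

theorem normalMetric_inverse_coord (hθ : ∀ v w, g θ.1.1 (θ.1.2 v) (θ.1.2 w) = inner ℝ v w)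
    (j : Fin n) :
    (normalMetric g θ.1 0).inverse (coord j) = EuclideanSpace.single j 1 := by
  rw [(normalMetric_zero_eq hθ).inverse_apply_eq]
  ext v
  rw [normalMetric_zero, hθ, EuclideanSpace.inner_single_left]
  simp

variable (hU : IsOpen U) (hg : ContDiffOn ℝ ∞ g U) (hinv : ∀ y ∈ U, (g y).IsInvertible)
include hU hg hinv

theorem contDiffAt_normalA (hx : θ.1.1 ∈ U)
    (hθ : ∀ v w, g θ.1.1 (θ.1.2 v) (θ.1.2 w) = inner ℝ v w) (i j : Fin n) :
    ContDiffAt ℝ ∞ (normalA g i j) (θ, 0) := by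
  have h := contDiffAt_normalMetric_inverse hU hg hinv (s := fun d : NormalParam n × _ ↦ d.1.1)
    (z := Prod.snd) (x := (θ, 0)) contDiffAt_fst.fst contDiffAt_snd hx (by simpa using hx)
    (normalMetric_zero_eq hθ)
  exact (coord i).contDiff.contDiffAt.comp _ (h.clm_apply (contDiffAt_const (c := coord j)))

theorem contDiffAt_normalB (hx : θ.1.1 ∈ U)
    (hθ : ∀ v w, g θ.1.1 (θ.1.2 v) (θ.1.2 w) = inner ℝ v w) (k : Fin n) :
    ContDiffAt ℝ ∞ (normalB g k) (θ, 0) := by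
  refine ContDiffAt.neg (ContDiffAt.sum fun j _ ↦ ?_)
  have h := contDiffAt_normalMetric_inverse hU hg hinv (s := fun d : NormalParam n × _ ↦ d.1.1)
    (z := Prod.snd) (x := (θ, 0)) contDiffAt_fst.fst contDiffAt_snd hx (by simpa using hx)
    (normalMetric_zero_eq hθ)
  have h2 := contDiffAt_normalChristoffel hU hg hinv (s := fun d : NormalParam n × _ ↦ d.1.1)
    (z := Prod.snd) (x := (θ, 0)) contDiffAt_fst.fst contDiffAt_snd
    (h.clm_apply (contDiffAt_const (c := coord j)))
    (contDiffAt_const (c := EuclideanSpace.single j (1 : ℝ))) hx (by simpa using hx)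
    (by simpa using isInvertible_frame hθ)
  exact (coord k).contDiff.contDiffAt.comp _ h2

theorem contDiffAt_normalΓ (hx : θ.1.1 ∈ U)
    (hθ : ∀ v w, g θ.1.1 (θ.1.2 v) (θ.1.2 w) = inner ℝ v w) (k : Fin n) :
    ContDiffAt ℝ ∞ (normalΓ g k) (θ, 0) := by
  have h2 := contDiffAt_normalChristoffel hU hg hinv (s := fun d : NormalParam n × _ ↦ d.1.1)
    (z := Prod.snd) (v := fun d ↦ d.1.2) (w := fun d ↦ d.1.2) (x := (θ, 0)) contDiffAt_fst.fst
    contDiffAt_snd contDiffAt_fst.snd contDiffAt_fst.snd hx (by simpa using hx)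
    (by simpa using isInvertible_frame hθ)
  exact (coord k).contDiff.contDiffAt.comp _ h2

theorem contDiffAt_normalG (hx : θ.1.1 ∈ U) : ContDiffAt ℝ ∞ (normalG g) (θ, 0) :=
  ((contDiffAt_normalMetric hU hg hinv (s := fun d : NormalParam n × _ ↦ d.1.1)
    (z := Prod.snd) (x := (θ, 0)) contDiffAt_fst.fst contDiffAt_snd hx
    (by simpa using hx)).clm_apply contDiffAt_fst.snd).clm_apply contDiffAt_fst.snd

theorem contDiffAt_comp_normalMap {α : EuclideanSpace ℝ (Fin n) → ℝ} (hα : ContDiffOn ℝ ∞ α U)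
    (hx : θ.1.1 ∈ U) : ContDiffAt ℝ ∞
      (fun d : NormalParam n × EuclideanSpace ℝ (Fin n) ↦ α (normalMap g d.1.1 d.2)) (θ, 0) := by
  have hα' : ContDiffAt ℝ ∞ α (normalMap g θ.1 0) :=
    hα.contDiffAt (hU.mem_nhds (by simpa using hx))
  exact hα'.comp (θ, (0 : EuclideanSpace ℝ (Fin n))) (contDiffAt_normalMap hU hg hinv
    (s := fun d : NormalParam n × _ ↦ d.1.1) (z := Prod.snd) (x := (θ, 0)) contDiffAt_fst.fst
    contDiffAt_snd hx)

theorem dir_normalA (hs : ∀ y v w, g y v w = g y w v) (hx : θ.1.1 ∈ U)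
    (hθ : ∀ v w, g θ.1.1 (θ.1.2 v) (θ.1.2 w) = inner ℝ v w) (w : EuclideanSpace ℝ (Fin n))
    (i j : Fin n) : dir w (fun y ↦ normalA g i j (θ, y)) 0 = 0 := by
  have := congrArg (fun L : EuclideanSpace ℝ (Fin n) →L[ℝ] ℝ ↦ L w)
    (fderiv_normalMetric_inverse hU hg hinv hs hx (normalMetric_zero_eq hθ) (coord i) (coord j))
  exact this

theorem dir_normalG (hs : ∀ y v w, g y v w = g y w v) (hx : θ.1.1 ∈ U)
    (w : EuclideanSpace ℝ (Fin n)) : dir w (fun y ↦ normalG g (θ, y)) 0 = 0 := by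
  have hd : DifferentiableAt ℝ (normalMetric g θ.1) 0 :=
    (contDiffAt_normalMetric hU hg hinv (s := fun _ ↦ θ.1) (z := id) contDiffAt_const
      contDiffAt_id hx (by simpa using hx)).differentiableAt (by simp)
  refine (fderiv_clm_apply_apply hd w θ.2 θ.2).trans ?_
  rw [fderiv_normalMetric hU hg hinv hs hx]
  simp

end NormalCoefficients

/-! ### Compactness of the orthonormal frames and uniform bounds for the coefficients. -/

section NormalCoefficients

variable {n : ℕ} {g : EuclideanSpace ℝ (Fin n) → EuclideanSpace ℝ (Fin n) →L[ℝ]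
    EuclideanSpace ℝ (Fin n) →L[ℝ] ℝ} {U K : Set (EuclideanSpace ℝ (Fin n))} {θ : NormalParam n}

theorem exists_coercive (hK : IsCompact K) (hg : ContinuousOn g K)
    (hpos : ∀ y ∈ K, ∀ v, v ≠ 0 → 0 < g y v v) :
    ∃ c : ℝ, 0 < c ∧ ∀ y ∈ K, ∀ v, c * ‖v‖ ^ 2 ≤ g y v v := by
  have hS : IsCompact (K ×ˢ Metric.sphere (0 : EuclideanSpace ℝ (Fin n)) 1) :=
    hK.prod (isCompact_sphere 0 1)
  obtain ⟨c, hc, hcS⟩ : ∃ c : ℝ, 0 < c ∧ ∀ y ∈ K, ∀ v, ‖v‖ = 1 → c ≤ g y v v := by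
    -- The product is empty when `K` is empty or the dimension is zero; any positive constant then
    -- works.
    rcases (K ×ˢ Metric.sphere (0 : EuclideanSpace ℝ (Fin n)) 1).eq_empty_or_nonempty with h | h
    · refine ⟨1, one_pos, fun y hy v hv ↦ ?_⟩
      have : (y, v) ∈ K ×ˢ Metric.sphere (0 : EuclideanSpace ℝ (Fin n)) 1 := ⟨hy, by simpa using hv⟩
      rw [h] at this
      exact this.elim
    · have hcont : ContinuousOn (fun q : EuclideanSpace ℝ (Fin n) × EuclideanSpace ℝ (Fin n) ↦
          g q.1 q.2 q.2) (K ×ˢ Metric.sphere 0 1) :=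
        ((hg.comp continuousOn_fst fun q hq ↦ hq.1).clm_apply continuousOn_snd).clm_apply
          continuousOn_snd
      obtain ⟨q, hq, hmin⟩ := hS.exists_isMinOn h hcont
      have hq2 : ‖q.2‖ = 1 := by simpa using hq.2
      refine ⟨g q.1 q.2 q.2, hpos _ hq.1 _ fun h0 ↦ ?_, fun y hy v hv ↦ ?_⟩
      · rw [h0, norm_zero] at hq2
        exact zero_ne_one hq2
      · exact hmin (show (y, v) ∈ _ from ⟨hy, by simpa using hv⟩)
  refine ⟨c, hc, fun y hy v ↦ ?_⟩
  rcases eq_or_ne v 0 with rfl | hv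
  · simp
  have hn : ‖v‖ ≠ 0 := norm_ne_zero_iff.2 hv
  have h1 := hcS y hy (‖v‖⁻¹ • v) (by rw [norm_smul, norm_inv, norm_norm, inv_mul_cancel₀ hn])
  simp only [map_smul, smul_apply, smul_eq_mul] at h1
  calc c * ‖v‖ ^ 2 ≤ (‖v‖⁻¹ * (‖v‖⁻¹ * g y v v)) * ‖v‖ ^ 2 := by gcongr
    _ = g y v v := by field_simp

/-- Coercivity of `g` over `K` gives c|Pv|² ≤ |v|² for an orthonormal frame P, so the frames are
bounded by √(1/c). Orthonormality is a closed condition. -/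
theorem isCompact_normalFrames (hK : IsCompact K) (hg : ContinuousOn g K)
    (hpos : ∀ y ∈ K, ∀ v, v ≠ 0 → 0 < g y v v) : IsCompact (normalFrames g K) := by
  obtain ⟨c, hc, hcK⟩ := exists_coercive hK hg hpos
  set T : Set (NormalParam n) := (K ×ˢ Metric.closedBall 0 (√(c⁻¹))) ×ˢ Metric.sphere 0 1 with hT
  have hTc : IsCompact T := by
    have : ProperSpace (EuclideanSpace ℝ (Fin n) →L[ℝ] EuclideanSpace ℝ (Fin n)) :=
      FiniteDimensional.proper ℝ _
    exact (hK.prod (isCompact_closedBall 0 _)).prod (isCompact_sphere 0 1)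
  have hcont (v w : EuclideanSpace ℝ (Fin n)) :
      ContinuousOn (fun θ : NormalParam n ↦ g θ.1.1 (θ.1.2 v) (θ.1.2 w)) T := by
    have h1 : ContinuousOn (fun θ : NormalParam n ↦ g θ.1.1) T :=
      hg.comp (by fun_prop) fun θ hθ ↦ hθ.1.1
    exact (h1.clm_apply (by fun_prop)).clm_apply (by fun_prop)
  have heq : normalFrames g K = T ∩ ⋂ v, ⋂ w,
      -- Each condition is intersected with `T` because `g` is known to be continuous only over `K`.
      (T ∩ (fun θ : NormalParam n ↦ g θ.1.1 (θ.1.2 v) (θ.1.2 w)) ⁻¹' {inner ℝ v w}) := by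
    ext θ
    simp only [normalFrames, Set.mem_ofPred_eq, Set.mem_inter_iff, Set.mem_iInter,
      Set.mem_preimage, Set.mem_singleton_iff]
    refine ⟨fun ⟨h1, h2, h3⟩ ↦ ?_, fun ⟨h1, h2⟩ ↦ ⟨h1.1.1, fun v w ↦ (h2 v w).2, by
      simpa using h1.2⟩⟩
    have hmem : θ ∈ T := by
      refine ⟨⟨h1, ?_⟩, by simpa using h3⟩
      rw [mem_closedBall_zero_iff]
      refine ContinuousLinearMap.opNorm_le_bound _ (Real.sqrt_nonneg _) fun v ↦ ?_
      have h4 := hcK _ h1 (θ.1.2 v)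
      rw [h2, real_inner_self_eq_norm_sq] at h4
      refine abs_le_of_sq_le_sq' ?_ (by positivity) |>.2
      rw [mul_pow, Real.sq_sqrt (by positivity), inv_mul_eq_div, le_div_iff₀ hc]
      linarith
    exact ⟨hmem, fun v w ↦ ⟨hmem, h2 v w⟩⟩
  rw [heq]
  refine hTc.inter_right (isClosed_iInter fun v ↦ isClosed_iInter fun w ↦ ?_)
  exact (hcont v w).preimage_isClosed_of_isClosed hTc.isClosed isClosed_singleton

/-- Normal coordinates give geodesic coefficients, with uniform bounds over compact sets. -/
theorem exists_flatCoefficients (hU : IsOpen U) (hg : ContDiffOn ℝ ∞ g U)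
    (hs : ∀ y v w, g y v w = g y w v) (hpos : ∀ y ∈ U, ∀ v, v ≠ 0 → 0 < g y v v)
    {α : EuclideanSpace ℝ (Fin n) → ℝ} (hα : ContDiffOn ℝ ∞ α U) (hK : IsCompact K)
    (hKU : K ⊆ U) :
    ∃ Λ : ℝ, 0 ≤ Λ ∧ ∀ θ ∈ normalFrames g K, ∀ t : ℝ,
      FlatCoefficients (fun i ↦ ((EuclideanSpace.single i 1, 0) : EuclideanSpace ℝ (Fin n) × ℝ))
        (0, 1) (θ.2, 0) (0, t) Λ (fun i j q ↦ normalA g i j (θ, q.1))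
        (fun k q ↦ normalB g k (θ, q.1)) (fun k q ↦ normalΓ g k (θ, q.1))
        (fun q ↦ normalG g (θ, q.1)) ∧
      (∀ k, |dir ((EuclideanSpace.single k 1, 0) : EuclideanSpace ℝ (Fin n) × ℝ)
        (fun q ↦ α (normalMap g θ.1 q.1)) (0, t)| ≤ Λ) ∧
      |dir ((θ.2, 0) : EuclideanSpace ℝ (Fin n) × ℝ) (dir (θ.2, 0)
        fun q ↦ α (normalMap g θ.1 q.1)) (0, t)| ≤ Λ := by
  have hinv (y : EuclideanSpace ℝ (Fin n)) (hy : y ∈ U) : (g y).IsInvertible :=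
    isInvertible_of_posDef (hpos y hy)
  have hc := isCompact_normalFrames hK (hg.continuousOn.mono hKU) fun y hy ↦ hpos y (hKU hy)
  have hA (i j : Fin n) (θ : NormalParam n) (hθ : θ ∈ normalFrames g K) :=
    contDiffAt_normalA hU hg hinv (hKU hθ.1) hθ.2.1 i j
  have hB (k : Fin n) (θ : NormalParam n) (hθ : θ ∈ normalFrames g K) :=
    contDiffAt_normalB hU hg hinv (hKU hθ.1) hθ.2.1 k
  have hΓ (k : Fin n) (θ : NormalParam n) (hθ : θ ∈ normalFrames g K) :=
    contDiffAt_normalΓ hU hg hinv (hKU hθ.1) hθ.2.1 k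
  have hG (θ : NormalParam n) (hθ : θ ∈ normalFrames g K) :=
    contDiffAt_normalG hU hg hinv (hKU hθ.1)
  have hα' (θ : NormalParam n) (hθ : θ ∈ normalFrames g K) :=
    contDiffAt_comp_normalMap hU hg hinv hα (hKU hθ.1)
  obtain ⟨Λ₁, h₁0, h₁⟩ := exists_forall_abs_dir_le_of_finite hc
    (f := fun p : Fin n × Fin n ↦ normalA g p.1 p.2) fun p ↦ hA p.1 p.2
  obtain ⟨Λ₂, h₂0, h₂⟩ := exists_forall_abs_dir_le_of_finite hc hB
  obtain ⟨Λ₃, h₃0, h₃⟩ := exists_forall_abs_dir_le_of_finite hc hΓ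
  obtain ⟨Λ₄, h₄0, h₄⟩ := exists_forall_abs_dir_le hc hG
  obtain ⟨Λ₅, h₅0, h₅⟩ := exists_forall_abs_dir_le hc hα'
  refine ⟨Λ₁ + Λ₂ + Λ₃ + Λ₄ + Λ₅, by positivity, fun θ hθ t ↦ ?_⟩
  have hslice {f : NormalParam n × EuclideanSpace ℝ (Fin n) → ℝ} (hf : ContDiffAt ℝ ∞ f (θ, 0)) :
      ContDiffAt ℝ ∞ (fun y ↦ f (θ, y)) 0 :=
    hf.comp 0 (contDiffAt_const.prodMk contDiffAt_id)
  have hlift {f : EuclideanSpace ℝ (Fin n) → ℝ} (hf : ContDiffAt ℝ ∞ f 0) :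
      ContDiffAt ℝ ∞ (fun q : EuclideanSpace ℝ (Fin n) × ℝ ↦ f q.1) (0, t) :=
    ContDiffAt.comp (g := f) (0, t) hf contDiffAt_fst
  have he (i : Fin n) : ‖(EuclideanSpace.single i (1 : ℝ))‖ ≤ 1 := by simp
  have hξ : ‖θ.2‖ ≤ 1 := hθ.2.2.le
  have sA (i j : Fin n) := hslice (hA i j θ hθ)
  have sB (k : Fin n) := hslice (hB k θ hθ)
  have sΓ (k : Fin n) := hslice (hΓ k θ hθ)
  have sG := hslice (hG θ hθ)
  have sα := hslice (hα' θ hθ)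
  have hA0 (i j : Fin n) : normalA g i j (θ, 0) = if i = j then 1 else 0 := by
    rw [normalA, normalMetric_inverse_coord hθ.2.1]
    simp
  have dir_zero (f : EuclideanSpace ℝ (Fin n) → ℝ) (y : EuclideanSpace ℝ (Fin n)) :
      dir 0 f y = 0 := map_zero _
  have dir_zero_right (w : EuclideanSpace ℝ (Fin n)) (f : EuclideanSpace ℝ (Fin n) → ℝ)
      (y : EuclideanSpace ℝ (Fin n)) : dir w (dir 0 f) y = 0 := by
    have : dir 0 f = fun _ ↦ 0 := funext fun y ↦ dir_zero f y
    rw [this, dir_const]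
  refine ⟨?_, fun k ↦ ?_, ?_⟩
  · constructor
    · exact fun i j ↦ hlift (sA i j)
    · exact fun i ↦ hlift (sB i)
    · exact fun i ↦ hlift (sΓ i)
    · exact hlift sG
    · exact hA0
    · intro w i j
      rw [dir₁_comp_fst (sA i j)]
      exact dir_normalA hU hg hinv hs (hKU hθ.1) hθ.2.1 _ i j
    · intro i
      simp [normalB]
    · intro i
      simp [normalΓ]
    · change normalMetric g θ.1 0 θ.2 θ.2 = 1
      rw [normalMetric_zero, hθ.2.1, real_inner_self_eq_norm_sq, hθ.2.2, one_pow]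
    · intro w
      rw [dir₁_comp_fst sG]
      exact dir_normalG hU hg hinv hs (hKU hθ.1) _
    · intro w i j
      rw [dir₂_comp_fst (sA i j), dir_zero_right]
    · intro i
      rw [dir₁_comp_fst (sΓ i), dir_zero]
    · intro w i
      rw [dir₂_comp_fst (sΓ i), dir_zero_right]
    · intro w
      rw [dir₂_comp_fst sG, dir_zero_right]
    · intro i j k
      rw [dir₂_comp_fst (sA i j)]
      linarith [(h₁ (i, j) θ hθ _ _ (he k) (he k)).2]
    · intro i j
      rw [dir₂_comp_fst (sA i j)]
      linarith [(h₁ (i, j) θ hθ _ _ hξ hξ).2]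
    · intro i k
      rw [dir₁_comp_fst (sB i)]
      linarith [(h₂ i θ hθ _ _ (he k) (he k)).1]
    · intro i
      rw [dir₁_comp_fst (sB i)]
      linarith [(h₂ i θ hθ _ _ hξ hξ).1]
    · intro i
      rw [dir₂_comp_fst (sB i)]
      linarith [(h₂ i θ hθ _ _ hξ hξ).2]
    · intro i k
      rw [dir₁_comp_fst (sΓ i)]
      linarith [(h₃ i θ hθ _ _ (he k) (he k)).1]
    · intro i k
      rw [dir₂_comp_fst (sΓ i)]
      linarith [(h₃ i θ hθ _ _ (he k) (he k)).2]
    · intro k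
      rw [dir₂_comp_fst sG]
      linarith [(h₄ θ hθ _ _ (he k) (he k)).2]
  · rw [dir₁_comp_fst sα]
    linarith [(h₅ θ hθ _ _ (he k) (he k)).1]
  · rw [dir₂_comp_fst sα]
    linarith [(h₅ θ hθ _ _ hξ hξ).2]

end NormalCoefficients

/-! ### Inner products and traces in a basis that need not be orthonormal. -/

section DualFrame

variable {n : ℕ} {T : Type*} [NormedAddCommGroup T] [InnerProductSpace ℝ T] [FiniteDimensional ℝ T]
  {ℓ β : Fin n → T}

theorem inner_eq_sum_dual (hβ : ∀ w, w = ∑ j, inner ℝ (β j) w • ℓ j) (v w : T) :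
    inner ℝ v w = ∑ j, inner ℝ v (ℓ j) * inner ℝ w (β j) := by
  conv_lhs => rw [hβ w, inner_sum]
  refine Finset.sum_congr rfl fun j _ ↦ ?_
  rw [real_inner_smul_right, real_inner_comm, mul_comm]

/-- The trace of an endomorphism in terms of a basis `ℓ` with metric dual `β`. -/
theorem sum_inner_apply_self (hβ : ∀ w, w = ∑ j, inner ℝ (β j) w • ℓ j) (A : T →L[ℝ] T) :
    ∑ i, inner ℝ (A (stdOrthonormalBasis ℝ T i)) (stdOrthonormalBasis ℝ T i)
      = ∑ j, inner ℝ (A (β j)) (ℓ j) := by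
  set b := stdOrthonormalBasis ℝ T
  calc ∑ i, inner ℝ (A (b i)) (b i)
      = ∑ i, ∑ j, inner ℝ (β j) (b i) * inner ℝ (A (b i)) (ℓ j) := by
        refine Finset.sum_congr rfl fun i _ ↦ ?_
        rw [inner_eq_sum_dual hβ]
        refine Finset.sum_congr rfl fun j _ ↦ ?_
        rw [real_inner_comm (β j), mul_comm]
    _ = ∑ j, ∑ i, inner ℝ (β j) (b i) * inner ℝ (A (b i)) (ℓ j) := Finset.sum_comm
    _ = ∑ j, inner ℝ (A (β j)) (ℓ j) := by
        refine Finset.sum_congr rfl fun j _ ↦ ?_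
        have h := b.sum_repr' (β j)
        rw [← h, map_sum, sum_inner]
        refine Finset.sum_congr rfl fun i _ ↦ ?_
        rw [h, map_smul, real_inner_smul_left, real_inner_comm]

end DualFrame

/-! ### First and second derivatives on the manifold in normal coordinates. -/

section ChangeOfCoordinates

variable {n : ℕ} {M : Type*} [TopologicalSpace M] [ChartedSpace (EuclideanSpace ℝ (Fin n)) M]
  [IsManifold (𝓡 n) ∞ M] [RiemannianBundle (fun x : M ↦ TangentSpace (𝓡 n) x)]

/-- The inverse of the normal coordinate chart with parameter `θ`. -/
def normalPoint (p : M) (θ : NormalParam n) (y : EuclideanSpace ℝ (Fin n)) : M :=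
  (extChartAt (𝓡 n) p).symm (normalMap (chartMetric p) θ.1 y)

/-- The coordinate vector fields of the normal coordinates. -/
def normalField (p : M) (θ : NormalParam n) (y w : EuclideanSpace ℝ (Fin n)) :
    TangentSpace (𝓡 n) (normalPoint p θ y) :=
  chartField p (normalDeriv (chartMetric p) θ.1 y w) (normalPoint p θ y)

variable {p : M} {θ : NormalParam n} {y : EuclideanSpace ℝ (Fin n)}

theorem inner_normalField (v w : EuclideanSpace ℝ (Fin n)) :
    inner ℝ (normalField p θ y v) (normalField p θ y w)
      = normalMetric (chartMetric p) θ.1 y v w := rfl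

theorem eq_sum_single (w : EuclideanSpace ℝ (Fin n)) :
    w = ∑ i, w i • EuclideanSpace.single i (1 : ℝ) := by
  ext j; simp [Finset.sum_apply, Pi.single_apply]

theorem normalField_sum (w : EuclideanSpace ℝ (Fin n)) :
    normalField p θ y w = ∑ i, w i • normalField p θ y (EuclideanSpace.single i 1) := by
  let L : EuclideanSpace ℝ (Fin n) →ₗ[ℝ] TangentSpace (𝓡 n) (normalPoint p θ y) :=
    { toFun := fun w ↦ normalField p θ y w
      map_add' := fun v w ↦ by rw [normalField, map_add, chartField_add]; rfl
      map_smul' := fun c v ↦ by rw [normalField, map_smul, chartField_smul]; rfl }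
  change L w = ∑ i, w i • L (EuclideanSpace.single i 1)
  conv_lhs => rw [eq_sum_single w, map_sum]
  exact Finset.sum_congr rfl fun i _ ↦ map_smul _ _ _

variable [IsContMDiffRiemannianBundle (𝓡 n) ∞ (EuclideanSpace ℝ (Fin n))
  (fun x : M ↦ TangentSpace (𝓡 n) x)]

theorem hasFDerivAt_normalMap_chart (hθ : θ.1.1 ∈ (extChartAt (𝓡 n) p).target) :
    HasFDerivAt (normalMap (chartMetric p) θ.1) (normalDeriv (chartMetric p) θ.1 y) y :=
  hasFDerivAt_normalMap <| christoffel_symm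
    ((contDiffAt_chartMetric p hθ).differentiableAt (by simp))
    (Eventually.of_forall fun z ↦ chartMetric_symm p z)

theorem contDiff_normalMap_chart (hθ : θ.1.1 ∈ (extChartAt (𝓡 n) p).target) :
    ContDiff ℝ ∞ (normalMap (chartMetric p) θ.1) :=
  contDiff_iff_contDiffAt.2 fun _ ↦ contDiffAt_normalMap (isOpen_extChartAt_target_model p)
    (contDiffOn_chartMetric p) (fun _ ↦ isInvertible_chartMetric p) contDiffAt_const
    contDiffAt_id hθ

variable (hθ : θ.1.1 ∈ (extChartAt (𝓡 n) p).target)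
  (hy : normalMap (chartMetric p) θ.1 y ∈ (extChartAt (𝓡 n) p).target)
include hθ hy

theorem mvfderiv_normalField {φ : M → ℝ}
    (hφ : DifferentiableAt ℝ (chartRep p φ) (normalMap (chartMetric p) θ.1 y))
    (hφ' : MDifferentiableAt (𝓡 n) 𝓘(ℝ, ℝ) φ (normalPoint p θ y))
    (w : EuclideanSpace ℝ (Fin n)) :
    mvfderiv (𝓡 n) φ (normalPoint p θ y) (normalField p θ y w)
      = dir w (fun y ↦ φ (normalPoint p θ y)) y := by
  have h1 : dir w (fun y ↦ φ (normalPoint p θ y)) y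
      = fderiv ℝ (chartRep p φ) (normalMap (chartMetric p) θ.1 y)
        (normalDeriv (chartMetric p) θ.1 y w) :=
    congrArg (fun L : EuclideanSpace ℝ (Fin n) →L[ℝ] ℝ ↦ L w)
      (hφ.hasFDerivAt.comp y (hasFDerivAt_normalMap_chart hθ)).fderiv
  have h2 := mvfderiv_chartField p (normalDeriv (chartMetric p) θ.1 y w)
    ((extChartAt (𝓡 n) p).map_target hy) hφ'
  rw [(extChartAt (𝓡 n) p).right_inv hy] at h2
  exact h2.trans h1.symm

/-- Chain rule applied to `hess_chart`. The second derivative of `normalMap` is minus the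
Christoffel term at the centre; combined with the symbols of the chart and moved back by the inverse
of `normalDeriv`, it gives `normalChristoffel`. -/
theorem hess_normalField {φ : M → ℝ} (hφ : ContMDiff (𝓡 n) 𝓘(ℝ, ℝ) ∞ φ)
    (hinv : (normalDeriv (chartMetric p) θ.1 y).IsInvertible) (v w : EuclideanSpace ℝ (Fin n)) :
    hess (𝓡 n) φ (normalPoint p θ y) (normalField p θ y v) (normalField p θ y w)
      = dir v (dir w fun y ↦ φ (normalPoint p θ y)) y
        - dir (normalChristoffel (chartMetric p) θ.1 y v w) (fun y ↦ φ (normalPoint p θ y)) y := by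
  set g := chartMetric (n := n) p with hg
  have hU := isOpen_extChartAt_target_model (n := n) p
  have hcd (z : EuclideanSpace ℝ (Fin n)) (hz : normalMap g θ.1 z ∈ (extChartAt (𝓡 n) p).target) :
      ContDiffAt ℝ ∞ (chartRep p φ) (normalMap g θ.1 z) :=
    (contDiffOn_chartRep p hφ).contDiffAt (hU.mem_nhds hz)
  have hdir (u z : EuclideanSpace ℝ (Fin n))
      (hz : normalMap g θ.1 z ∈ (extChartAt (𝓡 n) p).target) :
      dir u (fun y ↦ φ (normalPoint p θ y)) z
      = fderiv ℝ (chartRep p φ) (normalMap g θ.1 z) (normalDeriv g θ.1 z u) :=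
    congrArg (fun L : EuclideanSpace ℝ (Fin n) →L[ℝ] ℝ ↦ L u)
      (((hcd z hz).differentiableAt (by simp)).hasFDerivAt.comp z
        (hasFDerivAt_normalMap_chart hθ)).fderiv
  have hd2 : HasFDerivAt (fderiv ℝ (chartRep p φ))
      (fderiv ℝ (fderiv ℝ (chartRep p φ)) (normalMap g θ.1 y)) (normalMap g θ.1 y) :=
    (((hcd y hy).fderiv_right (m := ∞) (by simp)).differentiableAt (by simp)).hasFDerivAt
  have h1 : HasFDerivAt (fun z ↦ fderiv ℝ (chartRep p φ) (normalMap g θ.1 z)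
      (normalDeriv g θ.1 z w)) _ y :=
    (hd2.comp y (hasFDerivAt_normalMap_chart hθ)).clm_apply (hasFDerivAt_normalDeriv w)
  have hev : dir w (fun y ↦ φ (normalPoint p θ y)) =ᶠ[𝓝 y] fun z ↦
      fderiv ℝ (chartRep p φ) (normalMap g θ.1 z) (normalDeriv g θ.1 z w) := by
    filter_upwards [(contDiff_normalMap_chart hθ).continuous.continuousAt.preimage_mem_nhds
      (hU.mem_nhds hy)] with z hz
    exact hdir w z hz
  have h2 : HasFDerivAt (fun z ↦ fderiv ℝ (chartRep p φ) z (normalDeriv g θ.1 y w)) _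
      (normalMap g θ.1 y) := hd2.clm_apply (hasFDerivAt_const _ _)
  rw [normalField, normalField, normalPoint, hess_chart p hφ hy, h2.fderiv, dir,
    hev.fderiv_eq, h1.fderiv, hdir _ y hy, normalChristoffel, hinv.self_apply_inverse, map_sub]
  simp
  ring

end ChangeOfCoordinates

/-! ### Gradient products, Laplacian and Hessian through the normal coefficients. -/

section NormalFormulas

variable {n : ℕ}

theorem dir_eq_sum_single (w : EuclideanSpace ℝ (Fin n)) (f : EuclideanSpace ℝ (Fin n) → ℝ)
    (y : EuclideanSpace ℝ (Fin n)) :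
    dir w f y = ∑ i, w i * dir (EuclideanSpace.single i 1) f y := by
  conv_lhs => rw [eq_sum_single w]
  exact dir_sum_dir _ _ _ _ _

variable {M : Type*} [TopologicalSpace M] [ChartedSpace (EuclideanSpace ℝ (Fin n)) M]
  [IsManifold (𝓡 n) ∞ M] [RiemannianBundle (fun x : M ↦ TangentSpace (𝓡 n) x)]
  [IsContMDiffRiemannianBundle (𝓡 n) ∞ (EuclideanSpace ℝ (Fin n))
    (fun x : M ↦ TangentSpace (𝓡 n) x)]
  {p : M} {θ : NormalParam n} {y : EuclideanSpace ℝ (Fin n)}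

variable (hθ : θ.1.1 ∈ (extChartAt (𝓡 n) p).target)
  (hy : normalMap (chartMetric p) θ.1 y ∈ (extChartAt (𝓡 n) p).target)
  (hinv : (normalDeriv (chartMetric p) θ.1 y).IsInvertible)

include hy hinv in
theorem isInvertible_normalMetric : (normalMetric (chartMetric p) θ.1 y).IsInvertible := by
  refine isInvertible_of_posDef fun v hv ↦ chartMetric_pos p hy fun h ↦ hv ?_
  exact hinv.injective (h.trans (map_zero _).symm)

include hy hinv in
theorem normalField_surjective : Function.Surjective (normalField p θ y) :=
  (chartField_bijective p ((extChartAt (𝓡 n) p).map_target hy)).2.comp hinv.surjective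

-- The vectors with components g⁻¹(dyʲ) are metrically dual to the coordinate frame. They turn inner
-- products and traces into contractions with `normalA`, also away from the centre, where the frame
-- is not orthonormal.
include hy hinv in
theorem normalField_dual (w : TangentSpace (𝓡 n) (normalPoint p θ y)) :
    w = ∑ j, inner ℝ (normalField p θ y ((normalMetric (chartMetric p) θ.1 y).inverse (coord j))) w
      • normalField p θ y (EuclideanSpace.single j 1) := by
  obtain ⟨v, rfl⟩ := normalField_surjective hy hinv w
  conv_lhs => rw [normalField_sum]
  refine Finset.sum_congr rfl fun j _ ↦ ?_
  rw [inner_normalField, (isInvertible_normalMetric hy hinv).self_apply_inverse]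
  rfl

include hθ hy hinv

theorem inner_grad_normal {φ φ' : M → ℝ}
    (hφ : DifferentiableAt ℝ (chartRep p φ) (normalMap (chartMetric p) θ.1 y))
    (hφm : MDifferentiableAt (𝓡 n) 𝓘(ℝ, ℝ) φ (normalPoint p θ y))
    (hφ' : DifferentiableAt ℝ (chartRep p φ') (normalMap (chartMetric p) θ.1 y))
    (hφm' : MDifferentiableAt (𝓡 n) 𝓘(ℝ, ℝ) φ' (normalPoint p θ y)) :
    inner ℝ (grad (𝓡 n) φ' (normalPoint p θ y)) (grad (𝓡 n) φ (normalPoint p θ y))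
      = ∑ i, ∑ j, normalA (chartMetric p) i j (θ, y)
        * (dir (EuclideanSpace.single i 1) (fun y ↦ φ (normalPoint p θ y)) y
          * dir (EuclideanSpace.single j 1) (fun y ↦ φ' (normalPoint p θ y)) y) := by
  rw [inner_eq_sum_dual (normalField_dual hy hinv), Finset.sum_comm]
  refine Finset.sum_congr rfl fun j _ ↦ ?_
  rw [inner_grad, inner_grad, mvfderiv_normalField hθ hy hφ hφm,
    mvfderiv_normalField hθ hy hφ' hφm', dir_eq_sum_single (ContinuousLinearMap.inverse _ _),
    Finset.mul_sum]
  refine Finset.sum_congr rfl fun i _ ↦ ?_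
  rw [normalA]
  ring

theorem laplacian_normal {φ : M → ℝ} (hφ : ContMDiff (𝓡 n) 𝓘(ℝ, ℝ) ∞ φ) :
    laplacian (𝓡 n) φ (normalPoint p θ y)
      = ∑ i, ∑ j, normalA (chartMetric p) i j (θ, y) * dir (EuclideanSpace.single i 1)
          (dir (EuclideanSpace.single j 1) fun y ↦ φ (normalPoint p θ y)) y
        + ∑ k, normalB (chartMetric p) k (θ, y) *
          dir (EuclideanSpace.single k 1) (fun y ↦ φ (normalPoint p θ y)) y := by
  have h := sum_inner_apply_self (normalField_dual hy hinv)
    (leviCivita (𝓡 n) M (grad (𝓡 n) φ) (normalPoint p θ y))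
  have h2 (j : Fin n) := hess_normalField hθ hy hφ hinv
    ((normalMetric (chartMetric p) θ.1 y).inverse (coord j)) (EuclideanSpace.single j 1)
  refine h.trans ((Finset.sum_congr rfl fun j _ ↦ h2 j).trans ?_)
  rw [Finset.sum_sub_distrib, sub_eq_add_neg]
  congr 1
  · rw [Finset.sum_comm]
    exact Finset.sum_congr rfl fun j _ ↦ dir_eq_sum_single _ _ _
  · simp only [normalB, neg_mul, Finset.sum_neg_distrib, Finset.sum_mul]
    rw [Finset.sum_comm]
    exact congrArg _ (Finset.sum_congr rfl fun j _ ↦ dir_eq_sum_single _ _ _)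

theorem hess_normal {φ : M → ℝ} (hφ : ContMDiff (𝓡 n) 𝓘(ℝ, ℝ) ∞ φ) :
    hess (𝓡 n) φ (normalPoint p θ y) (normalField p θ y θ.2) (normalField p θ y θ.2)
      = dir θ.2 (dir θ.2 fun y ↦ φ (normalPoint p θ y)) y
        - ∑ k, normalΓ (chartMetric p) k (θ, y) *
          dir (EuclideanSpace.single k 1) (fun y ↦ φ (normalPoint p θ y)) y := by
  rw [hess_normalField hθ hy hφ hinv, dir_eq_sum_single (normalChristoffel _ _ _ _ _)]
  rfl

end NormalFormulas

/-! ### Symmetry of the Hessian, and its norm in terms of its quadratic form. -/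

section HessianAlgebra

variable {n : ℕ} {M : Type*} [TopologicalSpace M] [ChartedSpace (EuclideanSpace ℝ (Fin n)) M]
  [IsManifold (𝓡 n) ∞ M] [RiemannianBundle (fun x : M ↦ TangentSpace (𝓡 n) x)]
  [IsContMDiffRiemannianBundle (𝓡 n) ∞ (EuclideanSpace ℝ (Fin n))
    (fun x : M ↦ TangentSpace (𝓡 n) x)]

theorem hess_symm {φ : M → ℝ} (hφ : ContMDiff (𝓡 n) 𝓘(ℝ, ℝ) ∞ φ) (x : M)
    (v w : TangentSpace (𝓡 n) x) : hess (𝓡 n) φ x v w = hess (𝓡 n) φ x w v := by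
  have hx := mem_extChartAt_source (I := 𝓡 n) x
  have hy := mem_extChartAt_target (I := 𝓡 n) x
  obtain ⟨v, rfl⟩ := (chartField_bijective x hx).2 v
  obtain ⟨w, rfl⟩ := (chartField_bijective x hx).2 w
  have h (v w) := hess_chart x hφ hy v w
  rw [(extChartAt (𝓡 n) x).left_inv hx] at h
  have hd : ContDiffAt ℝ ∞ (chartRep x φ) (extChartAt (𝓡 n) x x) :=
    (contDiffOn_chartRep x hφ).contDiffAt ((isOpen_extChartAt_target_model x).mem_nhds hy)
  beta_reduce
  rw [h, h, christoffel_symm ((contDiffAt_chartMetric x hy).differentiableAt (by simp))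
    (Eventually.of_forall fun z ↦ chartMetric_symm x z) v w]
  congr 1
  exact dir_comm_apply v w hd

theorem hess_add_left (φ : M → ℝ) (x : M) (v v' w : TangentSpace (𝓡 n) x) :
    hess (𝓡 n) φ x (v + v') w = hess (𝓡 n) φ x v w + hess (𝓡 n) φ x v' w := by
  simp only [hess, map_add, inner_add_left]

theorem hess_add_right (φ : M → ℝ) (x : M) (v w w' : TangentSpace (𝓡 n) x) :
    hess (𝓡 n) φ x v (w + w') = hess (𝓡 n) φ x v w + hess (𝓡 n) φ x v w' :=
  inner_add_right _ _ _

theorem hess_smul_left (φ : M → ℝ) (x : M) (c : ℝ) (v w : TangentSpace (𝓡 n) x) :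
    hess (𝓡 n) φ x (c • v) w = c * hess (𝓡 n) φ x v w := by
  simp only [hess, map_smul, real_inner_smul_left]

theorem hess_smul_right (φ : M → ℝ) (x : M) (c : ℝ) (v w : TangentSpace (𝓡 n) x) :
    hess (𝓡 n) φ x v (c • w) = c * hess (𝓡 n) φ x v w :=
  real_inner_smul_right _ _ _

theorem abs_hess_le_hessNorm (φ : M → ℝ) (x : M) {v : TangentSpace (𝓡 n) x} (hv : ‖v‖ = 1) :
    |hess (𝓡 n) φ x v v| ≤ hessNorm (𝓡 n) φ x := by
  set b := stdOrthonormalBasis ℝ (TangentSpace (𝓡 n) x) with hb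
  have hsum : hess (𝓡 n) φ x v v
      = ∑ i, ∑ j, (inner ℝ (b i) v * inner ℝ (b j) v) * hess (𝓡 n) φ x (b i) (b j) := by
    have h1 := b.sum_repr' v
    conv_lhs => rw [← h1]
    simp only [hess, map_sum, map_smul, sum_inner, inner_sum, real_inner_smul_left,
      real_inner_smul_right]
    rw [Finset.sum_comm]
    exact Finset.sum_congr rfl fun i _ ↦ Finset.sum_congr rfl fun j _ ↦ by ring
  have hone : ∑ i, inner ℝ (b i) v ^ 2 = 1 := by
    have := b.sum_sq_norm_inner_right v
    simpa [hv] using this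
  refine Real.le_sqrt_of_sq_le ?_
  rw [sq_abs, hsum, ← Finset.sum_product', ← Finset.sum_product']
  refine (Finset.sum_mul_sq_le_sq_mul_sq _ _ _).trans ?_
  rw [Finset.sum_product' (f := fun i j ↦ (inner ℝ (b i) v * inner ℝ (b j) v) ^ 2)]
  simp only [mul_pow, ← Finset.mul_sum, ← Finset.sum_mul, hone]
  simp only [one_mul]
  rfl

/-- An upper bound on the diagonal and a bound on the trace bound each diagonal entry from below.
The off-diagonal entries follow by polarization with bᵢ ± bⱼ. -/
theorem hessNorm_le_of_hess_le {φ : M → ℝ} (hφ : ContMDiff (𝓡 n) 𝓘(ℝ, ℝ) ∞ φ) (x : M)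
    {C K : ℝ} (hC : 0 ≤ C) (hK : |laplacian (𝓡 n) φ x| ≤ K)
    (h : ∀ v : TangentSpace (𝓡 n) x, ‖v‖ = 1 → hess (𝓡 n) φ x v v ≤ C) :
    hessNorm (𝓡 n) φ x ≤ n * (3 * (n * C + C + K)) := by
  set b := stdOrthonormalBasis ℝ (TangentSpace (𝓡 n) x) with hb
  have hK0 : 0 ≤ K := (abs_nonneg _).trans hK
  have hfr : Module.finrank ℝ (TangentSpace (𝓡 n) x) = n :=
    (finrank_euclideanSpace_fin (𝕜 := ℝ) (n := n))
  have h' (v : TangentSpace (𝓡 n) x) : hess (𝓡 n) φ x v v ≤ C * ‖v‖ ^ 2 := by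
    rcases eq_or_ne v 0 with rfl | hv
    · simp [hess]
    have hn : ‖v‖ ≠ 0 := norm_ne_zero_iff.2 hv
    have h1 := h (‖v‖⁻¹ • v) (by rw [norm_smul, norm_inv, norm_norm, inv_mul_cancel₀ hn])
    rw [hess_smul_left, hess_smul_right] at h1
    calc hess (𝓡 n) φ x v v = (‖v‖⁻¹ * (‖v‖⁻¹ * hess (𝓡 n) φ x v v)) * ‖v‖ ^ 2 := by field_simp
      _ ≤ C * ‖v‖ ^ 2 := by gcongr
  have hdiag (i) : hess (𝓡 n) φ x (b i) (b i) ≤ C := h _ (b.norm_eq_one i)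
  -- One diagonal entry is the trace minus the others, each of which is at most `C`.
  have hdiag' (i) : -(n * C + K) ≤ hess (𝓡 n) φ x (b i) (b i) := by
    have h1 : laplacian (𝓡 n) φ x = hess (𝓡 n) φ x (b i) (b i)
        + ∑ j ∈ Finset.univ.erase i, hess (𝓡 n) φ x (b j) (b j) :=
      (Finset.add_sum_erase _ _ (Finset.mem_univ i)).symm
    have h2 : ∑ j ∈ Finset.univ.erase i, hess (𝓡 n) φ x (b j) (b j) ≤ n * C := by
      refine (Finset.sum_le_card_nsmul _ _ C fun j _ ↦ hdiag j).trans ?_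
      rw [nsmul_eq_mul]
      refine mul_le_mul_of_nonneg_right ?_ hC
      have := Finset.card_le_univ (Finset.univ.erase i)
      exact_mod_cast this.trans_eq ((Fintype.card_fin _).trans hfr)
    linarith [(abs_le.1 hK).1]
  have hent (i j) : |hess (𝓡 n) φ x (b i) (b j)| ≤ 3 * (n * C + C + K) := by
    have hnC : 0 ≤ n * C := by positivity
    have hn1 : ‖b i + b j‖ ^ 2 ≤ 4 := by
      have : ‖b i + b j‖ ≤ 2 := (norm_add_le _ _).trans (by rw [b.norm_eq_one, b.norm_eq_one]; norm_num)
      nlinarith [norm_nonneg (b i + b j)]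
    have hn2 : ‖b i + (-1 : ℝ) • b j‖ ^ 2 ≤ 4 := by
      have : ‖b i + (-1 : ℝ) • b j‖ ≤ 2 :=
        (norm_add_le _ _).trans (by rw [norm_smul, b.norm_eq_one, b.norm_eq_one]; norm_num)
      nlinarith [norm_nonneg (b i + (-1 : ℝ) • b j)]
    have h1 := (h' (b i + b j)).trans (mul_le_mul_of_nonneg_left hn1 hC)
    have h2 := (h' (b i + (-1 : ℝ) • b j)).trans (mul_le_mul_of_nonneg_left hn2 hC)
    simp only [hess_add_left, hess_add_right, hess_smul_left, hess_smul_right] at h1 h2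
    rw [hess_symm hφ x (b j) (b i)] at h1 h2
    rw [abs_le]
    constructor <;> linarith [hdiag' i, hdiag' j]
  refine Real.sqrt_le_iff.2 ⟨by positivity, ?_⟩
  have h3 : ∑ i, ∑ j, hess (𝓡 n) φ x (b i) (b j) ^ 2
      ≤ ∑ _i : Fin (Module.finrank ℝ (TangentSpace (𝓡 n) x)),
        ∑ _j : Fin (Module.finrank ℝ (TangentSpace (𝓡 n) x)), (3 * (n * C + C + K)) ^ 2 :=
    Finset.sum_le_sum fun i _ ↦ Finset.sum_le_sum fun j _ ↦ sq_le_sq' (abs_le.1 (hent i j)).1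
      (abs_le.1 (hent i j)).2
  refine h3.trans (le_of_eq ?_)
  simp only [Finset.sum_const, Finset.card_univ, Fintype.card_fin, hfr, nsmul_eq_mul]
  ring

end HessianAlgebra

/-! ### Time and space derivatives of functions smooth up to the ends of the time interval. -/

section SlabCalculus

variable {F : Type*} [NormedAddCommGroup F] [NormedSpace ℝ F] {O : Set F} {f : F × ℝ → ℝ}

theorem uniqueDiffOn_slab (hO : IsOpen O) : UniqueDiffOn ℝ (O ×ˢ Set.Icc (0 : ℝ) 1) :=
  hO.uniqueDiffOn.prod (uniqueDiffOn_Icc zero_lt_one)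

theorem contDiffAt_of_slab (hO : IsOpen O) (hf : ContDiffOn ℝ ∞ f (O ×ˢ Set.Icc (0 : ℝ) 1)) {y : F}
    {t : ℝ} (hy : y ∈ O) (ht : t ∈ Set.Ioo (0 : ℝ) 1) : ContDiffAt ℝ ∞ f (y, t) :=
  hf.contDiffAt (prod_mem_nhds (hO.mem_nhds hy) (Icc_mem_nhds ht.1 ht.2))

/-- A space derivative is a component of the derivative within the slab, so it is smooth up to times
0 and 1. The compactness of `chartValues` depends on this. -/
theorem contDiffOn_fderiv_slice {G : Type*} [NormedAddCommGroup G] [NormedSpace ℝ G]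
    {f : F × ℝ → G} (hO : IsOpen O) (hf : ContDiffOn ℝ ∞ f (O ×ˢ Set.Icc (0 : ℝ) 1)) :
    ContDiffOn ℝ ∞ (fun q : F × ℝ ↦ fderiv ℝ (fun y ↦ f (y, q.2)) q.1)
      (O ×ˢ Set.Icc (0 : ℝ) 1) := by
  have h1 : ContDiffOn ℝ ∞ (fun q ↦ (fderivWithin ℝ f (O ×ˢ Set.Icc (0 : ℝ) 1) q).comp
      (ContinuousLinearMap.inl ℝ F ℝ)) (O ×ˢ Set.Icc (0 : ℝ) 1) :=
    (hf.fderivWithin (uniqueDiffOn_slab hO) (by simp)).clm_comp contDiffOn_const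
  refine h1.congr fun q hq ↦ ?_
  have h2 := ((hf.differentiableOn (by simp)) q hq).hasFDerivWithinAt
  have h3 : HasFDerivWithinAt (fun y ↦ f (y, q.2)) _ O q.1 :=
    HasFDerivWithinAt.comp (f := fun y ↦ (y, q.2)) q.1 h2
      (hasFDerivAt_prodMk_left q.1 q.2).hasFDerivWithinAt fun y hy ↦ ⟨hy, hq.2⟩
  exact (h3.hasFDerivAt (hO.mem_nhds hq.1)).fderiv

theorem contDiffOn_derivWithin_slice (hO : IsOpen O)
    (hf : ContDiffOn ℝ ∞ f (O ×ˢ Set.Icc (0 : ℝ) 1)) :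
    ContDiffOn ℝ ∞ (fun q : F × ℝ ↦ derivWithin (fun t ↦ f (q.1, t)) (Set.Icc 0 1) q.2)
      (O ×ˢ Set.Icc (0 : ℝ) 1) := by
  have h1 : ContDiffOn ℝ ∞ (fun q ↦ fderivWithin ℝ f (O ×ˢ Set.Icc (0 : ℝ) 1) q (0, 1))
      (O ×ˢ Set.Icc (0 : ℝ) 1) :=
    (hf.fderivWithin (uniqueDiffOn_slab hO) (by simp)).clm_apply contDiffOn_const
  refine h1.congr fun q hq ↦ ?_
  have h2 := ((hf.differentiableOn (by simp)) q hq).hasFDerivWithinAt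
  have h3 : HasFDerivWithinAt (fun t ↦ f (q.1, t)) _ (Set.Icc 0 1) q.2 :=
    HasFDerivWithinAt.comp (f := fun t ↦ (q.1, t)) q.2 h2
      (hasFDerivAt_prodMk_right q.1 q.2).hasFDerivWithinAt fun t ht ↦ ⟨hq.1, ht⟩
  rw [(h3.hasDerivWithinAt).derivWithin (uniqueDiffOn_Icc zero_lt_one _ hq.2)]
  rfl

theorem derivWithin_slice_eq_dir (hO : IsOpen O)
    (hf : ContDiffOn ℝ ∞ f (O ×ˢ Set.Icc (0 : ℝ) 1)) {y : F} {t : ℝ} (hy : y ∈ O)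
    (ht : t ∈ Set.Ioo (0 : ℝ) 1) :
    derivWithin (fun s ↦ f (y, s)) (Set.Icc 0 1) t = dir (0, 1) f (y, t) := by
  have h1 := ((contDiffAt_of_slab hO hf hy ht).differentiableAt (by simp)).hasFDerivAt
  have h2 : HasFDerivAt (fun s ↦ f (y, s)) _ t := h1.comp t (hasFDerivAt_prodMk_right y t)
  rw [derivWithin_of_mem_nhds (Icc_mem_nhds ht.1 ht.2), h2.hasDerivAt.deriv]
  rfl

/-- At interior times the one-sided definition of the time derivative is irrelevant. Agreement near
the point permits further differentiation. -/
theorem derivWithin_slice_eventuallyEq (hO : IsOpen O)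
    (hf : ContDiffOn ℝ ∞ f (O ×ˢ Set.Icc (0 : ℝ) 1)) {y : F} {t : ℝ} (hy : y ∈ O)
    (ht : t ∈ Set.Ioo (0 : ℝ) 1) :
    (fun q : F × ℝ ↦ derivWithin (fun s ↦ f (q.1, s)) (Set.Icc 0 1) q.2)
      =ᶠ[𝓝 (y, t)] dir (0, 1) f := by
  filter_upwards [prod_mem_nhds (hO.mem_nhds hy) (Ioo_mem_nhds ht.1 ht.2)] with q hq
  exact derivWithin_slice_eq_dir hO hf hq.1 hq.2

theorem derivWithin_derivWithin_slice_eq_dir (hO : IsOpen O)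
    (hf : ContDiffOn ℝ ∞ f (O ×ˢ Set.Icc (0 : ℝ) 1)) {y : F} {t : ℝ} (hy : y ∈ O)
    (ht : t ∈ Set.Ioo (0 : ℝ) 1) :
    derivWithin (fun s ↦ derivWithin (fun s ↦ f (y, s)) (Set.Icc 0 1) s) (Set.Icc 0 1) t
      = dir (0, 1) (dir (0, 1) f) (y, t) :=
  (derivWithin_slice_eq_dir hO (contDiffOn_derivWithin_slice hO hf) hy ht).trans
    (dir_congr _ (derivWithin_slice_eventuallyEq hO hf hy ht)).self_of_nhds

theorem dir_slice {y : F} {t : ℝ} (hf : ContDiffAt ℝ ∞ f (y, t)) (w : F) :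
    dir w (fun y ↦ f (y, t)) =ᶠ[𝓝 y] fun y ↦ dir (w, 0) f (y, t) := by
  have hc : Tendsto (fun y : F ↦ (y, t)) (𝓝 y) (𝓝 (y, t)) :=
    (Continuous.prodMk_left t).continuousAt
  filter_upwards [hc.eventually (eventually_differentiableAt_of_contDiffAt hf)] with z hz
  have := HasFDerivAt.comp (f := fun y ↦ (y, t)) z hz.hasFDerivAt (hasFDerivAt_prodMk_left z t)
  exact congrArg (fun L : F →L[ℝ] ℝ ↦ L w) this.fderiv

theorem dir₁_slice {y : F} {t : ℝ} (hf : ContDiffAt ℝ ∞ f (y, t)) (w : F) :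
    dir w (fun y ↦ f (y, t)) y = dir (w, 0) f (y, t) :=
  (dir_slice hf w).self_of_nhds

theorem dir₂_slice {y : F} {t : ℝ} (hf : ContDiffAt ℝ ∞ f (y, t)) (w w' : F) :
    dir w (dir w' fun y ↦ f (y, t)) y = dir (w, 0) (dir (w', 0) f) (y, t) :=
  (dir_congr w (dir_slice hf w')).self_of_nhds.trans (dir₁_slice (contDiffAt_dir (w', 0) hf) w)

end SlabCalculus

/-! ### Slab functions read in a chart. -/

section SlabCharts

variable {n : ℕ} {M : Type*} [TopologicalSpace M] [ChartedSpace (EuclideanSpace ℝ (Fin n)) M]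
  [IsManifold (𝓡 n) ∞ M]

theorem SmoothOnSlab.contDiffOn {u : M → ℝ → ℝ} (hu : SmoothOnSlab (𝓡 n) u) (p : M) :
    ContDiffOn ℝ ∞ (fun q : EuclideanSpace ℝ (Fin n) × ℝ ↦ u ((extChartAt (𝓡 n) p).symm q.1) q.2)
      ((extChartAt (𝓡 n) p).target ×ˢ Set.Icc (0 : ℝ) 1) := by
  rw [← contMDiffOn_iff_contDiffOn]
  refine ContMDiffOn.comp (g := fun p : M × ℝ ↦ u p.1 p.2)
    (f := fun q : EuclideanSpace ℝ (Fin n) × ℝ ↦ ((extChartAt (𝓡 n) p).symm q.1, q.2)) hu ?_ ?_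
  · refine ContMDiffOn.prodMk ?_ contDiff_snd.contMDiff.contMDiffOn
    exact (contMDiffOn_extChartAt_symm p).comp contDiff_fst.contMDiff.contMDiffOn
      fun q hq ↦ hq.1
  · exact fun q hq ↦ ⟨Set.mem_univ _, hq.2⟩

theorem SmoothOnSlab.contMDiff {u : M → ℝ → ℝ} (hu : SmoothOnSlab (𝓡 n) u) {t : ℝ}
    (ht : t ∈ Set.Icc (0 : ℝ) 1) : ContMDiff (𝓡 n) 𝓘(ℝ, ℝ) ∞ (fun x ↦ u x t) :=
  ContMDiffOn.comp_contMDiff (g := fun p : M × ℝ ↦ u p.1 p.2) (f := fun x ↦ (x, t)) hu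
    (contMDiff_id.prodMk contMDiff_const) fun _ ↦ ⟨Set.mem_univ _, ht⟩

theorem SmoothOnSlab.sqrt {f : M → ℝ → ℝ} (hf : SmoothOnSlab (𝓡 n) f)
    (hpos : ∀ x, ∀ t ∈ Set.Icc (0 : ℝ) 1, 0 < f x t) :
    SmoothOnSlab (𝓡 n) (fun x t ↦ √(f x t)) := fun q hq ↦
  ContMDiffAt.comp_contMDiffWithinAt (g := Real.sqrt) q
    (Real.contDiffAt_sqrt (hpos q.1 q.2 hq.2).ne').contMDiffAt (hf q hq)

theorem contMDiffAt_of_chartRep {p : M} {φ : M → ℝ} {x : M} (hx : x ∈ (extChartAt (𝓡 n) p).source)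
    (hφ : ContDiffAt ℝ ∞ (chartRep p φ) (extChartAt (𝓡 n) p x)) :
    ContMDiffAt (𝓡 n) 𝓘(ℝ, ℝ) ∞ φ x := by
  have h1 : ContMDiffAt (𝓡 n) 𝓘(ℝ, ℝ) ∞ (fun z ↦ chartRep p φ (extChartAt (𝓡 n) p z)) x :=
    hφ.contMDiffAt.comp x (contMDiffAt_extChartAt' (by simpa using hx))
  refine h1.congr_of_eventuallyEq ?_
  filter_upwards [extChartAt_source_mem_nhds' (I := 𝓡 n) hx] with z hz
  exact congrArg φ ((extChartAt (𝓡 n) p).left_inv hz).symm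

variable [RiemannianBundle (fun x : M ↦ TangentSpace (𝓡 n) x)]
  [IsContMDiffRiemannianBundle (𝓡 n) ∞ (EuclideanSpace ℝ (Fin n))
    (fun x : M ↦ TangentSpace (𝓡 n) x)]

theorem SmoothOnSlab.contDiffAt_chartRep_timeDeriv {u : M → ℝ → ℝ} (hu : SmoothOnSlab (𝓡 n) u)
    (p : M) {y : EuclideanSpace ℝ (Fin n)} (hy : y ∈ (extChartAt (𝓡 n) p).target) {t : ℝ}
    (ht : t ∈ Set.Ioo (0 : ℝ) 1) :
    ContDiffAt ℝ ∞ (chartRep p fun x ↦ timeDeriv u x t) y :=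
  ContDiffAt.comp (g := fun q : EuclideanSpace ℝ (Fin n) × ℝ ↦
    timeDeriv u ((extChartAt (𝓡 n) p).symm q.1) q.2) (f := fun y ↦ (y, t)) y
    (contDiffAt_of_slab (isOpen_extChartAt_target_model p)
      (contDiffOn_derivWithin_slice (isOpen_extChartAt_target_model p) (hu.contDiffOn p)) hy ht)
    (contDiffAt_id.prodMk contDiffAt_const)

end SlabCharts

/-! ### The solution and its equation in normal coordinates. -/

section InteriorMaximum

variable {n : ℕ} {M : Type*} [TopologicalSpace M] [ChartedSpace (EuclideanSpace ℝ (Fin n)) M]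
  [IsManifold (𝓡 n) ∞ M] [RiemannianBundle (fun x : M ↦ TangentSpace (𝓡 n) x)]
  [IsContMDiffRiemannianBundle (𝓡 n) ∞ (EuclideanSpace ℝ (Fin n))
    (fun x : M ↦ TangentSpace (𝓡 n) x)]

/-- A solution of the equation with the bounds which enter the Hessian estimate. -/
structure ControlledSolution (a : M → ℝ) (b K₁ K₃ K₅ K₆ : ℝ) (f u : M → ℝ → ℝ) : Prop where
  smooth_rhs : SmoothOnSlab (𝓡 n) f
  rhs_pos : ∀ x, ∀ t ∈ Set.Icc (0 : ℝ) 1, 0 < f x t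
  smooth : SmoothOnSlab (𝓡 n) u
  solves : SolvesChenHe (𝓡 n) a b f u
  mem : ∀ t ∈ Set.Icc (0 : ℝ) 1, (fun x ↦ u x t) ∈ spaceH (𝓡 n) a b
  grad_le : ∀ x, ∀ t ∈ Set.Icc (0 : ℝ) 1, ‖grad (𝓡 n) (fun y ↦ u y t) x‖ ≤ K₁
  laplacian_le : ∀ x, ∀ t ∈ Set.Icc (0 : ℝ) 1, |laplacian (𝓡 n) (fun y ↦ u y t) x| ≤ K₃
  grad_sqrt_le : ∀ x, ∀ t ∈ Set.Icc (0 : ℝ) 1, ‖grad (𝓡 n) (fun y ↦ √(f y t)) x‖ ≤ K₅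
  hess_sqrt_le : ∀ x, ∀ t ∈ Set.Icc (0 : ℝ) 1, hessNorm (𝓡 n) (fun y ↦ √(f y t)) x ≤ K₆

/-- The function `∇²u(ξ, ξ) + |∇u|² / 2 + D t²` to which the maximum principle is applied. -/
def testFun (D : ℝ) (u : M → ℝ → ℝ) (x : M) (t : ℝ) (ξ : TangentSpace (𝓡 n) x) : ℝ :=
  hess (𝓡 n) (fun y ↦ u y t) x ξ ξ + (1 / 2 * ‖grad (𝓡 n) (fun y ↦ u y t) x‖ ^ 2 + D * t ^ 2)

/-- A slab function in normal coordinates. -/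
def normalRep (p : M) (θ : NormalParam n) (u : M → ℝ → ℝ) (q : EuclideanSpace ℝ (Fin n) × ℝ) : ℝ :=
  u (normalPoint p θ q.1) q.2

/-- The points where normal coordinates are defined. -/
def normalDomain (p : M) (θ : NormalParam n) : Set (EuclideanSpace ℝ (Fin n)) :=
  normalMap (chartMetric p) θ.1 ⁻¹' (extChartAt (𝓡 n) p).target

variable {p : M} {θ : NormalParam n}

theorem isOpen_normalDomain (hθ : θ.1.1 ∈ (extChartAt (𝓡 n) p).target) :
    IsOpen (normalDomain p θ) :=
  (isOpen_extChartAt_target_model p).preimage (contDiff_normalMap_chart hθ).continuous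

theorem zero_mem_normalDomain (hθ : θ.1.1 ∈ (extChartAt (𝓡 n) p).target) :
    0 ∈ normalDomain p θ := by
  simpa [normalDomain] using hθ

theorem contDiffOn_normalRep {u : M → ℝ → ℝ} (hu : SmoothOnSlab (𝓡 n) u)
    (hθ : θ.1.1 ∈ (extChartAt (𝓡 n) p).target) :
    ContDiffOn ℝ ∞ (normalRep p θ u) (normalDomain p θ ×ˢ Set.Icc (0 : ℝ) 1) :=
  (hu.contDiffOn p).comp (((contDiff_normalMap_chart hθ).comp contDiff_fst).prodMk
    contDiff_snd).contDiffOn fun _ hq ↦ ⟨hq.1, hq.2⟩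

theorem eventually_isInvertible_normalDeriv (hθ : θ.1.1 ∈ (extChartAt (𝓡 n) p).target)
    (hinv : θ.1.2.IsInvertible) :
    ∀ᶠ y in 𝓝 0, (normalDeriv (chartMetric p) θ.1 y).IsInvertible := by
  obtain ⟨L, hL⟩ := hinv
  have h1 : ContinuousAt (fun y ↦ normalDeriv (chartMetric p) θ.1 y) 0 :=
    (contDiffAt_normalDeriv (isOpen_extChartAt_target_model p) (contDiffOn_chartMetric p)
      (fun _ ↦ isInvertible_chartMetric p) (s := fun _ ↦ θ.1) (z := id) contDiffAt_const
      contDiffAt_id hθ).continuousAt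
  have h2 : Set.range ((↑) : (EuclideanSpace ℝ (Fin n) ≃L[ℝ] EuclideanSpace ℝ (Fin n)) →
      EuclideanSpace ℝ (Fin n) →L[ℝ] EuclideanSpace ℝ (Fin n)) ∈
      𝓝 (normalDeriv (chartMetric p) θ.1 0) := by
    rw [normalDeriv_zero, ← hL]
    exact ContinuousLinearEquiv.nhds L
  exact h1.eventually h2

section PointwiseFormulas

variable {u f : M → ℝ → ℝ} {y : EuclideanSpace ℝ (Fin n)} {t : ℝ}

theorem timeDeriv_timeDeriv_normal (hu : SmoothOnSlab (𝓡 n) u)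
    (hθ : θ.1.1 ∈ (extChartAt (𝓡 n) p).target) (hy : y ∈ normalDomain p θ)
    (ht : t ∈ Set.Ioo (0 : ℝ) 1) :
    timeDeriv (timeDeriv u) (normalPoint p θ y) t
      = dir (0, 1) (dir (0, 1) (normalRep p θ u)) (y, t) :=
  derivWithin_derivWithin_slice_eq_dir (isOpen_normalDomain hθ) (contDiffOn_normalRep hu hθ) hy ht

theorem dir_timeDeriv_normal (hu : SmoothOnSlab (𝓡 n) u)
    (hθ : θ.1.1 ∈ (extChartAt (𝓡 n) p).target) (hy : y ∈ normalDomain p θ)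
    (ht : t ∈ Set.Ioo (0 : ℝ) 1) (w : EuclideanSpace ℝ (Fin n)) :
    dir w (fun y ↦ timeDeriv u (normalPoint p θ y) t) y
      = dir (w, 0) (dir (0, 1) (normalRep p θ u)) (y, t) := by
  have hO := isOpen_normalDomain hθ
  have hV := contDiffOn_normalRep hu hθ
  have h1 := dir₁_slice (contDiffAt_of_slab hO (contDiffOn_derivWithin_slice hO hV) hy ht) w
  exact h1.trans (dir_congr _ (derivWithin_slice_eventuallyEq hO hV hy ht)).self_of_nhds

theorem inner_grad_slice_normal (hu : SmoothOnSlab (𝓡 n) u) (hf : SmoothOnSlab (𝓡 n) f)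
    (hθ : θ.1.1 ∈ (extChartAt (𝓡 n) p).target) (hy : y ∈ normalDomain p θ)
    (hinv : (normalDeriv (chartMetric p) θ.1 y).IsInvertible) (ht : t ∈ Set.Ioo (0 : ℝ) 1) :
    inner ℝ (grad (𝓡 n) (fun x ↦ f x t) (normalPoint p θ y))
      (grad (𝓡 n) (fun x ↦ u x t) (normalPoint p θ y))
      = ∑ i, ∑ j, normalA (chartMetric p) i j (θ, y)
        * (dir (EuclideanSpace.single i 1, 0) (normalRep p θ u) (y, t)
          * dir (EuclideanSpace.single j 1, 0) (normalRep p θ f) (y, t)) := by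
  have hO := isOpen_normalDomain hθ
  have hd {φ : M → ℝ} (hφ : ContMDiff (𝓡 n) 𝓘(ℝ, ℝ) ∞ φ) :
      DifferentiableAt ℝ (chartRep p φ) (normalMap (chartMetric p) θ.1 y) :=
    ((contDiffOn_chartRep p hφ).contDiffAt
      ((isOpen_extChartAt_target_model p).mem_nhds hy)).differentiableAt (by simp)
  have hut := hu.contMDiff (Set.Ioo_subset_Icc_self ht)
  have hft := hf.contMDiff (Set.Ioo_subset_Icc_self ht)
  rw [inner_grad_normal hθ hy hinv (hd hut) (hut.mdifferentiable (by simp) _) (hd hft)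
    (hft.mdifferentiable (by simp) _)]
  refine Finset.sum_congr rfl fun i _ ↦ Finset.sum_congr rfl fun j _ ↦ ?_
  congr 2
  · exact dir₁_slice (contDiffAt_of_slab hO (contDiffOn_normalRep hu hθ) hy ht) _
  · exact dir₁_slice (contDiffAt_of_slab hO (contDiffOn_normalRep hf hθ) hy ht) _

theorem norm_grad_slice_normal (hu : SmoothOnSlab (𝓡 n) u)
    (hθ : θ.1.1 ∈ (extChartAt (𝓡 n) p).target) (hy : y ∈ normalDomain p θ)
    (hinv : (normalDeriv (chartMetric p) θ.1 y).IsInvertible) (ht : t ∈ Set.Ioo (0 : ℝ) 1) :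
    ‖grad (𝓡 n) (fun x ↦ u x t) (normalPoint p θ y)‖ ^ 2
      = ∑ i, ∑ j, normalA (chartMetric p) i j (θ, y)
        * (dir (EuclideanSpace.single i 1, 0) (normalRep p θ u) (y, t)
          * dir (EuclideanSpace.single j 1, 0) (normalRep p θ u) (y, t)) := by
  rw [← real_inner_self_eq_norm_sq]
  exact inner_grad_slice_normal hu hu hθ hy hinv ht

theorem norm_grad_timeDeriv_normal (hu : SmoothOnSlab (𝓡 n) u)
    (hθ : θ.1.1 ∈ (extChartAt (𝓡 n) p).target) (hy : y ∈ normalDomain p θ)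
    (hinv : (normalDeriv (chartMetric p) θ.1 y).IsInvertible) (ht : t ∈ Set.Ioo (0 : ℝ) 1) :
    ‖grad (𝓡 n) (fun x ↦ timeDeriv u x t) (normalPoint p θ y)‖ ^ 2
      = ∑ i, ∑ j, normalA (chartMetric p) i j (θ, y)
        * (dir (EuclideanSpace.single i 1, 0) (dir (0, 1) (normalRep p θ u)) (y, t)
          * dir (EuclideanSpace.single j 1, 0) (dir (0, 1) (normalRep p θ u)) (y, t)) := by
  have hc := hu.contDiffAt_chartRep_timeDeriv p hy ht
  have hd := hc.differentiableAt (by simp)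
  have hm : MDifferentiableAt (𝓡 n) 𝓘(ℝ, ℝ) (fun x ↦ timeDeriv u x t) (normalPoint p θ y) := by
    refine (contMDiffAt_of_chartRep ((extChartAt (𝓡 n) p).map_target hy) ?_).mdifferentiableAt
      (by simp)
    rwa [(extChartAt (𝓡 n) p).right_inv hy]
  rw [← real_inner_self_eq_norm_sq, inner_grad_normal hθ hy hinv hd hm hd hm]
  refine Finset.sum_congr rfl fun i _ ↦ Finset.sum_congr rfl fun j _ ↦ ?_
  rw [dir_timeDeriv_normal hu hθ hy ht, dir_timeDeriv_normal hu hθ hy ht]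

theorem laplacian_slice_normal (hu : SmoothOnSlab (𝓡 n) u)
    (hθ : θ.1.1 ∈ (extChartAt (𝓡 n) p).target) (hy : y ∈ normalDomain p θ)
    (hinv : (normalDeriv (chartMetric p) θ.1 y).IsInvertible) (ht : t ∈ Set.Ioo (0 : ℝ) 1) :
    laplacian (𝓡 n) (fun x ↦ u x t) (normalPoint p θ y)
      = ∑ i, ∑ j, normalA (chartMetric p) i j (θ, y) * dir (EuclideanSpace.single i 1, 0)
          (dir (EuclideanSpace.single j 1, 0) (normalRep p θ u)) (y, t)
        + ∑ k, normalB (chartMetric p) k (θ, y) *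
          dir (EuclideanSpace.single k 1, 0) (normalRep p θ u) (y, t) := by
  have hV := contDiffAt_of_slab (isOpen_normalDomain hθ) (contDiffOn_normalRep hu hθ) hy ht
  rw [laplacian_normal hθ hy hinv (hu.contMDiff (Set.Ioo_subset_Icc_self ht))]
  congr 1
  · exact Finset.sum_congr rfl fun i _ ↦ Finset.sum_congr rfl fun j _ ↦
      congrArg _ (dir₂_slice hV _ _)
  · exact Finset.sum_congr rfl fun i _ ↦ congrArg _ (dir₁_slice hV _)

theorem hess_slice_normal (hu : SmoothOnSlab (𝓡 n) u)
    (hθ : θ.1.1 ∈ (extChartAt (𝓡 n) p).target) (hy : y ∈ normalDomain p θ)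
    (hinv : (normalDeriv (chartMetric p) θ.1 y).IsInvertible) (ht : t ∈ Set.Ioo (0 : ℝ) 1) :
    hess (𝓡 n) (fun x ↦ u x t) (normalPoint p θ y) (normalField p θ y θ.2) (normalField p θ y θ.2)
      = dir (θ.2, 0) (dir (θ.2, 0) (normalRep p θ u)) (y, t)
        - ∑ k, normalΓ (chartMetric p) k (θ, y) *
          dir (EuclideanSpace.single k 1, 0) (normalRep p θ u) (y, t) := by
  have hV := contDiffAt_of_slab (isOpen_normalDomain hθ) (contDiffOn_normalRep hu hθ) hy ht
  rw [hess_normal hθ hy hinv (hu.contMDiff (Set.Ioo_subset_Icc_self ht))]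
  congr 1
  · exact dir₂_slice hV _ _
  · exact Finset.sum_congr rfl fun i _ ↦ congrArg _ (dir₁_slice hV _)

end PointwiseFormulas

end InteriorMaximum

/-! ### The Hessian bound at an interior maximum of the test function. -/

section InteriorMaximum

variable {n : ℕ} {M : Type*} [TopologicalSpace M] [ChartedSpace (EuclideanSpace ℝ (Fin n)) M]
  [IsManifold (𝓡 n) ∞ M] [RiemannianBundle (fun x : M ↦ TangentSpace (𝓡 n) x)]
  [IsContMDiffRiemannianBundle (𝓡 n) ∞ (EuclideanSpace ℝ (Fin n))
    (fun x : M ↦ TangentSpace (𝓡 n) x)]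
  {p : M} {θ : NormalParam n} {K : Set (EuclideanSpace ℝ (Fin n))}

theorem norm_normalField_sq (y w : EuclideanSpace ℝ (Fin n)) :
    ‖normalField p θ y w‖ ^ 2 = normalMetric (chartMetric p) θ.1 y w w := by
  rw [← real_inner_self_eq_norm_sq, inner_normalField]

theorem norm_normalField_center (hθ : θ ∈ normalFrames (chartMetric p) K) :
    ‖normalField p θ 0 θ.2‖ = 1 := by
  have h : ‖normalField p θ 0 θ.2‖ ^ 2 = 1 := by
    rw [norm_normalField_sq, normalMetric_zero, hθ.2.1, real_inner_self_eq_norm_sq, hθ.2.2, one_pow]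
  exact (pow_eq_one_iff_of_nonneg (norm_nonneg _) two_ne_zero).1 h

/-- A bound on `∇²u(ξ, ξ) + r` over unit vectors, in homogeneous form. -/
theorem testFun_homogeneous {D : ℝ} {u : M → ℝ → ℝ} {x : M} {t B : ℝ}
    (h : ∀ ξ : TangentSpace (𝓡 n) x, ‖ξ‖ = 1 → testFun D u x t ξ ≤ B)
    (ξ : TangentSpace (𝓡 n) x) :
    hess (𝓡 n) (fun y ↦ u y t) x ξ ξ
      + (1 / 2 * ‖grad (𝓡 n) (fun y ↦ u y t) x‖ ^ 2 + D * t ^ 2 - B) * ‖ξ‖ ^ 2 ≤ 0 := by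
  rcases eq_or_ne ξ 0 with rfl | hξ
  · simp [hess]
  have hn : ‖ξ‖ ≠ 0 := norm_ne_zero_iff.2 hξ
  have h1 := h (‖ξ‖⁻¹ • ξ) (by rw [norm_smul, norm_inv, norm_norm, inv_mul_cancel₀ hn])
  rw [testFun, hess_smul_left, hess_smul_right] at h1
  have h2 := mul_le_mul_of_nonneg_right h1 (sq_nonneg ‖ξ‖)
  have h3 : ‖ξ‖⁻¹ * (‖ξ‖⁻¹ * hess (𝓡 n) (fun y ↦ u y t) x ξ ξ) * ‖ξ‖ ^ 2
      = hess (𝓡 n) (fun y ↦ u y t) x ξ ξ := by field_simp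
  nlinarith

variable {a : M → ℝ} {b K₁ K₃ K₅ K₆ : ℝ} {f u : M → ℝ → ℝ}

/-- The second time derivative of a solution is positive. -/
theorem ControlledSolution.timeDeriv_pos (h : ControlledSolution (n := n) a b K₁ K₃ K₅ K₆ f u) (x : M)
    {t : ℝ} (ht : t ∈ Set.Icc (0 : ℝ) 1) : 0 < timeDeriv (timeDeriv u) x t := by
  have h1 := h.solves x t ht
  have h2 := (h.mem t ht).2 x
  have h3 := h.rhs_pos x t ht
  -- By the equation the product of u_tt and the positive factor is f + |∇u_t|² > 0.
  refine (pos_iff_pos_of_mul_pos ?_).2 h2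
  nlinarith [sq_nonneg ‖grad (𝓡 n) (fun y ↦ timeDeriv u y t) x‖]

set_option maxHeartbeats 1000000 in
/-- The Hessian bound at an interior maximum of the test function, uniformly for centres in a
compact subset of a chart. -/
theorem exists_hess_le_of_interior_max (ha : ContMDiff (𝓡 n) 𝓘(ℝ, ℝ) ∞ a) (hb : 0 ≤ b)
    {a₀ : ℝ} (ha₀ : ∀ x, a x ≤ a₀) (K₁ K₃ K₅ K₆ : ℝ) (p : M) (hK : IsCompact K)
    (hKp : K ⊆ (extChartAt (𝓡 n) p).target) :
    ∃ C : ℝ, ∀ f u : M → ℝ → ℝ, ControlledSolution (n := n) a b K₁ K₃ K₅ K₆ f u →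
      ∀ θ ∈ normalFrames (chartMetric p) K, ∀ t ∈ Set.Ioo (0 : ℝ) 1,
      (∀ x, ∀ s ∈ Set.Icc (0 : ℝ) 1, ∀ ξ : TangentSpace (𝓡 n) x, ‖ξ‖ = 1 →
        testFun ((K₆ + K₁ * K₅) ^ 2 + 1) u x s ξ
          ≤ testFun ((K₆ + K₁ * K₅) ^ 2 + 1) u (normalPoint p θ 0) t (normalField p θ 0 θ.2)) →
      hess (𝓡 n) (fun x ↦ u x t) (normalPoint p θ 0) (normalField p θ 0 θ.2)
        (normalField p θ 0 θ.2) ≤ C := by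
  obtain ⟨Λ, hΛ, hΛK⟩ := exists_flatCoefficients (isOpen_extChartAt_target_model p)
    (contDiffOn_chartMetric p) (chartMetric_symm p) (fun y hy v hv ↦ chartMetric_pos p hy hv)
    (contDiffOn_chartRep p ha) hK hKp
  -- The argument K₃ + a₀ bounds Δu - b|∇u|² + a from above. The factor n² passes from the norm of
  -- the Hessian to its value on `θ.2`, whose components are at most one in absolute value.
  refine ⟨n * (n * hessConst n Λ K₁ b (K₃ + a₀)), fun f u hfu θ hθK t ht hmax ↦ ?_⟩
  set D := (K₆ + K₁ * K₅) ^ 2 + 1 with hD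
  obtain ⟨hc, ha1, haξ⟩ := hΛK θ hθK t
  have hθ : θ.1.1 ∈ (extChartAt (𝓡 n) p).target := hKp hθK.1
  have hinv0 : θ.1.2.IsInvertible := isInvertible_frame hθK.2.1
  have hinv : (normalDeriv (chartMetric p) θ.1 0).IsInvertible := by
    rwa [normalDeriv_zero]
  have hO := isOpen_normalDomain hθ
  have h0 := zero_mem_normalDomain hθ
  have htI := Set.Ioo_subset_Icc_self ht
  have hu := hfu.smooth
  have hsf := hfu.smooth_rhs.sqrt hfu.rhs_pos
  have hv := contDiffAt_of_slab hO (contDiffOn_normalRep hu hθ) h0 ht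
  have hh := contDiffAt_of_slab hO (contDiffOn_normalRep hsf hθ) h0 ht
  set x₀ := normalPoint p θ 0 with hx₀
  set ξ₀ := normalField p θ 0 θ.2 with hξ₀
  have hξn : ‖ξ₀‖ = 1 := norm_normalField_center hθK
  have hK1 : 0 ≤ K₁ := (norm_nonneg _).trans (hfu.grad_le x₀ t htI)
  have hc1 (i : Fin n) : |θ.2 i| ≤ 1 := by
    have := PiLp.norm_apply_le θ.2 i
    rwa [hθK.2.2, Real.norm_eq_abs] at this
  have hξ : ((θ.2, 0) : EuclideanSpace ℝ (Fin n) × ℝ)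
      = ∑ i, θ.2 i • ((EuclideanSpace.single i 1, 0) : EuclideanSpace ℝ (Fin n) × ℝ) := by
    refine Prod.ext ?_ ?_
    · rw [Prod.fst_sum]
      exact eq_sum_single θ.2
    · simp [Prod.snd_sum]
  have hA0 : ∀ i j, normalA (chartMetric p) i j (θ, 0) = if i = j then 1 else 0 := hc.A_self
  have hgrad : ‖grad (𝓡 n) (fun x ↦ u x t) x₀‖ ^ 2
      = ∑ i, dir (EuclideanSpace.single i 1, 0) (normalRep p θ u) (0, t) ^ 2 := by
    rw [norm_grad_slice_normal hu hθ h0 hinv ht]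
    simp [hA0, pow_two]
  have hlap : laplacian (𝓡 n) (fun x ↦ u x t) x₀ = ∑ i, dir (EuclideanSpace.single i 1, 0)
      (dir (EuclideanSpace.single i 1, 0) (normalRep p θ u)) (0, t) := by
    rw [laplacian_slice_normal hu hθ h0 hinv ht]
    have hB0 : ∀ k, normalB (chartMetric p) k (θ, 0) = 0 := hc.B_self
    simp [hA0, hB0]
  have hhess {w : M → ℝ → ℝ} (hw : SmoothOnSlab (𝓡 n) w) :
      hess (𝓡 n) (fun x ↦ w x t) x₀ ξ₀ ξ₀
        = dir (θ.2, 0) (dir (θ.2, 0) (normalRep p θ w)) (0, t) := by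
    rw [hess_slice_normal hw hθ h0 hinv ht]
    have hΓ0 : ∀ k, normalΓ (chartMetric p) k (θ, 0) = 0 := hc.Γ_self
    simp [hΓ0]
  have hYle : laplacian (𝓡 n) (fun x ↦ u x t) x₀
      - b * ‖grad (𝓡 n) (fun x ↦ u x t) x₀‖ ^ 2 + a x₀ ≤ K₃ + a₀ := by
    have h1 := (abs_le.1 (hfu.laplacian_le x₀ t htI)).2
    have h2 := ha₀ x₀
    have h3 : 0 ≤ b * ‖grad (𝓡 n) (fun x ↦ u x t) x₀‖ ^ 2 := by positivity
    linarith
  have hY0 : 0 ≤ K₃ + a₀ := ((hfu.mem t htI).2 x₀).le.trans hYle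
  have hq (i : Fin n) : |dir (EuclideanSpace.single i 1, 0) (normalRep p θ u) (0, t)| ≤ K₁ := by
    refine abs_le_of_sq_le_sq ?_ hK1
    calc dir (EuclideanSpace.single i 1, 0) (normalRep p θ u) (0, t) ^ 2
        ≤ ‖grad (𝓡 n) (fun x ↦ u x t) x₀‖ ^ 2 := by
          rw [hgrad]
          exact Finset.single_le_sum
            (f := fun i ↦ dir (EuclideanSpace.single i 1, 0) (normalRep p θ u) (0, t) ^ 2)
            (fun i _ ↦ sq_nonneg _) (Finset.mem_univ i)
      _ ≤ K₁ ^ 2 := by gcongr; exact hfu.grad_le x₀ t htI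
  -- At the centre the frame is orthonormal and the Christoffel terms vanish, so this is ∇²√f(ξ,ξ) +
  -- ⟨∇u, ∇√f⟩. Its bound is the κ used in the choice of `D`.
  have hκ : |dir (θ.2, 0) (dir (θ.2, 0) (normalRep p θ fun x t ↦ √(f x t))) (0, t)
      + ∑ i, dir (EuclideanSpace.single i 1, 0) (normalRep p θ u) (0, t)
        * dir (EuclideanSpace.single i 1, 0) (normalRep p θ fun x t ↦ √(f x t)) (0, t)|
      ≤ K₆ + K₁ * K₅ := by
    have e1 : ∑ i, dir (EuclideanSpace.single i 1, 0) (normalRep p θ u) (0, t)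
        * dir (EuclideanSpace.single i 1, 0) (normalRep p θ fun x t ↦ √(f x t)) (0, t)
        = inner ℝ (grad (𝓡 n) (fun x ↦ √(f x t)) x₀) (grad (𝓡 n) (fun x ↦ u x t) x₀) := by
      rw [inner_grad_slice_normal hu hsf hθ h0 hinv ht]
      simp [hA0]
    rw [e1, ← hhess hsf]
    refine (abs_add_le _ _).trans (add_le_add ?_ ?_)
    · exact (abs_hess_le_hessNorm _ _ hξn).trans (hfu.hess_sqrt_le x₀ t htI)
    · refine (abs_real_inner_le_norm _ _).trans ?_
      rw [mul_comm]
      exact mul_le_mul (hfu.grad_le x₀ t htI) (hfu.grad_sqrt_le x₀ t htI) (norm_nonneg _) hK1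
  have hfpos : 0 < normalRep p θ (fun x t ↦ √(f x t)) (0, t) :=
    Real.sqrt_pos.2 (hfu.rhs_pos x₀ t htI)
  have hnhds : ∀ᶠ q : EuclideanSpace ℝ (Fin n) × ℝ in 𝓝 (0, t), q.1 ∈ normalDomain p θ ∧
      (normalDeriv (chartMetric p) θ.1 q.1).IsInvertible ∧ q.2 ∈ Set.Ioo (0 : ℝ) 1 := by
    filter_upwards [continuousAt_fst.eventually (hO.mem_nhds h0),
      continuousAt_fst.eventually (eventually_isInvertible_normalDeriv hθ hinv0),
      continuousAt_snd.eventually (Ioo_mem_nhds ht.1 ht.2)] with q h1 h2 h3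
    exact ⟨h1, h2, h3⟩
  have hsnd (q : EuclideanSpace ℝ (Fin n) × ℝ) :
      HasFDerivAt (Prod.snd : EuclideanSpace ℝ (Fin n) × ℝ → ℝ)
        (ContinuousLinearMap.snd ℝ (EuclideanSpace ℝ (Fin n)) ℝ) q := hasFDerivAt_snd
  have hPsnd (w : EuclideanSpace ℝ (Fin n) × ℝ) :
      dir w (fun q : EuclideanSpace ℝ (Fin n) × ℝ ↦ D * q.2 ^ 2) = fun q ↦ 2 * D * q.2 * w.2 := by
    funext q
    have h1 : HasFDerivAt (fun q : EuclideanSpace ℝ (Fin n) × ℝ ↦ D * q.2 ^ 2) _ q :=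
      ((hsnd q).pow 2).const_mul D
    rw [dir, h1.fderiv]
    simp
    ring
  have hPsnd₂ (w w' : EuclideanSpace ℝ (Fin n) × ℝ) :
      dir w (dir w' fun q : EuclideanSpace ℝ (Fin n) × ℝ ↦ D * q.2 ^ 2) (0, t)
        = 2 * D * w.2 * w'.2 := by
    rw [hPsnd]
    have h1 : HasFDerivAt (fun q : EuclideanSpace ℝ (Fin n) × ℝ ↦ 2 * D * q.2 * w'.2) _ (0, t) :=
      ((hsnd (0, t)).const_mul (2 * D)).mul_const w'.2
    rw [dir, h1.fderiv]
    simp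
    ring
  have key := hessian_bound_of_isLocalMax (K := K₁) (b := b) (Y := K₃ + a₀) (κ := K₆ + K₁ * K₅)
    (D := D) (M := testFun D u x₀ t ξ₀) (a := fun q ↦ chartRep p a (normalMap (chartMetric p) θ.1 q.1))
    (P := fun q ↦ D * q.2 ^ 2) (v := normalRep p θ u) (h := normalRep p θ fun x t ↦ √(f x t))
    hc hξ hc1 hΛ hK1 hb hY0 (by rw [hD]; nlinarith [sq_nonneg (K₆ + K₁ * K₅)])
    ?_ ha1 haξ ?_ ?_ ?_ ?_ hv hh hfpos ?_ ?_ ?_ hq hκ ?_ ?_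
  · rw [hhess hu]
    refine (le_abs_self _).trans ((abs_dir_dir_le hξ hc1 hv).2.2.trans ?_)
    gcongr
  · have h1 : ContDiffAt ℝ ∞ (chartRep p a) (normalMap (chartMetric p) θ.1 0) := by
      rw [normalMap_zero]
      exact (contDiffOn_chartRep p ha).contDiffAt
        ((isOpen_extChartAt_target_model p).mem_nhds hθ)
    exact ContDiffAt.comp (f := fun q : EuclideanSpace ℝ (Fin n) × ℝ ↦
      normalMap (chartMetric p) θ.1 q.1) (0, t) h1
      ((contDiff_normalMap_chart hθ).comp contDiff_fst).contDiffAt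
  · exact (contDiff_const.mul (contDiff_snd.pow 2)).contDiffAt
  · intro k
    rw [hPsnd]
    simp
  · rw [hPsnd₂]
    simp
  · intro k w
    rw [hPsnd₂]
    simp
  · rw [← timeDeriv_timeDeriv_normal hu hθ h0 ht]
    exact hfu.timeDeriv_pos x₀ htI
  · filter_upwards [hnhds] with q ⟨h1, h2, h3⟩
    have h4 := hfu.solves (normalPoint p θ q.1) q.2 (Set.Ioo_subset_Icc_self h3)
    rw [timeDeriv_timeDeriv_normal hu hθ h1 h3, laplacian_slice_normal hu hθ h1 h2 h3,
      norm_grad_slice_normal hu hθ h1 h2 h3, norm_grad_timeDeriv_normal hu hθ h1 h2 h3] at h4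
    refine h4.trans ?_
    exact (Real.mul_self_sqrt
      (hfu.rhs_pos (normalPoint p θ q.1) q.2 (Set.Ioo_subset_Icc_self h3)).le).symm
  · rw [← hlap, ← hgrad]
    exact hYle
  · rw [← hhess hu, ← hgrad]
    rfl
  · have hval : (dir (θ.2, 0) (dir (θ.2, 0) (normalRep p θ u)) (0, t)
        - ∑ k, normalΓ (chartMetric p) k (θ, 0)
          * dir (EuclideanSpace.single k 1, 0) (normalRep p θ u) (0, t))
        + (1 / 2 * ∑ i, ∑ j, normalA (chartMetric p) i j (θ, 0)
          * (dir (EuclideanSpace.single i 1, 0) (normalRep p θ u) (0, t)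
            * dir (EuclideanSpace.single j 1, 0) (normalRep p θ u) (0, t)) + D * t ^ 2
          - testFun D u x₀ t ξ₀) * normalG (chartMetric p) (θ, 0) = 0 := by
      rw [← hess_slice_normal hu hθ h0 hinv ht, ← norm_grad_slice_normal hu hθ h0 hinv ht,
        show normalG (chartMetric p) (θ, 0) = 1 from hc.G_self, testFun]
      ring
    filter_upwards [hnhds] with q ⟨h1, h2, h3⟩
    refine le_of_le_of_eq ?_ hval.symm
    have h4 := testFun_homogeneous
      (hmax (normalPoint p θ q.1) q.2 (Set.Ioo_subset_Icc_self h3)) (normalField p θ q.1 θ.2)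
    rw [norm_normalField_sq, hess_slice_normal hu hθ h1 h2 h3,
      norm_grad_slice_normal hu hθ h1 h2 h3] at h4
    exact h4

end InteriorMaximum

/-! ### Attainment of the maximum over a compact part of a chart, and adapted frames. -/

section Maximum

variable {n : ℕ} {M : Type*} [TopologicalSpace M] [ChartedSpace (EuclideanSpace ℝ (Fin n)) M]
  [IsManifold (𝓡 n) ∞ M] [RiemannianBundle (fun x : M ↦ TangentSpace (𝓡 n) x)]
  [IsContMDiffRiemannianBundle (𝓡 n) ∞ (EuclideanSpace ℝ (Fin n))
    (fun x : M ↦ TangentSpace (𝓡 n) x)]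
  {p : M} {K : Set (EuclideanSpace ℝ (Fin n))}

theorem norm_grad_sq_chart {φ : M → ℝ} (hφ : ContMDiff (𝓡 n) 𝓘(ℝ, ℝ) ∞ φ)
    {y : EuclideanSpace ℝ (Fin n)} (hy : y ∈ (extChartAt (𝓡 n) p).target) :
    ‖grad (𝓡 n) φ ((extChartAt (𝓡 n) p).symm y)‖ ^ 2 = fderiv ℝ (chartRep p φ) y
      ((chartMetric p y).inverse (fderiv ℝ (chartRep p φ) y)) := by
  have hx := (extChartAt (𝓡 n) p).map_target hy
  have h := grad_chart p hφ hx
  rw [(extChartAt (𝓡 n) p).right_inv hy] at h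
  rw [← real_inner_self_eq_norm_sq, h, ← chartMetric_apply,
    (isInvertible_chartMetric p hy).self_apply_inverse]

theorem contDiffOn_chartMetric_inverse (p : M) :
    ContDiffOn ℝ ∞ (fun y ↦ (chartMetric p y).inverse) (extChartAt (𝓡 n) p).target := fun y hy ↦
  ((isInvertible_chartMetric p hy).contDiffAt_map_inverse).comp_contDiffWithinAt y
    (contDiffOn_chartMetric p y hy)

theorem fderiv_fderiv_apply {F : Type*} [NormedAddCommGroup F] [NormedSpace ℝ F] {f : F → ℝ}
    {y : F} (hf : ContDiffAt ℝ ∞ f y) (v w : F) :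
    fderiv ℝ (fun z ↦ fderiv ℝ f z w) y v = fderiv ℝ (fderiv ℝ f) y v w := by
  have h1 : DifferentiableAt ℝ (fderiv ℝ f) y :=
    (hf.fderiv_right (m := ∞) (by simp)).differentiableAt (by simp)
  rw [(h1.hasFDerivAt.clm_apply (hasFDerivAt_const w y)).fderiv]
  simp

/-- The values of the test function at unit vectors over a subset of a chart. -/
def chartValues (D : ℝ) (u : M → ℝ → ℝ) (p : M) (K : Set (EuclideanSpace ℝ (Fin n))) : Set ℝ :=
  (fun z : (EuclideanSpace ℝ (Fin n) × ℝ) × EuclideanSpace ℝ (Fin n) ↦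
    testFun D u ((extChartAt (𝓡 n) p).symm z.1.1) z.1.2
      (chartField p z.2 ((extChartAt (𝓡 n) p).symm z.1.1))) ''
    {z | z.1 ∈ K ×ˢ Set.Icc (0 : ℝ) 1 ∧ chartMetric p z.1.1 z.2 z.2 = 1}

/-- In coordinates the test function is a continuous expression in the point, the time and the
vector. Coercivity of the metric makes the set of unit vectors over `K` compact. -/
theorem isCompact_chartValues (D : ℝ) {u : M → ℝ → ℝ} (hu : SmoothOnSlab (𝓡 n) u)
    (hK : IsCompact K) (hKp : K ⊆ (extChartAt (𝓡 n) p).target) :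
    IsCompact (chartValues D u p K) := by
  have hO := isOpen_extChartAt_target_model (n := n) p
  have hg := contDiffOn_chartMetric (n := n) p
  obtain ⟨c, hc, hcK⟩ := exists_coercive hK (hg.continuousOn.mono hKp)
    fun y hy v hv ↦ chartMetric_pos p (hKp hy) hv
  set T : Set ((EuclideanSpace ℝ (Fin n) × ℝ) × EuclideanSpace ℝ (Fin n)) :=
    (K ×ˢ Set.Icc (0 : ℝ) 1) ×ˢ Metric.closedBall 0 (√(c⁻¹)) with hT
  have hTc : IsCompact T := (hK.prod isCompact_Icc).prod (isCompact_closedBall 0 _)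
  have hgT : ContinuousOn (fun z : (EuclideanSpace ℝ (Fin n) × ℝ) × EuclideanSpace ℝ (Fin n) ↦
      chartMetric p z.1.1) T :=
    hg.continuousOn.comp (by fun_prop) fun z hz ↦ hKp hz.1.1
  have hset : {z : (EuclideanSpace ℝ (Fin n) × ℝ) × EuclideanSpace ℝ (Fin n) |
      z.1 ∈ K ×ˢ Set.Icc (0 : ℝ) 1 ∧ chartMetric p z.1.1 z.2 z.2 = 1}
      = T ∩ (fun z ↦ chartMetric p z.1.1 z.2 z.2) ⁻¹' {1} := by
    ext z
    refine ⟨fun ⟨h1, h2⟩ ↦ ⟨⟨h1, ?_⟩, h2⟩, fun ⟨h1, h2⟩ ↦ ⟨h1.1, h2⟩⟩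
    rw [mem_closedBall_zero_iff]
    refine Real.le_sqrt_of_sq_le ?_
    have h3 := hcK _ h1.1 z.2
    rw [h2] at h3
    rw [← one_div, le_div_iff₀ hc]
    linarith
  have hgz (w : EuclideanSpace ℝ (Fin n) × ℝ) (hw : w ∈ K ×ˢ Set.Icc (0 : ℝ) 1) :
      w ∈ (extChartAt (𝓡 n) p).target ×ˢ Set.Icc (0 : ℝ) 1 := ⟨hKp hw.1, hw.2⟩
  set f : EuclideanSpace ℝ (Fin n) × ℝ → ℝ := fun q ↦ u ((extChartAt (𝓡 n) p).symm q.1) q.2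
  have h1 := contDiffOn_fderiv_slice hO (hu.contDiffOn p)
  have h2 := contDiffOn_fderiv_slice hO h1
  set F₁ : EuclideanSpace ℝ (Fin n) × ℝ → EuclideanSpace ℝ (Fin n) →L[ℝ] ℝ :=
    fun q ↦ fderiv ℝ (fun y ↦ f (y, q.2)) q.1
  set F₂ : EuclideanSpace ℝ (Fin n) × ℝ → EuclideanSpace ℝ (Fin n) →L[ℝ]
    EuclideanSpace ℝ (Fin n) →L[ℝ] ℝ := fun q ↦ fderiv ℝ (fun y ↦ F₁ (y, q.2)) q.1
  have hmap : Set.MapsTo (fun z : (EuclideanSpace ℝ (Fin n) × ℝ) × EuclideanSpace ℝ (Fin n) ↦ z.1)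
      T ((extChartAt (𝓡 n) p).target ×ˢ Set.Icc (0 : ℝ) 1) := fun z hz ↦ hgz _ hz.1
  have hmap' : Set.MapsTo (fun z : (EuclideanSpace ℝ (Fin n) × ℝ) × EuclideanSpace ℝ (Fin n) ↦
      z.1.1) T (extChartAt (𝓡 n) p).target := fun z hz ↦ hKp hz.1.1
  have c1 : ContinuousOn (fun z : (EuclideanSpace ℝ (Fin n) × ℝ) × EuclideanSpace ℝ (Fin n) ↦
      F₁ z.1) T := h1.continuousOn.comp (by fun_prop) hmap
  have c2 : ContinuousOn (fun z : (EuclideanSpace ℝ (Fin n) × ℝ) × EuclideanSpace ℝ (Fin n) ↦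
      F₂ z.1) T := h2.continuousOn.comp (by fun_prop) hmap
  have c3 : ContinuousOn (fun z : (EuclideanSpace ℝ (Fin n) × ℝ) × EuclideanSpace ℝ (Fin n) ↦
      christoffel (chartMetric p) z.1.1) T :=
    (contDiffOn_christoffel hO hg fun _ ↦ isInvertible_chartMetric p).continuousOn.comp
      (by fun_prop) hmap'
  have c4 : ContinuousOn (fun z : (EuclideanSpace ℝ (Fin n) × ℝ) × EuclideanSpace ℝ (Fin n) ↦
      (chartMetric p z.1.1).inverse) T :=
    ContinuousOn.comp (g := fun y ↦ (chartMetric p y).inverse)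
      (contDiffOn_chartMetric_inverse p).continuousOn (by fun_prop) hmap'
  have c5 : ContinuousOn (fun z : (EuclideanSpace ℝ (Fin n) × ℝ) × EuclideanSpace ℝ (Fin n) ↦
      z.2) T := continuousOn_snd
  have hcont := ((c2.clm_apply c5).clm_apply c5).sub
    (c1.clm_apply ((c3.clm_apply c5).clm_apply c5)) |>.add
    ((continuousOn_const (c := (1 / 2 : ℝ)).mul (c1.clm_apply (c4.clm_apply c1))).add
      (continuousOn_const (c := D).mul
        (continuousOn_fst.snd.pow 2)))
  have hclosed : IsClosed (T ∩ (fun z : (EuclideanSpace ℝ (Fin n) × ℝ) ×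
      EuclideanSpace ℝ (Fin n) ↦ chartMetric p z.1.1 z.2 z.2) ⁻¹' {1}) :=
    ((hgT.clm_apply c5).clm_apply c5).preimage_isClosed_of_isClosed hTc.isClosed isClosed_singleton
  rw [chartValues, hset]
  refine (hTc.of_isClosed_subset hclosed Set.inter_subset_left).image_of_continuousOn
    ((hcont.congr fun z hz ↦ ?_).mono Set.inter_subset_left)
  have hy : z.1.1 ∈ (extChartAt (𝓡 n) p).target := hmap' hz
  have hut := hu.contMDiff hz.1.2
  have hd : ContDiffAt ℝ ∞ (chartRep p fun x ↦ u x z.1.2) z.1.1 :=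
    (contDiffOn_chartRep p hut).contDiffAt (hO.mem_nhds hy)
  rw [testFun, hess_chart p hut hy, norm_grad_sq_chart hut hy, fderiv_fderiv_apply hd]
  rfl

/-- Any orthonormal frame will do: the given unit vector need not be one of its members, since the
direction is carried as the separate parameter `θ.2`. -/
theorem exists_orthonormal_frame {y v₀ : EuclideanSpace ℝ (Fin n)}
    (hy : y ∈ (extChartAt (𝓡 n) p).target) (hv₀ : chartMetric p y v₀ v₀ = 1) (hyK : y ∈ K) :
    ∃ θ ∈ normalFrames (chartMetric p) K, θ.1.1 = y ∧ θ.1.2 θ.2 = v₀ := by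
  set x := (extChartAt (𝓡 n) p).symm y with hx
  have hfr : Module.finrank ℝ (TangentSpace (𝓡 n) x) = n :=
    finrank_euclideanSpace_fin (𝕜 := ℝ) (n := n)
  let b := (stdOrthonormalBasis ℝ (TangentSpace (𝓡 n) x)).reindex (finCongr hfr)
  let L : EuclideanSpace ℝ (Fin n) →ₗ[ℝ] TangentSpace (𝓡 n) x :=
    { toFun := fun w ↦ chartField p w x
      map_add' := fun v w ↦ chartField_add p v w x
      map_smul' := fun c v ↦ chartField_smul p c v x }
  let e := LinearEquiv.ofBijective L (chartField_bijective p ((extChartAt (𝓡 n) p).map_target hy))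
  let P : EuclideanSpace ℝ (Fin n) →L[ℝ] EuclideanSpace ℝ (Fin n) :=
    LinearMap.toContinuousLinearMap (e.symm.toLinearMap ∘ₗ b.repr.symm.toLinearEquiv.toLinearMap)
  have hLP (v : EuclideanSpace ℝ (Fin n)) : chartField p (P v) x = b.repr.symm v :=
    e.apply_symm_apply (b.repr.symm v)
  have hP (v w : EuclideanSpace ℝ (Fin n)) : chartMetric p y (P v) (P w) = inner ℝ v w := by
    rw [chartMetric_apply, ← hx, hLP, hLP, LinearIsometryEquiv.inner_map_map]
  have hinv : P.IsInvertible := isInvertible_frame (θ := ((y, P), 0)) hP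
  refine ⟨((y, P), P.inverse v₀), ⟨hyK, hP, ?_⟩, rfl, hinv.self_apply_inverse v₀⟩
  have h1 : ‖P.inverse v₀‖ ^ 2 = 1 := by
    rw [← real_inner_self_eq_norm_sq, ← hP, hinv.self_apply_inverse, hv₀]
  exact (pow_eq_one_iff_of_nonneg (norm_nonneg _) two_ne_zero).1 h1

theorem testFun_normal_zero (D : ℝ) (u : M → ℝ → ℝ) (θ : NormalParam n) (t : ℝ) :
    testFun D u (normalPoint p θ 0) t (normalField p θ 0 θ.2)
      = testFun D u ((extChartAt (𝓡 n) p).symm θ.1.1) t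
        (chartField p (θ.1.2 θ.2) ((extChartAt (𝓡 n) p).symm θ.1.1)) := by
  unfold normalField normalPoint
  rw [normalMap_zero, normalDeriv_zero]

theorem mem_chartValues (D : ℝ) (u : M → ℝ → ℝ) {x : M} (hx : x ∈ (extChartAt (𝓡 n) p).source)
    (hxK : extChartAt (𝓡 n) p x ∈ K) {t : ℝ} (ht : t ∈ Set.Icc (0 : ℝ) 1)
    {ξ : TangentSpace (𝓡 n) x} (hξ : ‖ξ‖ = 1) : testFun D u x t ξ ∈ chartValues D u p K := by
  obtain ⟨v, rfl⟩ := (chartField_bijective p hx).2 ξ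
  have hl := (extChartAt (𝓡 n) p).left_inv hx
  refine ⟨((extChartAt (𝓡 n) p x, t), v), ⟨⟨hxK, ht⟩, ?_⟩, ?_⟩
  · beta_reduce at hξ
    rw [chartMetric_apply, hl, real_inner_self_eq_norm_sq, hξ, one_pow]
  · beta_reduce
    rw [hl]

theorem exists_compact_chart_neighborhood (p : M) :
    ∃ K : Set (EuclideanSpace ℝ (Fin n)), IsCompact K ∧ K ⊆ (extChartAt (𝓡 n) p).target ∧
      {x | x ∈ (extChartAt (𝓡 n) p).source ∧ extChartAt (𝓡 n) p x ∈ K} ∈ 𝓝 p := by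
  obtain ⟨K, hK, hKt, hKc⟩ := local_compact_nhds
    ((isOpen_extChartAt_target_model (n := n) p).mem_nhds (mem_extChartAt_target p))
  refine ⟨K, hKc, hKt, ?_⟩
  filter_upwards [extChartAt_source_mem_nhds (I := 𝓡 n) p,
    (continuousAt_extChartAt (I := 𝓡 n) p).preimage_mem_nhds hK] with x h1 h2
  exact ⟨h1, h2⟩

end Maximum

/-! ### The global maximum principle on a compact manifold. -/

section MaximumPrinciple

variable {n : ℕ} {M : Type*} [TopologicalSpace M] [CompactSpace M]
  [ChartedSpace (EuclideanSpace ℝ (Fin n)) M]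
  [IsManifold (𝓡 n) ∞ M] [RiemannianBundle (fun x : M ↦ TangentSpace (𝓡 n) x)]
  [IsContMDiffRiemannianBundle (𝓡 n) ∞ (EuclideanSpace ℝ (Fin n))
    (fun x : M ↦ TangentSpace (𝓡 n) x)]

/-- A compact manifold is covered by finitely many compact subsets of charts. -/
theorem exists_finite_chart_cover :
    ∃ (s : Finset M) (K : M → Set (EuclideanSpace ℝ (Fin n))),
      (∀ p, IsCompact (K p) ∧ K p ⊆ (extChartAt (𝓡 n) p).target) ∧
      ∀ x : M, ∃ p ∈ s, x ∈ (extChartAt (𝓡 n) p).source ∧ extChartAt (𝓡 n) p x ∈ K p := by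
  choose K hK hKt hKn using exists_compact_chart_neighborhood (n := n) (M := M)
  obtain ⟨s, hs⟩ := CompactSpace.elim_nhds_subcover _ hKn
  refine ⟨s, K, fun p ↦ ⟨hK p, hKt p⟩, fun x ↦ ?_⟩
  have hx : x ∈ ⋃ p ∈ s, {x | x ∈ (extChartAt (𝓡 n) p).source ∧ extChartAt (𝓡 n) p x ∈ K p} := by
    rw [hs]
    trivial
  simp only [Set.mem_iUnion] at hx
  obtain ⟨p, hp, h⟩ := hx
  exact ⟨p, hp, h⟩

/-- Used for the boundary data. Viewing φ as constant in time and taking D = 0 makes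
`isCompact_chartValues` applicable; the gradient term only increases the test function. -/
theorem exists_hess_le {φ : M → ℝ} (hφ : ContMDiff (𝓡 n) 𝓘(ℝ, ℝ) ∞ φ) :
    ∃ B : ℝ, ∀ x, ∀ ξ : TangentSpace (𝓡 n) x, ‖ξ‖ = 1 → hess (𝓡 n) φ x ξ ξ ≤ B := by
  obtain ⟨s, K, hK, hs⟩ := exists_finite_chart_cover (n := n) (M := M)
  have hsm : SmoothOnSlab (𝓡 n) (fun x (_ : ℝ) ↦ φ x) :=
    (hφ.comp contMDiff_fst).contMDiffOn
  have hc : IsCompact (⋃ p ∈ s, chartValues 0 (fun x (_ : ℝ) ↦ φ x) p (K p)) :=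
    s.isCompact_biUnion fun p _ ↦ isCompact_chartValues 0 hsm (hK p).1 (hK p).2
  obtain ⟨B, hB⟩ := hc.bddAbove
  refine ⟨B, fun x ξ hξ ↦ ?_⟩
  obtain ⟨p, hp, hx, hxK⟩ := hs x
  have h1 := hB (Set.mem_biUnion hp (mem_chartValues 0 (fun x (_ : ℝ) ↦ φ x) hx hxK
    (Set.left_mem_Icc.2 zero_le_one) hξ))
  rw [testFun] at h1
  nlinarith [sq_nonneg ‖grad (𝓡 n) φ x‖]

/-- The maximum principle: an upper bound for the Hessian of solutions. -/
theorem exists_hess_le_of_controlledSolution {a : M → ℝ} {b : ℝ}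
    (ha : ContMDiff (𝓡 n) 𝓘(ℝ, ℝ) ∞ a) (hb : 0 ≤ b) {u₀ u₁ : M → ℝ}
    (hu₀ : ContMDiff (𝓡 n) 𝓘(ℝ, ℝ) ∞ u₀) (hu₁ : ContMDiff (𝓡 n) 𝓘(ℝ, ℝ) ∞ u₁)
    (K₁ K₃ K₅ K₆ : ℝ) :
    ∃ B : ℝ, 0 ≤ B ∧ ∀ f u : M → ℝ → ℝ,
      ControlledSolution (n := n) a b K₁ K₃ K₅ K₆ f u →
      (∀ x, u x 0 = u₀ x) → (∀ x, u x 1 = u₁ x) → ∀ x, ∀ t ∈ Set.Icc (0 : ℝ) 1,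
      ∀ ξ : TangentSpace (𝓡 n) x, ‖ξ‖ = 1 → hess (𝓡 n) (fun y ↦ u y t) x ξ ξ ≤ B := by
  obtain ⟨s, K, hK, hs⟩ := exists_finite_chart_cover (n := n) (M := M)
  obtain ⟨a₀, ha₀⟩ := (isCompact_range ha.continuous).bddAbove
  obtain ⟨B₀, hB₀⟩ := exists_hess_le hu₀
  obtain ⟨B₁, hB₁⟩ := exists_hess_le hu₁
  choose C hC using fun p ↦ exists_hess_le_of_interior_max (K := K p) ha hb
    (fun x ↦ ha₀ (Set.mem_range_self x)) K₁ K₃ K₅ K₆ p (hK p).1 (hK p).2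
  set D := (K₆ + K₁ * K₅) ^ 2 + 1 with hD
  have hD0 : 0 ≤ D := by positivity
  set B := ∑ p ∈ s, |C p| + |B₀| + |B₁| with hBdef
  have hsum : 0 ≤ ∑ p ∈ s, |C p| := Finset.sum_nonneg fun p _ ↦ abs_nonneg _
  -- The test function exceeds ∇²u(ξ,ξ) by an amount between 0 and K₁²/2 + D, so a bound `B` on the
  -- Hessian at the maximum point gives this bound everywhere.
  refine ⟨B + (1 / 2 * K₁ ^ 2 + D), by positivity, fun f u hfu h0 h1 ↦ ?_⟩
  have hvals : IsCompact (⋃ p ∈ s, chartValues D u p (K p)) :=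
    s.isCompact_biUnion fun p _ ↦ isCompact_chartValues D hfu.smooth (hK p).1 (hK p).2
  have hmem (x : M) (t : ℝ) (ht : t ∈ Set.Icc (0 : ℝ) 1) (ξ : TangentSpace (𝓡 n) x)
      (hξ : ‖ξ‖ = 1) : testFun D u x t ξ ∈ ⋃ p ∈ s, chartValues D u p (K p) := by
    obtain ⟨p, hp, hx, hxK⟩ := hs x
    exact Set.mem_biUnion hp (mem_chartValues D u hx hxK ht hξ)
  intro x t ht ξ hξ
  obtain ⟨r, hr, hmax⟩ := hvals.exists_isGreatest ⟨_, hmem x t ht ξ hξ⟩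
  suffices hrB : r ≤ B + (1 / 2 * K₁ ^ 2 + D) by
    have h2 := (hmax (hmem x t ht ξ hξ)).trans hrB
    rw [testFun] at h2
    have h3 : 0 ≤ D * t ^ 2 := by positivity
    nlinarith [sq_nonneg ‖grad (𝓡 n) (fun y ↦ u y t) x‖]
  simp only [Set.mem_iUnion] at hr
  obtain ⟨p, hp, ⟨⟨y, t₀⟩, v⟩, ⟨⟨hyK, ht₀⟩, hv⟩, rfl⟩ := hr
  beta_reduce at hmax hv ⊢
  have hy := (hK p).2 hyK
  obtain ⟨θ, hθ, rfl, rfl⟩ := exists_orthonormal_frame hy hv hyK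
  dsimp only at hmax ⊢
  rw [← testFun_normal_zero] at hmax ⊢
  have hξ₀ := norm_normalField_center hθ
  suffices hle : hess (𝓡 n) (fun y ↦ u y t₀) (normalPoint p θ 0) (normalField p θ 0 θ.2)
      (normalField p θ 0 θ.2) ≤ B by
    rw [testFun]
    have h2 := hfu.grad_le (normalPoint p θ 0) t₀ ht₀
    have h3 : ‖grad (𝓡 n) (fun y ↦ u y t₀) (normalPoint p θ 0)‖ ^ 2 ≤ K₁ ^ 2 := by gcongr
    have h4 : D * t₀ ^ 2 ≤ D * 1 :=
      mul_le_mul_of_nonneg_left (pow_le_one₀ ht₀.1 ht₀.2) hD0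
    linarith
  -- A maximum at time 0 or 1 is controlled by the boundary data, any other one by
  -- `exists_hess_le_of_interior_max`.
  rcases eq_or_lt_of_le ht₀.1 with h2 | h2
  · obtain rfl : (0 : ℝ) = t₀ := h2
    rw [show (fun y ↦ u y 0) = u₀ from funext h0]
    have := hB₀ _ _ hξ₀
    linarith [le_abs_self B₀, abs_nonneg B₁]
  rcases eq_or_lt_of_le ht₀.2 with h3 | h3
  · obtain rfl : t₀ = (1 : ℝ) := h3
    rw [show (fun y ↦ u y 1) = u₁ from funext h1]
    have := hB₁ _ _ hξ₀
    linarith [le_abs_self B₁, abs_nonneg B₀]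
  have h4 := hC p f u hfu θ hθ t₀ ⟨h2, h3⟩ fun x s hs ξ hξ ↦ hmax (hmem x s hs ξ hξ)
  have h5 : |C p| ≤ ∑ p ∈ s, |C p| :=
    Finset.single_le_sum (f := fun p ↦ |C p|) (fun p _ ↦ abs_nonneg _) hp
  linarith [le_abs_self (C p), abs_nonneg B₀, abs_nonneg B₁]

end MaximumPrinciple

end ChenHe

end

theorem theorem1p2 (n : ℕ) {M : Type*} [TopologicalSpace M] [T2Space M] [CompactSpace M]
    [ChartedSpace (EuclideanSpace ℝ (Fin n)) M] [IsManifold (𝓡 n) ∞ M]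
    [RiemannianBundle (fun x : M ↦ TangentSpace (𝓡 n) x)]
    [IsContMDiffRiemannianBundle (𝓡 n) ∞ (EuclideanSpace ℝ (Fin n))
      (fun x : M ↦ TangentSpace (𝓡 n) x)]
    (a : M → ℝ) (ha : ContMDiff (𝓡 n) 𝓘(ℝ, ℝ) ∞ a) (ha_pos : ∀ x, 0 < a x)
    (b : ℝ) (hb : 0 ≤ b)
    (u₀ u₁ : M → ℝ) (hu₀ : u₀ ∈ ChenHe.spaceH (𝓡 n) a b) (hu₁ : u₁ ∈ ChenHe.spaceH (𝓡 n) a b)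
    (K₁ K₂ K₃ K₄ K₅ K₆ : ℝ) :
    ∃ C : ℝ, ∀ f u : M → ℝ → ℝ,
      ChenHe.SmoothOnSlab (𝓡 n) f →
      (∀ x, ∀ t ∈ Set.Icc (0 : ℝ) 1, 0 < f x t) →
      ChenHe.SmoothOnSlab (𝓡 n) u →
      ChenHe.SolvesChenHe (𝓡 n) a b f u →
      (∀ t ∈ Set.Icc (0 : ℝ) 1, (fun x ↦ u x t) ∈ ChenHe.spaceH (𝓡 n) a b) →
      (∀ x, u x 0 = u₀ x) →
      (∀ x, u x 1 = u₁ x) →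
      (∀ x, ∀ t ∈ Set.Icc (0 : ℝ) 1, ‖ChenHe.grad (𝓡 n) (fun y ↦ u y t) x‖ ≤ K₁) →
      (∀ x, ∀ t ∈ Set.Icc (0 : ℝ) 1, |ChenHe.timeDeriv (ChenHe.timeDeriv u) x t| ≤ K₂) →
      (∀ x, ∀ t ∈ Set.Icc (0 : ℝ) 1, |ChenHe.laplacian (𝓡 n) (fun y ↦ u y t) x| ≤ K₃) →
      (∀ x, ∀ t ∈ Set.Icc (0 : ℝ) 1, f x t ≤ K₄) →
      (∀ x, ∀ t ∈ Set.Icc (0 : ℝ) 1, ‖ChenHe.grad (𝓡 n) (fun y ↦ √(f y t)) x‖ ≤ K₅) →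
      (∀ x, ∀ t ∈ Set.Icc (0 : ℝ) 1, ChenHe.hessNorm (𝓡 n) (fun y ↦ √(f y t)) x ≤ K₆) →
      ∀ x, ∀ t ∈ Set.Icc (0 : ℝ) 1, ChenHe.hessNorm (𝓡 n) (fun y ↦ u y t) x ≤ C := by
  obtain ⟨B, hB0, hB⟩ := ChenHe.exists_hess_le_of_controlledSolution ha hb hu₀.1 hu₁.1 K₁ K₃ K₅ K₆
  refine ⟨n * (3 * (n * B + B + K₃)), fun f u hf hfpos hu hsol hmem h0 h1 hg _ hl _ hg' hh x t ht ↦ ?_⟩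
  exact ChenHe.hessNorm_le_of_hess_le (hmem t ht).1 x hB0 (hl x t ht)
    (hB f u ⟨hf, hfpos, hu, hsol, hmem, hg, hl, hg', hh⟩ h0 h1 x t ht)
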